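/- Setting. Let $\Bbbk$ be a field, $\mathcal R=\Bbbk[x_1,x_2,x_3,x_4]$ with the graded reverse lexicographic (grevlex) order, $x_1\succ x_2\succ x_3\succ x_4$, let $n\ge 3$, and let $M$ be an $n\times n$ matrix whose entries are linear forms (homogeneous of degree $1$) of $\mathcal R$. Let $F=(f_1,\dots,f_{n^2})$ be the $(n-1)$-minors of $M$, listed in any order, let $I$ be the ideal they generate, and let $h_D=\dim_\Bbbk I_D$ be its Hilbert function. Assume that * $I$ is reverse lexicographic: $I\neq0$, and for every leading monomial $\tau\in\operatorname{LM}(I)$ all monomials $\sigma\succ\tau$ with $\deg\sigma=\deg\tau$ lie in $\operatorname{LM}(I)$; * $I$ has the generic Hilbert function: $h_D=n^2\binom{D+4-n}{3}-(2n^2-2)\binom{D+3-n}{3}+n^2\binom{D+2-n}{3}$ for $n-1\le D\le 2n-3$. The matrices. For $d\ge n-1$ let $\widetilde{\mathcal M}_d$ be the reduced row echelon form of the Macaulay matrix of $F$ in degree $d$ (columns: monomials of degree $d$ in decreasing order; rows: the products $\tau f_i$ with $\tau$ a monomial of degree $d-n+1$). Order the monomials $\tau e_i$ of $\mathcal R^{n^2}$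 by term over position: $\tau e_i\succ\sigma e_j$ iff $\tau\succ\sigma$, or $\tau=\sigma$ and $i>j$. The signature of a nonzero row $g$ of $\widetilde{\mathcal M}_d$ is the smallest $\operatorname{LM}(u)$ over the homogeneous $u\in\mathcal R^{n^2}$ such that $\sum_i u_if_i$ has the same leading monomial as $g$. The matrix $\mathcal M_{d+1}$ built by the algorithm DetGB has, for every nonzero row $g$ of $\widetilde{\mathcal M}_d$, with signature $\tau e_i$, and every variable $x_k$ such that no $x_l$ with $l>k$ divides $\tau$ and such that $x_k\tau e_i$ is not the leading monomial of a syzygy of $F$, the row of coefficients of $x_kg$. Block sizes. Put $$\alpha_{d+1}=\frac{(d-2n+3)(d-2n+2)}2,\qquad \beta_{d+1}=h_{d+1}-\alpha_{d+1},\qquad \gamma_{d+1}=\binom{d+4}3-\beta_{d+1}.$$ Cost. Computations are algebraic computation trees over $\Bbbk$: one arithmetic operation $+,-,\times,/$ of $\Bbbk$ or one zero test costs $1$; constants of $\Bbbk$ are free. Let $2\le\omega\le3$ be a complexity exponent for matrix multiplication over $\Bbbk$, i.e. for some constant $c$ and every $m$, two $m\times m$ matrices over $\Bbbk$ can be multiplied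 with at most $c\,m^\omega$ operations. Statement. For $n-1\le d\le 2n-3$, the reduced row echelon form of $\mathcal M_{d+1}$ can be computed from $\mathcal M_{d+1}$ with $$O\!\left(\beta_{d+1}^2\,\alpha_{d+1}^{\omega-2}+\alpha_{d+1}^{\omega-2}\,\beta_{d+1}\gamma_{d+1}\right)$$ operations in $\Bbbk$. Precisely, there is a constant $C$ depending only on $\omega$ and $c$ such that for every $\Bbbk$ as above, every $n\ge3$ and every $d$ in this range there is a computation tree (for the given number of rows of $\mathcal M_{d+1}$) which, for every $M$ as above and every order of the rows of $\mathcal M_{d+1}$, returns the reduced row echelon form of $\mathcal M_{d+1}$ with at most $C\left(\beta_{d+1}^2\alpha_{d+1}^{\omega-2}+\alpha_{d+1}^{\omega-2}\beta_{d+1}\gamma_{d+1}\right)$ operations. -/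

import Mathlib

open MvPolynomial

noncomputable section

namespace DetGB

/-! ### Arithmetic complexity: computation trees over a field -/

/-- The four arithmetic operations of a field. -/
inductive ArithOp
  | add
  | sub
  | mul
  | div

/-- What an instruction may read: an input entry, a memory cell, or a constant of the field. -/
inductive Operand (𝕜 ι : Type*)
  | input (i : ι)
  | cell (j : ℕ)
  | const (c : 𝕜)

/-- Algebraic computation trees with inputs indexed by `ι` and outputs indexed by `κ`.
A node either performs one arithmetic operation and stores the result in a memory cell, or
branches on whether a value is zero; a leaf returns the outputs. -/
inductive CompTree (𝕜 ι κ : Type*)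
  | output (f : κ → Operand 𝕜 ι)
  | compute (o : ArithOp) (a b : Operand 𝕜 ι) (dst : ℕ) (next : CompTree 𝕜 ι κ)
  | branch (a : Operand 𝕜 ι) (ifZero ifNonzero : CompTree 𝕜 ι κ)

/-- The value of an operand, given the input `x` and the memory `mem`. -/
def Operand.eval {𝕜 ι : Type*} (x : ι → 𝕜) (mem : ℕ → 𝕜) : Operand 𝕜 ι → 𝕜
  | .input i => x i
  | .cell j => mem j
  | .const c => c

open Classical in
/-- The result of an arithmetic operation; division by zero is undefined. -/
def ArithOp.apply {𝕜 : Type*} [Field 𝕜] : ArithOp → 𝕜 → 𝕜 → Option 𝕜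
  | .add, a, b => some (a + b)
  | .sub, a, b => some (a - b)
  | .mul, a, b => some (a * b)
  | .div, a, b => if b = 0 then none else some (a / b)

open Classical in
/-- Run a tree on the input `x` from the memory `mem`. The result is the family of outputs and
the number of steps on the path taken, where every arithmetic operation and every zero test
costs one step; it is `none` if a division by zero occurs. -/
def CompTree.run {𝕜 ι κ : Type*} [Field 𝕜] (x : ι → 𝕜) :
    CompTree 𝕜 ι κ → (ℕ → 𝕜) → Option ((κ → 𝕜) × ℕ)
  | .output f, mem => some (fun k => (f k).eval x mem, 0)
  | .compute o a b dst next, mem =>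
      (o.apply (a.eval x mem) (b.eval x mem)).bind fun v =>
        (next.run x (Function.update mem dst v)).map fun p => (p.1, p.2 + 1)
  | .branch a ifZero ifNonzero, mem =>
      (if a.eval x mem = 0 then ifZero.run x mem else ifNonzero.run x mem).map
        fun p => (p.1, p.2 + 1)

/-- On input `x`, the tree `t` returns `y` after `cost` steps (the memory is initially zero). -/
def CompTree.Computes {𝕜 ι κ : Type*} [Field 𝕜] (t : CompTree 𝕜 ι κ) (x : ι → 𝕜) (y : κ → 𝕜)
    (cost : ℕ) : Prop :=
  t.run x (fun _ => 0) = some (y, cost)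

/-- For every `m`, two `m × m` matrices over `𝕜` can be multiplied in at most `c * m ^ ω`
steps: `ω` is a complexity exponent for matrix multiplication over `𝕜`, with constant `c`. -/
def IsMatMulExponent (𝕜 : Type*) [Field 𝕜] (ω c : ℝ) : Prop :=
  ∀ m : ℕ, ∃ t : CompTree 𝕜 ((Fin m × Fin m) ⊕ (Fin m × Fin m)) (Fin m × Fin m),
    ∀ A B : Matrix (Fin m) (Fin m) 𝕜, ∃ cost : ℕ,
      t.Computes (Sum.elim (fun p => A p.1 p.2) (fun p => B p.1 p.2))
        (fun p => (A * B) p.1 p.2) cost ∧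
      (cost : ℝ) ≤ c * (m : ℝ) ^ ω

/-! ### Monomials and the graded reverse lexicographic order

The four variables are `X 0`, `X 1`, `X 2`, `X 3`, in decreasing order. -/

/-- `a ≺ b` in the graded reverse lexicographic order. -/
def GrevlexLT (a b : Fin 4 →₀ ℕ) : Prop :=
  a.degree < b.degree ∨
    (a.degree = b.degree ∧ ∃ i, b i < a i ∧ ∀ j, i < j → a j = b j)

/-- `m` is the leading monomial of the polynomial `f` (which is then nonzero). -/
def IsLM {𝕜 : Type*} [Field 𝕜] (f : MvPolynomial (Fin 4) 𝕜) (m : Fin 4 →₀ ℕ) : Prop :=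
  m ∈ f.support ∧ ∀ m' ∈ f.support, m' ≠ m → GrevlexLT m' m

/-- The leading monomials of the nonzero elements of an ideal. -/
def leadingMonomials {𝕜 : Type*} [Field 𝕜] (I : Ideal (MvPolynomial (Fin 4) 𝕜)) :
    Set (Fin 4 →₀ ℕ) :=
  {m | ∃ f ∈ I, IsLM f m}

/-- A nonzero ideal is reverse lexicographic if, with each leading monomial `τ`, every larger
monomial of the same degree is a leading monomial. -/
def IsReverseLex {𝕜 : Type*} [Field 𝕜] (I : Ideal (MvPolynomial (Fin 4) 𝕜)) : Prop :=
  I ≠ ⊥ ∧ ∀ τ ∈ leadingMonomials I, ∀ σ : Fin 4 →₀ ℕ,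
    σ.degree = τ.degree → GrevlexLT τ σ → σ ∈ leadingMonomials I

/-- The Hilbert function of an ideal: the dimension of its homogeneous part of degree `d`. -/
def hilbertFun {𝕜 : Type*} [Field 𝕜] (I : Ideal (MvPolynomial (Fin 4) 𝕜)) (d : ℕ) : ℕ :=
  Module.finrank 𝕜
    ↥(Submodule.restrictScalars 𝕜 I ⊓ homogeneousSubmodule (Fin 4) 𝕜 d)

/-- The monomials of degree `d`. -/
def MonDeg (d : ℕ) : Type :=
  {m : Fin 4 →₀ ℕ // m ∈ Finset.finsuppAntidiag (Finset.univ : Finset (Fin 4)) d}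

instance (d : ℕ) : Fintype (MonDeg d) :=
  inferInstanceAs (Fintype
    {m : Fin 4 →₀ ℕ // m ∈ Finset.finsuppAntidiag (Finset.univ : Finset (Fin 4)) d})

/-- The order of the columns of a Macaulay matrix: the columns are indexed by monomials in
decreasing grevlex order, so a column comes first if its monomial is larger. -/
instance (d : ℕ) : LT (MonDeg d) :=
  ⟨fun a b => GrevlexLT b.1 a.1⟩

/-! ### Macaulay matrices and reduced row echelon forms -/

/-- The polynomial represented by a row of a Macaulay matrix in degree `d`. -/
def rowPoly {𝕜 : Type*} [Field 𝕜] {d : ℕ} (v : MonDeg d → 𝕜) : MvPolynomial (Fin 4) 𝕜 :=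
  ∑ m : MonDeg d, monomial m.1 (v m)

/-- The Macaulay matrix in degree `d` of a family of forms of degree `δ ≤ d`: one row for each
product `τ * F i` with `τ` a monomial of degree `d - δ`. -/
def macaulay {𝕜 : Type*} [Field 𝕜] {s : ℕ} (F : Fin s → MvPolynomial (Fin 4) 𝕜) (δ d : ℕ) :
    Matrix (MonDeg (d - δ) × Fin s) (MonDeg d) 𝕜 :=
  fun p σ => coeff σ.1 (monomial p.1.1 (1 : 𝕜) * F p.2)

/-- `E` is a reduced row echelon form of `A`: it is in reduced row echelon form and has the
same row space. (It is unique up to the number of zero rows at the bottom.) -/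
def IsRREFOf {𝕜 ρ : Type*} [Field 𝕜] {q d : ℕ} (A : Matrix ρ (MonDeg d) 𝕜)
    (E : Matrix (Fin q) (MonDeg d) 𝕜) : Prop :=
  E.IsReducedRowEchelon ∧
    Submodule.span 𝕜 (Set.range fun i => E i) = Submodule.span 𝕜 (Set.range fun i => A i)

/-! ### Module monomials, syzygies and signatures

The pair `(τ, i)` stands for the monomial `τ e_i` of the free module with basis `e_i`. -/

/-- The term-over-position order on module monomials induced by grevlex. -/
def TopLT {s : ℕ} (t u : (Fin 4 →₀ ℕ) × Fin s) : Prop :=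
  GrevlexLT t.1 u.1 ∨ (t.1 = u.1 ∧ t.2 < u.2)

/-- `t` is the leading monomial of the module element `u` (which is then nonzero). -/
def IsModLM {𝕜 : Type*} [Field 𝕜] {s : ℕ} (u : Fin s → MvPolynomial (Fin 4) 𝕜)
    (t : (Fin 4 →₀ ℕ) × Fin s) : Prop :=
  coeff t.1 (u t.2) ≠ 0 ∧
    ∀ t' : (Fin 4 →₀ ℕ) × Fin s, coeff t'.1 (u t'.2) ≠ 0 → t' ≠ t → TopLT t' t

/-- The leading monomials of the syzygies of `F`. -/
def syzLM {𝕜 : Type*} [Field 𝕜] {s : ℕ} (F : Fin s → MvPolynomial (Fin 4) 𝕜) :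
    Set ((Fin 4 →₀ ℕ) × Fin s) :=
  {t | ∃ u : Fin s → MvPolynomial (Fin 4) 𝕜, ∑ i, u i * F i = 0 ∧ IsModLM u t}

/-- `t` is attained at the monomial `p`: some homogeneous module element with leading monomial
`t` is sent by `e_i ↦ F i` to a polynomial with leading monomial `p`. -/
def Attains {𝕜 : Type*} [Field 𝕜] {s : ℕ} (F : Fin s → MvPolynomial (Fin 4) 𝕜)
    (p : Fin 4 →₀ ℕ) (t : (Fin 4 →₀ ℕ) × Fin s) : Prop :=
  ∃ (e : ℕ) (u : Fin s → MvPolynomial (Fin 4) 𝕜),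
    (∀ i, (u i).IsHomogeneous e) ∧ IsModLM u t ∧ IsLM (∑ i, u i * F i) p

/-- `t` is the signature of the echelonized row `g`: the smallest signature at which the leading
monomial of `g` occurs. This is the label that the row with this leading monomial carries when
the rows are processed by increasing signature, each being reduced by rows of smaller
signature. -/
def IsSignature {𝕜 : Type*} [Field 𝕜] {s : ℕ} (F : Fin s → MvPolynomial (Fin 4) 𝕜)
    (g : MvPolynomial (Fin 4) 𝕜) (t : (Fin 4 →₀ ℕ) × Fin s) : Prop :=
  ∃ p, IsLM g p ∧ Attains F p t ∧ ∀ t', Attains F p t' → t' ≠ t → TopLT t t'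

/-! ### The matrix built by the algorithm -/

/-- The rows of the next Macaulay matrix. For a nonzero row `g` of the echelonized matrix `E` in
degree `d`, with signature `τ e_i`, the row `X k * g` is inserted for each `k` such that no
variable smaller than `X k` divides `τ`, unless `X k * τ e_i` is the leading monomial of a
syzygy. -/
def newRows {𝕜 : Type*} [Field 𝕜] {s q d : ℕ} (F : Fin s → MvPolynomial (Fin 4) 𝕜)
    (E : Matrix (Fin q) (MonDeg d) 𝕜) : Set (Fin q × Fin 4) :=
  {r | E r.1 ≠ 0 ∧ ∃ t, IsSignature F (rowPoly (E r.1)) t ∧ (∀ l ∈ t.1.support, l ≤ r.2) ∧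
    (t.1 + Finsupp.single r.2 1, t.2) ∉ syzLM F}

/-- `A` is the unreduced Macaulay matrix in degree `d + 1` that the algorithm builds for forms
`F` of degree `δ`, with its rows listed in some order. -/
def IsBuiltMatrix {𝕜 : Type*} [Field 𝕜] {s r : ℕ} (F : Fin s → MvPolynomial (Fin 4) 𝕜)
    (δ d : ℕ) (A : Matrix (Fin r) (MonDeg (d + 1)) 𝕜) : Prop :=
  ∃ (q : ℕ) (E : Matrix (Fin q) (MonDeg d) 𝕜), IsRREFOf (macaulay F δ d) E ∧
    ∃ e : Fin r ≃ newRows F E, ∀ (i : Fin r) (σ : MonDeg (d + 1)),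
      A i σ = coeff σ.1 (X (e i).1.2 * rowPoly (E (e i).1.1))

/-! ### Determinantal ideals -/

/-- The minor of size `n - 1` given by increasing selections of rows and columns. -/
def minor {𝕜 : Type*} [Field 𝕜] {n : ℕ} (M : Matrix (Fin n) (Fin n) (MvPolynomial (Fin 4) 𝕜))
    (p : (Fin (n - 1) ↪o Fin n) × (Fin (n - 1) ↪o Fin n)) : MvPolynomial (Fin 4) 𝕜 :=
  (M.submatrix p.1 p.2).det

/-- The ideal generated by the minors of size `n - 1`. -/
def detIdeal {𝕜 : Type*} [Field 𝕜] {n : ℕ}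
    (M : Matrix (Fin n) (Fin n) (MvPolynomial (Fin 4) 𝕜)) : Ideal (MvPolynomial (Fin 4) 𝕜) :=
  Ideal.span (Set.range (minor M))

/-- The Hilbert function of `I` in the degrees from `n - 1` to `2 n - 3` is the one of the ideal
of `(n - 1)`-minors of a generic `n × n` matrix of linear forms in four variables. -/
def HasGenericHilbertFun {𝕜 : Type*} [Field 𝕜] (n : ℕ) (I : Ideal (MvPolynomial (Fin 4) 𝕜)) :
    Prop :=
  ∀ D : ℕ, n - 1 ≤ D → D ≤ 2 * n - 3 →
    (hilbertFun I D : ℤ) =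
      (n : ℤ) ^ 2 * ((D + 4 - n).choose 3 : ℤ)
        - (2 * (n : ℤ) ^ 2 - 2) * ((D + 3 - n).choose 3 : ℤ)
        + (n : ℤ) ^ 2 * ((D + 2 - n).choose 3 : ℤ)

/-- The block size `α_{d+1}`. -/
def alphaSucc (n d : ℕ) : ℝ :=
  ((d : ℝ) - 2 * n + 3) * ((d : ℝ) - 2 * n + 2) / 2

/-- The block size `β_{d+1} = h_{d+1} - α_{d+1}`, with `h` the Hilbert function of `I`. -/
def betaSucc {𝕜 : Type*} [Field 𝕜] (n d : ℕ) (I : Ideal (MvPolynomial (Fin 4) 𝕜)) : ℝ :=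
  (hilbertFun I (d + 1) : ℝ) - alphaSucc n d

/-- The block size `γ_{d+1} = binom (d + 4) 3 - β_{d+1}`. -/
def gammaSucc {𝕜 : Type*} [Field 𝕜] (n d : ℕ) (I : Ideal (MvPolynomial (Fin 4) 𝕜)) : ℝ :=
  ((d + 4).choose 3 : ℝ) - betaSucc n d I

end DetGB

end

/-! Call the exponent of `X 3` the level of a monomial, and put e = 2n-3-d and a = 2(d+2-n), so that
d+1 = a+e. For n-1 ≤ D ≤ 2n-3 the generic Hilbert function satisfies h_D + binom(2n-1-D, 3) =
binom(D+3, 3), and the first binomial counts the monomials of degree D of level at least 2(D+2-n).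
In grevlex a larger monomial of the same degree has at most the same level. So the leading monomials
of a reverse lexicographic ideal with this Hilbert function are exactly those of level below
2(D+2-n) (`mem_leadingMonomials_iff_lastExp_lt`).

Therefore a nonzero row of the reduced matrix in degree d has its pivot at level below a and all
other terms at level at least a. After multiplication by a variable the matrix is almost in echelon
form (`IsNearEchelon`). Each row has an entry 1 at a pivot of level at most a, and its other entries
have level at least a, even above a if the pivot has level a. Every column of level at most a occurs
as a pivot, because the product with the last variable of that monomial always survives the syzygy
test (`notMem_syzLM_of_low`). By the same test the number of rows is at most h_{d+1}
(`IsBuiltMatrix.card_rows_le`).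

For e ≥ 1, β counts the columns of level at most a, γ = binom(e+2, 3) those of level above a, and α
= binom(e+1, 2) those of level a+1. So there are β pivot rows, found by zero tests alone, and at
most α other rows. The pivot rows are reduced by each other with one matrix product, and a Schur
complement leaves at most α rows on γ columns. These are eliminated on the α columns of level a+1
only: no leading monomial in degree d+1 has a higher level, so rows that vanish there are zero. A
back substitution ends the reduction (`can_reduce`).

The rectangular products, cut into blocks of size α, cost O(α^(ω-2) βγ). The elimination uses e
panels of e columns and costs O(e^5 α^(ω-2)), which suffices since e^2 ≤ 2β and e^3 ≤ 6γ. For e = 0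
every column is a pivot and the answer is a constant. -/

noncomputable section

namespace DetGB

/-! ### Computations on a set of instances

A computation is described semantically: `P` is the set of instances that can still occur at a
node of a computation tree, and `K` is a set of functions of the instance whose values have
already been computed. -/

section Computation

variable {𝕜 S : Type*}

/-- On the instances in `P`, the function `f` is constant or agrees with a function in `K`. -/
def Known (P : Set S) (K : Set (S → 𝕜)) (f : S → 𝕜) : Prop :=
  (∃ a, ∀ s ∈ P, f s = a) ∨ ∃ g ∈ K, ∀ s ∈ P, f s = g s

theorem Known.mono {P P' : Set S} {K K' : Set (S → 𝕜)} {f : S → 𝕜} (h : Known P K f)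
    (hP : P' ⊆ P) (hK : K ⊆ K') : Known P' K' f := by
  rcases h with ⟨a, ha⟩ | ⟨g, hg, h⟩
  · exact .inl ⟨a, fun s hs => ha s (hP hs)⟩
  · exact .inr ⟨g, hK hg, fun s hs => h s (hP hs)⟩

theorem Known.of_mem {P : Set S} {K : Set (S → 𝕜)} {f : S → 𝕜} (h : f ∈ K) : Known P K f :=
  .inr ⟨f, h, fun _ _ => rfl⟩

theorem Known.const {P : Set S} {K : Set (S → 𝕜)} (a : 𝕜) : Known P K (fun _ => a) :=
  .inl ⟨a, fun _ _ => rfl⟩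

theorem Known.congr {P : Set S} {K : Set (S → 𝕜)} {f g : S → 𝕜} (h : Known P K f)
    (hfg : ∀ s ∈ P, g s = f s) : Known P K g := by
  rcases h with ⟨a, ha⟩ | ⟨k, hk, h⟩
  · exact .inl ⟨a, fun s hs => (hfg s hs).trans (ha s hs)⟩
  · exact .inr ⟨k, hk, fun s hs => (hfg s hs).trans (h s hs)⟩

/-- The memory cell `j` of an operand satisfies `j < N`. -/
def Operand.Below {ι : Type*} (N : ℕ) : Operand 𝕜 ι → Prop
  | .cell j => j < N
  | _ => True

theorem Operand.Below.mono {ι : Type*} {N N' : ℕ} {o : Operand 𝕜 ι} (h : o.Below N)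
    (hN : N ≤ N') : o.Below N' := by
  cases o <;> simp_all [Operand.Below]; omega

theorem Operand.Below.eval_update {ι : Type*} {N : ℕ} {o : Operand 𝕜 ι} (h : o.Below N)
    (x : ι → 𝕜) (mem : ℕ → 𝕜) (v : 𝕜) :
    o.eval x (Function.update mem N v) = o.eval x mem := by
  cases o with
  | cell j =>
    have : j ≠ N := Nat.ne_of_lt h
    simp [Operand.eval, this]
  | _ => rfl

theorem exists_operand {ι : Type*} {P : Set S} {K : Set (S → 𝕜)} {x : S → ι → 𝕜} {N : ℕ}
    {mem : S → ℕ → 𝕜}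
    (hmem : ∀ f ∈ K, ∃ o : Operand 𝕜 ι, o.Below N ∧ ∀ s ∈ P, o.eval (x s) (mem s) = f s)
    {f : S → 𝕜} (hf : Known P K f) :
    ∃ o : Operand 𝕜 ι, o.Below N ∧ ∀ s ∈ P, o.eval (x s) (mem s) = f s := by
  rcases hf with ⟨a, ha⟩ | ⟨g, hg, h⟩
  · exact ⟨.const a, trivial, fun s hs => (ha s hs).symm⟩
  · obtain ⟨o, ho, h'⟩ := hmem g hg
    exact ⟨o, ho, fun s hs => (h' s hs).trans (h s hs).symm⟩

theorem Known.eval {ι : Type*} {P : Set S} {K : Set (S → 𝕜)} {inp : ι → S → 𝕜}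
    {mem : ℕ → S → 𝕜} (hinp : ∀ i, Known P K (inp i)) (hmem : ∀ j, Known P K (mem j))
    (o : Operand 𝕜 ι) : Known P K fun s => o.eval (fun i => inp i s) fun j => mem j s := by
  cases o with
  | input i => exact hinp i
  | cell j => exact hmem j
  | const a => exact .const a

variable [Field 𝕜]

/-- From the functions `K` on the instances `P`, at most `c` steps suffice to reach, along every
path, a situation `P'`, `K'` in which `Q P' K'` holds (unless no instance is left). -/
inductive Can (Q : Set S → Set (S → 𝕜) → Prop) : Set S → Set (S → 𝕜) → ℕ → Prop
  | done {P : Set S} {K : Set (S → 𝕜)} {c : ℕ} : Q P K → Can Q P K c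
  | empty {P : Set S} {K : Set (S → 𝕜)} {c : ℕ} : P = ∅ → Can Q P K c
  | compute {P : Set S} {K : Set (S → 𝕜)} {c : ℕ} (o : ArithOp) (f g h : S → 𝕜) :
      Known P K f → Known P K g → (∀ s ∈ P, o.apply (f s) (g s) = some (h s)) →
      Can Q P (insert h K) c → Can Q P K (c + 1)
  | branch {P : Set S} {K : Set (S → 𝕜)} {c : ℕ} (f : S → 𝕜) : Known P K f →
      Can Q {s ∈ P | f s = 0} K c → Can Q {s ∈ P | f s ≠ 0} K c → Can Q P K (c + 1)

theorem Can.mono_cost {Q : Set S → Set (S → 𝕜) → Prop} {P : Set S} {K : Set (S → 𝕜)}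
    {c c' : ℕ} (h : Can Q P K c) (hc : c ≤ c') : Can Q P K c' := by
  induction h generalizing c' with
  | done h => exact .done h
  | empty h => exact .empty h
  | compute o f g h hf hg hh _ ih =>
    obtain ⟨k, rfl⟩ : ∃ k, c' = k + 1 := ⟨c' - 1, by omega⟩
    exact .compute o f g h hf hg hh (ih (by omega))
  | branch f hf _ _ ih₁ ih₂ =>
    obtain ⟨k, rfl⟩ : ∃ k, c' = k + 1 := ⟨c' - 1, by omega⟩
    exact .branch f hf (ih₁ (by omega)) (ih₂ (by omega))

theorem Can.bind {Q Q' : Set S → Set (S → 𝕜) → Prop} {P : Set S} {K : Set (S → 𝕜)}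
    {c c' : ℕ} (h : Can Q P K c)
    (hQ : ∀ P' K', P' ⊆ P → K ⊆ K' → Q P' K' → Can Q' P' K' c') : Can Q' P K (c + c') := by
  induction h with
  | done h => exact (hQ _ _ subset_rfl subset_rfl h).mono_cost (by omega)
  | empty h => exact .empty h
  | @compute P K c o f g h hf hg hh _ ih =>
    rw [Nat.add_right_comm]
    exact .compute o f g h hf hg hh
      (ih fun P' K' hP hK => hQ P' K' hP ((Set.subset_insert _ _).trans hK))
  | @branch P K c f hf _ _ ih₁ ih₂ =>
    rw [Nat.add_right_comm]
    exact .branch f hf (ih₁ fun P' K' hP hK => hQ P' K' (hP.trans (Set.sep_subset _ _)) hK)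
      (ih₂ fun P' K' hP hK => hQ P' K' (hP.trans (Set.sep_subset _ _)) hK)

/-- Weaken the goal of a computation, remembering that instances are only discarded and known
functions are only added. -/
theorem Can.imp {Q Q' : Set S → Set (S → 𝕜) → Prop} {P : Set S} {K : Set (S → 𝕜)}
    {c : ℕ} (h : Can Q P K c)
    (hQ : ∀ P' K', P' ⊆ P → K ⊆ K' → Q P' K' → Q' P' K') : Can Q' P K c :=
  h.bind (c' := 0) fun P' K' hP hK hq => .done (hQ P' K' hP hK hq)

theorem Can.op {P : Set S} {K : Set (S → 𝕜)} (o : ArithOp) {f g h : S → 𝕜}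
    (hf : Known P K f) (hg : Known P K g) (hh : ∀ s ∈ P, o.apply (f s) (g s) = some (h s)) :
    Can (fun P' K' => Known P' K' h) P K 1 :=
  .compute o f g h hf hg hh (.done (.of_mem (Set.mem_insert _ _)))

/-- Reach finitely many stable goals one after the other. -/
theorem Can.all {κ : Type*} [Fintype κ] {Q : κ → Set S → Set (S → 𝕜) → Prop}
    (hQ : ∀ {k P K P' K'}, P' ⊆ P → K ⊆ K' → Q k P K → Q k P' K') {P : Set S}
    {K : Set (S → 𝕜)} {c : ℕ}
    (hc : ∀ k P' K', P' ⊆ P → K ⊆ K' → Can (Q k) P' K' c) :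
    Can (fun P' K' => ∀ k, Q k P' K') P K (Fintype.card κ * c) := by
  classical
  have key : ∀ T : Finset κ, Can (fun P' K' => ∀ k ∈ T, Q k P' K') P K (T.card * c) := by
    intro T
    induction T using Finset.induction_on with
    | empty => exact .done (by simp)
    | insert a T ha ih =>
      rw [Finset.card_insert_of_notMem ha, Nat.add_mul, Nat.one_mul]
      refine ih.bind fun P' K' hP hK hT => ?_
      refine (hc a P' K' hP hK).imp fun P'' K'' hP' hK' ha' k hk => ?_
      rcases Finset.mem_insert.1 hk with rfl | hk
      · exact ha'
      · exact hQ hP' hK' (hT k hk)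
  exact (key Finset.univ).imp fun P' K' _ _ hk k => hk k (Finset.mem_univ k)

/-- Decide for each function of a finite family whether it vanishes. -/
theorem Can.test_family {κ : Type*} [Fintype κ] {P : Set S} {K : Set (S → 𝕜)}
    (h : κ → S → 𝕜) (hK : ∀ k, Known P K (h k)) :
    Can (fun P' _ => ∃ Z : Set κ, ∀ s ∈ P', ∀ k, h k s = 0 ↔ k ∈ Z) P K (Fintype.card κ) := by
  classical
  have key : ∀ T : Finset κ, Can (fun P' _ => ∃ Z : Set κ, ∀ s ∈ P', ∀ k ∈ T, h k s = 0 ↔ k ∈ Z)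
      P K T.card := by
    intro T
    induction T using Finset.induction_on with
    | empty => exact .done (by simp)
    | insert a T ha ih =>
      rw [Finset.card_insert_of_notMem ha]
      refine ih.bind fun P' K' hP hKK hT => ?_
      obtain ⟨Z, hZ⟩ := hT
      refine .branch (c := 0) (h a) ((hK a).mono hP hKK)
        (.done ⟨insert a Z, fun s hs k hk => ?_⟩) (.done ⟨Z \ {a}, fun s hs k hk => ?_⟩)
      · rcases Finset.mem_insert.1 hk with rfl | hk'
        · simpa using hs.2
        · rw [hZ s hs.1 k hk', Set.mem_insert_iff, or_iff_right]
          rintro rfl; exact ha hk'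
      · rcases Finset.mem_insert.1 hk with rfl | hk'
        · simpa using hs.2
        · rw [hZ s hs.1 k hk', Set.mem_sdiff, Set.mem_singleton_iff, and_iff_left]
          rintro rfl; exact ha hk'
  exact (key Finset.univ).imp fun P' K' _ _ ⟨Z, hZ⟩ =>
    ⟨Z, fun s hs k => hZ s hs k (Finset.mem_univ k)⟩

/-- Each computed value goes to the fresh cell `N`. The operands for known functions only read cells
below `N`, so nothing that is still needed is overwritten. `N` and `mem` are arbitrary to make the
induction work. -/
theorem Can.exists_tree_of_mem {ι κ : Type*} {Q : Set S → Set (S → 𝕜) → Prop} {P : Set S}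
    {K : Set (S → 𝕜)} {c : ℕ} (hcan : Can Q P K c) (x : S → ι → 𝕜)
    (spec : S → (κ → 𝕜) → Prop)
    (hQ : ∀ P' K', Q P' K' → ∃ h : κ → S → 𝕜, (∀ k, Known P' K' (h k)) ∧
      ∀ s ∈ P', spec s fun k => h k s) (N : ℕ) (mem : S → ℕ → 𝕜)
    (hmem : ∀ f ∈ K, ∃ o : Operand 𝕜 ι, o.Below N ∧ ∀ s ∈ P, o.eval (x s) (mem s) = f s) :
    ∃ t : CompTree 𝕜 ι κ, ∀ s ∈ P, ∃ y cost,
      t.run (x s) (mem s) = some (y, cost) ∧ spec s y ∧ cost ≤ c := by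
  induction hcan generalizing N mem with
  | @done P K c h =>
    obtain ⟨h, hK, hs⟩ := hQ _ _ h
    choose o ho using fun k => exists_operand hmem (hK k)
    refine ⟨.output o, fun s hs' => ⟨_, 0, rfl, ?_, Nat.zero_le _⟩⟩
    simpa only [(ho _).2 s hs'] using hs s hs'
  | empty h => exact ⟨.output fun _ => .const 0, by simp [h]⟩
  | @compute P K c o f g h hf hg hh _ ih =>
    obtain ⟨a, ha, ha'⟩ := exists_operand hmem hf
    obtain ⟨b, hb, hb'⟩ := exists_operand hmem hg
    obtain ⟨t, ht⟩ := ih (N + 1) (fun s => Function.update (mem s) N (h s)) (by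
      intro k hk
      rcases Set.mem_insert_iff.1 hk with rfl | hk
      · exact ⟨.cell N, Nat.lt_succ_self N, fun s _ => by simp [Operand.eval]⟩
      · obtain ⟨o, ho, ho'⟩ := hmem k hk
        exact ⟨o, ho.mono (Nat.le_succ N), fun s hs => by rw [ho.eval_update, ho' s hs]⟩)
    refine ⟨.compute o a b N t, fun s hs => ?_⟩
    obtain ⟨y, cost, hrun, hy, hc⟩ := ht s hs
    refine ⟨y, cost + 1, ?_, hy, by omega⟩
    simp [CompTree.run, ha' s hs, hb' s hs, hh s hs, hrun]
  | @branch P K c f hf _ _ ih₁ ih₂ =>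
    obtain ⟨a, ha, ha'⟩ := exists_operand hmem hf
    obtain ⟨t₁, ht₁⟩ := ih₁ N mem fun k hk => (hmem k hk).imp fun o ho =>
      ⟨ho.1, fun s hs => ho.2 s hs.1⟩
    obtain ⟨t₂, ht₂⟩ := ih₂ N mem fun k hk => (hmem k hk).imp fun o ho =>
      ⟨ho.1, fun s hs => ho.2 s hs.1⟩
    refine ⟨.branch a t₁ t₂, fun s hs => ?_⟩
    by_cases h0 : f s = 0
    · obtain ⟨y, cost, hrun, hy, hc⟩ := ht₁ s ⟨hs, h0⟩
      refine ⟨y, cost + 1, ?_, hy, by omega⟩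
      simp [CompTree.run, ha' s hs, h0, hrun]
    · obtain ⟨y, cost, hrun, hy, hc⟩ := ht₂ s ⟨hs, h0⟩
      refine ⟨y, cost + 1, ?_, hy, by omega⟩
      simp [CompTree.run, ha' s hs, h0, hrun]

/-- A computation that starts from the inputs only is realized by a computation tree. -/
theorem Can.exists_tree {ι κ : Type*} {P : Set S} {c : ℕ} (x : S → ι → 𝕜)
    (spec : S → (κ → 𝕜) → Prop)
    (hcan : Can (fun P' K' => ∃ h : κ → S → 𝕜, (∀ k, Known P' K' (h k)) ∧
      ∀ s ∈ P', spec s fun k => h k s) P (Set.range fun i s => x s i) c) :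
    ∃ t : CompTree 𝕜 ι κ, ∀ s ∈ P, ∃ y cost,
      t.Computes (x s) y cost ∧ spec s y ∧ cost ≤ c :=
  hcan.exists_tree_of_mem x spec (fun _ _ h => h) 0 (fun _ _ => 0) (by
    rintro _ ⟨i, rfl⟩
    exact ⟨.input i, trivial, fun s _ => rfl⟩)

/-- Run a computation tree on known functions. -/
theorem Can.run {ι κ : Type*} (t : CompTree 𝕜 ι κ) {P : Set S} {K : Set (S → 𝕜)} {c : ℕ}
    (inp : ι → S → 𝕜) (mem : ℕ → S → 𝕜) (out : κ → S → 𝕜)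
    (hinp : ∀ i, Known P K (inp i)) (hmem : ∀ j, Known P K (mem j))
    (ht : ∀ s ∈ P, ∃ cost ≤ c, t.run (fun i => inp i s) (fun j => mem j s) =
      some (fun k => out k s, cost)) :
    Can (fun P' K' => ∀ k, Known P' K' (out k)) P K c := by
  classical
  induction t generalizing P K c mem with
  | output f =>
    refine .done fun k => (Known.eval hinp hmem (f k)).congr fun s hs => ?_
    obtain ⟨cost, -, h⟩ := ht s hs
    simp only [CompTree.run, Option.some.injEq, Prod.mk.injEq] at h
    exact (congrFun h.1 k).symm
  | compute o a b dst next ih =>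
    -- The bound `c` is seen to be positive only through the run on some instance, so the empty set
    -- is treated apart.
    rcases P.eq_empty_or_nonempty with rfl | ⟨s₀, hs₀⟩
    · exact .empty rfl
    have hv : ∀ s ∈ P, ∃ v cost, o.apply (a.eval (fun i => inp i s) fun j => mem j s)
        (b.eval (fun i => inp i s) fun j => mem j s) = some v ∧ cost + 1 ≤ c ∧
        next.run (fun i => inp i s) (Function.update (fun j => mem j s) dst v) =
          some (fun k => out k s, cost) := by
      intro s hs
      obtain ⟨cost, hc, h⟩ := ht s hs
      simp only [CompTree.run, Option.bind_eq_some_iff, Option.map_eq_some_iff] at h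
      obtain ⟨v, hv, p, hp, hp'⟩ := h
      simp only [Prod.mk.injEq] at hp'
      refine ⟨v, p.2, hv, by omega, ?_⟩
      rw [hp, ← hp'.1]
    obtain ⟨c, rfl⟩ : ∃ k, c = k + 1 := by
      obtain ⟨_, _, _, h, _⟩ := hv s₀ hs₀
      exact ⟨c - 1, by omega⟩
    -- The result of the operation as a function of the instance; the value 0 outside `P` is
    -- irrelevant.
    let v : S → 𝕜 := fun s => if h : s ∈ P then (hv s h).choose else 0
    have hv' : ∀ s ∈ P, ∃ cost, o.apply (a.eval (fun i => inp i s) fun j => mem j s)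
        (b.eval (fun i => inp i s) fun j => mem j s) = some (v s) ∧ cost + 1 ≤ c + 1 ∧
        next.run (fun i => inp i s) (Function.update (fun j => mem j s) dst (v s)) =
          some (fun k => out k s, cost) := by
      intro s hs
      simpa only [v, dif_pos hs] using (hv s hs).choose_spec
    refine .compute o _ _ v (Known.eval hinp hmem a) (Known.eval hinp hmem b)
      (fun s hs => (hv' s hs).choose_spec.1) ?_
    have hmono : K ⊆ insert v K := Set.subset_insert _ _
    refine ih (Function.update mem dst v) (fun i => (hinp i).mono subset_rfl hmono)
      (fun j => ?_) fun s hs => ?_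
    · rcases eq_or_ne j dst with rfl | hj
      · simpa using Known.of_mem (Set.mem_insert v K)
      · simpa [hj] using (hmem j).mono subset_rfl hmono
    · obtain ⟨cost, -, hc, h⟩ := hv' s hs
      refine ⟨cost, by omega, ?_⟩
      rw [← h]
      congr 1
      funext j
      rcases eq_or_ne j dst with rfl | hj <;> simp [*]
  | branch a t₁ t₂ ih₁ ih₂ =>
    rcases P.eq_empty_or_nonempty with rfl | ⟨s₀, hs₀⟩
    · exact .empty rfl
    have hv : ∀ s ∈ P, ∃ cost, cost + 1 ≤ c ∧
        (if a.eval (fun i => inp i s) (fun j => mem j s) = 0 then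
          t₁.run (fun i => inp i s) (fun j => mem j s) else
          t₂.run (fun i => inp i s) (fun j => mem j s)) = some (fun k => out k s, cost) := by
      intro s hs
      obtain ⟨cost, hc, h⟩ := ht s hs
      simp only [CompTree.run, Option.map_eq_some_iff] at h
      obtain ⟨p, hp, hp'⟩ := h
      simp only [Prod.mk.injEq] at hp'
      refine ⟨p.2, by omega, ?_⟩
      rw [← hp'.1]
      exact hp
    obtain ⟨c, rfl⟩ : ∃ k, c = k + 1 := by
      obtain ⟨_, h, _⟩ := hv s₀ hs₀
      exact ⟨c - 1, by omega⟩
    refine .branch _ (Known.eval hinp hmem a) ?_ ?_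
    · refine ih₁ mem (fun i => (hinp i).mono (Set.sep_subset _ _) subset_rfl)
        (fun i => (hmem i).mono (Set.sep_subset _ _) subset_rfl) fun s hs => ?_
      obtain ⟨cost, hc, h⟩ := hv s hs.1
      exact ⟨cost, by omega, by rwa [if_pos hs.2] at h⟩
    · refine ih₂ mem (fun i => (hinp i).mono (Set.sep_subset _ _) subset_rfl)
        (fun i => (hmem i).mono (Set.sep_subset _ _) subset_rfl) fun s hs => ?_
      obtain ⟨cost, hc, h⟩ := hv s hs.1
      exact ⟨cost, by omega, by rwa [if_neg hs.2] at h⟩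

end Computation

/-! ### Matrix arithmetic and blockwise multiplication -/

section MatrixOperations

variable {𝕜 S : Type*}

/-- All entries of the matrix `X` are known. -/
def KnownMat {m n : Type*} (P : Set S) (K : Set (S → 𝕜)) (X : S → Matrix m n 𝕜) : Prop :=
  ∀ i j, Known P K fun s => X s i j

theorem KnownMat.mono {m n : Type*} {P P' : Set S} {K K' : Set (S → 𝕜)} {X : S → Matrix m n 𝕜}
    (h : KnownMat P K X) (hP : P' ⊆ P) (hK : K ⊆ K') : KnownMat P' K' X :=
  fun i j => (h i j).mono hP hK

theorem KnownMat.congr {m n : Type*} {P : Set S} {K : Set (S → 𝕜)} {X Y : S → Matrix m n 𝕜}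
    (h : KnownMat P K X) (hXY : ∀ s ∈ P, Y s = X s) : KnownMat P K Y :=
  fun i j => (h i j).congr fun s hs => by rw [hXY s hs]

variable [Field 𝕜]

theorem Can.sum {κ : Type*} (T : Finset κ) {P : Set S} {K : Set (S → 𝕜)} (f : κ → S → 𝕜)
    (hf : ∀ k ∈ T, Known P K (f k)) :
    Can (fun P' K' => Known P' K' fun s => ∑ k ∈ T, f k s) P K T.card := by
  classical
  induction T using Finset.induction_on with
  | empty => exact .done (by simpa using Known.const 0)
  | insert a T ha ih =>
    rw [Finset.card_insert_of_notMem ha]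
    refine (ih fun k hk => hf k (Finset.mem_insert_of_mem hk)).bind fun P' K' hP hK h => ?_
    exact .op .add ((hf a (Finset.mem_insert_self a T)).mono hP hK) h fun s _ => by
      simp [ArithOp.apply, Finset.sum_insert ha]

theorem Can.sub_mat {m n : Type*} [Fintype m] [Fintype n] {P : Set S} {K : Set (S → 𝕜)}
    {X Y : S → Matrix m n 𝕜} (hX : KnownMat P K X) (hY : KnownMat P K Y) :
    Can (fun P' K' => KnownMat P' K' fun s => X s - Y s) P K
      (Fintype.card m * Fintype.card n) := by
  have h := Can.all (Q := fun (k : m × n) P' K' => Known P' K' fun s => (X s - Y s) k.1 k.2)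
    (P := P) (K := K) (c := 1) (fun hP hK h => h.mono hP hK) fun k P' K' hP hK =>
      .op .sub ((hX k.1 k.2).mono hP hK) ((hY k.1 k.2).mono hP hK) fun s _ => rfl
  rw [Fintype.card_prod, mul_one] at h
  exact h.imp fun P' K' _ _ h i j => h (i, j)

theorem Can.add_mat {m n : Type*} [Fintype m] [Fintype n] {P : Set S} {K : Set (S → 𝕜)}
    {X Y : S → Matrix m n 𝕜} (hX : KnownMat P K X) (hY : KnownMat P K Y) :
    Can (fun P' K' => KnownMat P' K' fun s => X s + Y s) P K
      (Fintype.card m * Fintype.card n) := by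
  have h := Can.all (Q := fun (k : m × n) P' K' => Known P' K' fun s => (X s + Y s) k.1 k.2)
    (P := P) (K := K) (c := 1) (fun hP hK h => h.mono hP hK) fun k P' K' hP hK =>
      .op .add ((hX k.1 k.2).mono hP hK) ((hY k.1 k.2).mono hP hK) fun s _ => rfl
  rw [Fintype.card_prod, mul_one] at h
  exact h.imp fun P' K' _ _ h i j => h (i, j)

/-- Two `b × b` matrices can be multiplied with at most `μ` steps. -/
def HasMulTree (𝕜 : Type*) [Field 𝕜] (b μ : ℕ) : Prop :=
  ∃ t : CompTree 𝕜 ((Fin b × Fin b) ⊕ (Fin b × Fin b)) (Fin b × Fin b),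
    ∀ A B : Matrix (Fin b) (Fin b) 𝕜, ∃ cost ≤ μ,
      t.Computes (Sum.elim (fun p => A p.1 p.2) (fun p => B p.1 p.2))
        (fun p => (A * B) p.1 p.2) cost

theorem IsMatMulExponent.hasMulTree {ω c : ℝ} (h : IsMatMulExponent 𝕜 ω c) (b : ℕ) :
    HasMulTree 𝕜 b ⌊c * (b : ℝ) ^ ω⌋₊ := by
  obtain ⟨t, ht⟩ := h b
  refine ⟨t, fun A B => ?_⟩
  obtain ⟨cost, h1, h2⟩ := ht A B
  exact ⟨cost, Nat.le_floor h2, h1⟩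

theorem HasMulTree.can {b μ : ℕ} (h : HasMulTree 𝕜 b μ) {P : Set S} {K : Set (S → 𝕜)}
    {X Y : S → Matrix (Fin b) (Fin b) 𝕜} (hX : KnownMat P K X) (hY : KnownMat P K Y) :
    Can (fun P' K' => KnownMat P' K' fun s => X s * Y s) P K μ := by
  obtain ⟨t, ht⟩ := h
  have := Can.run t (P := P) (K := K) (c := μ)
    (Sum.elim (fun p s => X s p.1 p.2) fun p s => Y s p.1 p.2) (fun _ _ => 0)
    (fun p s => (X s * Y s) p.1 p.2) (by rintro (p | p); exacts [hX _ _, hY _ _])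
    (fun _ => .const 0) fun s _ => by
      obtain ⟨cost, hc, h⟩ := ht (X s) (Y s)
      refine ⟨cost, hc, ?_⟩
      rw [← h]
      congr 1
      funext p
      cases p <;> rfl
  exact this.imp fun P' K' _ _ h i j => h (i, j)

/-- There are pqt block products, and each of the ptb² entries of the result is a sum of q terms.
The additions account for the b² next to μ. -/
theorem HasMulTree.can_blocks {b μ : ℕ} (h : HasMulTree 𝕜 b μ) {p q t : ℕ} {P : Set S}
    {K : Set (S → 𝕜)} {X : S → Matrix (Fin p × Fin b) (Fin q × Fin b) 𝕜}
    {Y : S → Matrix (Fin q × Fin b) (Fin t × Fin b) 𝕜}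
    (hX : KnownMat P K X) (hY : KnownMat P K Y) :
    Can (fun P' K' => KnownMat P' K' fun s => X s * Y s) P K (p * q * t * (μ + b ^ 2)) := by
  let Z : (Fin p × Fin q × Fin t) → S → Matrix (Fin b) (Fin b) 𝕜 := fun k s =>
    (Matrix.of fun i j => X s (k.1, i) (k.2.1, j)) * Matrix.of fun i j => Y s (k.2.1, i) (k.2.2, j)
  have h₁ := Can.all (Q := fun k P' K' => KnownMat P' K' (Z k)) (P := P) (K := K) (c := μ)
    (fun hP hK h => h.mono hP hK) fun k P' K' hP hK =>
      h.can (fun i j => (hX _ _).mono hP hK) fun i j => (hY _ _).mono hP hK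
  refine Can.mono_cost (h₁.bind (c' := p * t * b ^ 2 * q) fun P' K' hP hK hZ => ?_) (le_of_eq ?_)
  · have h₂ := Can.all (Q := fun (k : (Fin p × Fin b) × (Fin t × Fin b)) P' K' =>
        Known P' K' fun s => (X s * Y s) k.1 k.2) (P := P') (K := K') (c := q)
      (fun hP hK h => h.mono hP hK) fun k P'' K'' hP' hK' => by
        have := Can.sum (P := P'') (K := K'') (Finset.univ : Finset (Fin q))
          (fun u s => Z (k.1.1, u, k.2.1) s k.1.2 k.2.2) fun u _ =>
            (hZ (k.1.1, u, k.2.1) k.1.2 k.2.2).mono hP' hK'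
        rw [Finset.card_univ, Fintype.card_fin] at this
        refine this.imp fun _ _ _ _ h => h.congr fun s _ => ?_
        simp only [Z, Matrix.mul_apply, Matrix.of_apply, Fintype.sum_prod_type]
    refine (h₂.imp fun P' K' _ _ h i j => h (i, j)).mono_cost (le_of_eq ?_)
    simp only [Fintype.card_prod, Fintype.card_fin]
    ring
  · simp only [Fintype.card_prod, Fintype.card_fin]
    ring

open Classical in
/-- Extend a matrix by zeros along injections of the index types. -/
def padMat {m n m' n' : Type*} (f : m → m') (g : n → n') (X : Matrix m n 𝕜) : Matrix m' n' 𝕜 :=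
  fun u v => if h : (∃ i, f i = u) ∧ ∃ j, g j = v then X h.1.choose h.2.choose else 0

theorem padMat_apply {m n m' n' : Type*} {f : m → m'} {g : n → n'} (hf : f.Injective)
    (hg : g.Injective) (X : Matrix m n 𝕜) (i : m) (j : n) : padMat f g X (f i) (g j) = X i j := by
  have h : (∃ i', f i' = f i) ∧ ∃ j', g j' = g j := ⟨⟨i, rfl⟩, j, rfl⟩
  rw [padMat, dif_pos h, hf h.1.choose_spec, hg h.2.choose_spec]

theorem padMat_apply_of_notMem {m n m' n' : Type*} {f : m → m'} {g : n → n'}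
    (X : Matrix m n 𝕜) (u : m') {v : n'} (hv : v ∉ Set.range g) : padMat f g X u v = 0 :=
  dif_neg fun h => hv h.2

theorem KnownMat.pad {m n m' n' : Type*} {P : Set S} {K : Set (S → 𝕜)} {X : S → Matrix m n 𝕜}
    (h : KnownMat P K X) (f : m → m') (g : n → n') :
    KnownMat P K fun s => padMat f g (X s) := by
  intro u v
  by_cases huv : (∃ i, f i = u) ∧ ∃ j, g j = v
  · simpa only [padMat, dif_pos huv] using h _ _
  · simpa only [padMat, dif_neg huv] using Known.const 0

/-- Rectangular matrices are multiplied by cutting them into blocks of size `b`. -/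
theorem HasMulTree.can_mul {b μ : ℕ} (h : HasMulTree 𝕜 b μ) {m n l : Type*} [Fintype m]
    [Fintype n] [Fintype l] {p q t : ℕ} (hm : Fintype.card m ≤ p * b)
    (hn : Fintype.card n ≤ q * b) (hl : Fintype.card l ≤ t * b) {P : Set S} {K : Set (S → 𝕜)}
    {X : S → Matrix m n 𝕜} {Y : S → Matrix n l 𝕜} (hX : KnownMat P K X) (hY : KnownMat P K Y) :
    Can (fun P' K' => KnownMat P' K' fun s => X s * Y s) P K (p * q * t * (μ + b ^ 2)) := by
  obtain ⟨f⟩ : Nonempty (m ↪ Fin p × Fin b) := Function.Embedding.nonempty_of_card_le (by simpa)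
  obtain ⟨g⟩ : Nonempty (n ↪ Fin q × Fin b) := Function.Embedding.nonempty_of_card_le (by simpa)
  obtain ⟨k⟩ : Nonempty (l ↪ Fin t × Fin b) := Function.Embedding.nonempty_of_card_le (by simpa)
  refine (h.can_blocks (hX.pad f g) (hY.pad g k)).imp fun P' K' _ _ h i j =>
    (h (f i) (k j)).congr fun s _ => ?_
  change (X s * Y s) i j = (padMat f g (X s) * padMat g k (Y s)) (f i) (k j)
  rw [Matrix.mul_apply, Matrix.mul_apply]
  refine Fintype.sum_of_injective g g.injective _ _ (fun v hv => ?_) fun v => ?_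
  · rw [padMat_apply_of_notMem _ _ hv, zero_mul]
  · rw [padMat_apply f.injective g.injective, padMat_apply g.injective k.injective]

end MatrixOperations

/-! ### Gaussian elimination by panels of columns -/

section Elimination

variable {𝕜 S ρ : Type*} [Field 𝕜] [DecidableEq ρ]

/-- The first `t` columns of `X` are in reduced form: the rows in `R` have their pivots in the
columns given by `π`, and the other rows vanish. -/
structure ReducedUpTo {k : ℕ} (X : Matrix ρ (Fin k) 𝕜) (R : Finset ρ) (π : ρ → Fin k) (t : ℕ) :
    Prop where
  lt : ∀ i ∈ R, (π i : ℕ) < t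
  pivot : ∀ i ∈ R, ∀ j, X j (π i) = if j = i then 1 else 0
  zero : ∀ i ∉ R, ∀ c : Fin k, (c : ℕ) < t → X i c = 0
  left : ∀ i ∈ R, ∀ c : Fin k, c < π i → X i c = 0

theorem ReducedUpTo.succ_of_zero {k t : ℕ} {X : Matrix ρ (Fin k) 𝕜} {R : Finset ρ}
    {π : ρ → Fin k} (h : ReducedUpTo X R π t) 
    (hz : ∀ c : Fin k, (c : ℕ) = t → ∀ i ∉ R, X i c = 0) : ReducedUpTo X R π (t + 1) where
  lt i hi := (h.lt i hi).trans (Nat.lt_succ_self t)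
  pivot := h.pivot
  zero i hi c hc := by
    rcases Nat.lt_succ_iff_lt_or_eq.1 hc with hc | hc
    · exact h.zero i hi c hc
    · exact hz c hc i hi
  left := h.left

/-- Row `r` vanishes to the left of `c`, so adding multiples of it leaves the earlier columns alone.
The multipliers are those that turn column `c` into the unit vector at `r`. -/
theorem ReducedUpTo.succ_of_pivot {k : ℕ} {X X' : Matrix ρ (Fin k) 𝕜} {R : Finset ρ}
    {π : ρ → Fin k} {c : Fin k} (h : ReducedUpTo X R π c) {r : ρ} (hr : r ∉ R)
    (hX : X r c ≠ 0)
    (hX' : ∀ i j, X' i j = X i j + ((if i = r then 1 else 0) - X i c) / X r c * X r j) :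
    ReducedUpTo X' (insert r R) (Function.update π r c) (c + 1) := by
  have hold : ∀ i (j : Fin k), (j : ℕ) < c → X' i j = X i j := fun i j hj => by
    rw [hX', h.zero r hr j hj, mul_zero, add_zero]
  have hnew : ∀ i, X' i c = if i = r then 1 else 0 := fun i => by
    rw [hX', div_mul_cancel₀ _ hX]; ring
  have hπ : ∀ i ∈ R, Function.update π r c i = π i := fun i hi =>
    Function.update_of_ne (by rintro rfl; exact hr hi) _ _
  constructor
  · intro i hi
    rcases Finset.mem_insert.1 hi with rfl | hi
    · simp
    · rw [hπ i hi]; exact (h.lt i hi).trans (Nat.lt_succ_self _)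
  · intro i hi j
    rcases Finset.mem_insert.1 hi with rfl | hi
    · simpa using hnew j
    · rw [hπ i hi, hold _ _ (h.lt i hi), h.pivot i hi]
  · intro i hi j hj
    rw [Finset.mem_insert, not_or] at hi
    rcases Nat.lt_succ_iff_lt_or_eq.1 hj with hj | hj
    · rw [hold _ _ hj, h.zero i hi.2 j hj]
    · rw [Fin.ext hj, hnew, if_neg hi.1]
  · intro i hi j hj
    rcases Finset.mem_insert.1 hi with rfl | hi
    · rw [Function.update_self] at hj
      rw [hold _ _ hj, h.zero i hr j hj]
    · rw [hπ i hi] at hj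
      rw [hold _ _ (lt_trans (show (j : ℕ) < π i from hj) (h.lt i hi)), h.left i hi j hj]

variable [Fintype ρ]

/-- The state of the elimination of a panel: `1 + W` transforms `X` into a matrix that is reduced
up to column `t`, and `W` vanishes outside the columns `R \ R₀`. -/
def PanelState {k : ℕ} (X : S → Matrix ρ (Fin k) 𝕜) (R₀ : Finset ρ) (t j : ℕ) (P : Set S)
    (K : Set (S → 𝕜)) : Prop :=
  ∃ (W : S → Matrix ρ ρ 𝕜) (R : Finset ρ) (π : ρ → Fin k),
    KnownMat P K W ∧ R₀ ⊆ R ∧ (R \ R₀).card ≤ j ∧ ∀ s ∈ P,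
      IsUnit (1 + W s) ∧ (∀ i, ∀ l ∉ R \ R₀, W s i l = 0) ∧
      ReducedUpTo ((1 + W s) * X s) R π t

theorem isUnit_one_add_vecMulVec {w : ρ → 𝕜} {r : ρ} (h : 1 + w r ≠ 0) :
    IsUnit (1 + Matrix.vecMulVec w (Pi.single r 1) : Matrix ρ ρ 𝕜) := by
  rw [Matrix.isUnit_iff_isUnit_det, Matrix.vecMulVec_eq Unit,
    Matrix.det_one_add_replicateCol_mul_replicateRow]
  simpa using h

/-- `X` itself is not updated inside a panel. Only the column that is reached is transformed, from
the fewer than b nonzero columns of `W`. Per row this takes 2b+1 steps, the zero test 1, the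
multiplier 2, and the update of `W` 2b. The set `R₀` contains the pivot rows of earlier panels. -/
theorem PanelState.step {k b : ℕ} {X : S → Matrix ρ (Fin k) 𝕜} {R₀ : Finset ρ} {t j : ℕ}
    {P : Set S} {K : Set (S → 𝕜)} (h : PanelState X R₀ t j P K) (hX : KnownMat P K X)
    (hj : j < b) :
    Can (PanelState X R₀ (t + 1) (j + 1)) P K (Fintype.card ρ * (4 * b + 4)) := by
  obtain ⟨W, R, π, hW, hR, hcard, hs⟩ := h
  rcases Nat.lt_or_ge t k with htk | htk
  swap
  -- The panels may extend beyond the last column; there is nothing to do there.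
  · refine .done ⟨W, R, π, hW, hR, by omega, fun s hsP => ⟨(hs s hsP).1, (hs s hsP).2.1, ?_⟩⟩
    exact (hs s hsP).2.2.succ_of_zero fun c hc => absurd c.2 (by omega)
  obtain ⟨c, hc⟩ : ∃ c : Fin k, (c : ℕ) = t := ⟨⟨t, htk⟩, rfl⟩
  have hN : (R \ R₀).card ≤ b := by omega
  let v : ρ → S → 𝕜 := fun i s => ((1 + W s) * X s : Matrix ρ (Fin k) 𝕜) i c
  have hv : ∀ i, ∀ s ∈ P, v i s = X s i c + ∑ l ∈ R \ R₀, W s i l * X s l c := by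
    intro i s hsP
    change ((1 + W s) * X s : Matrix ρ (Fin k) 𝕜) i c = _
    rw [Matrix.add_mul, Matrix.one_mul, Matrix.add_apply, Matrix.mul_apply]
    congr 1
    refine (Finset.sum_subset (Finset.subset_univ _) fun l _ hl => ?_).symm
    rw [(hs s hsP).2.1 i l hl, zero_mul]
  have h₁ : Can (fun P' K' => ∀ i, Known P' K' (v i)) P K (Fintype.card ρ * (2 * b + 1)) := by
    refine Can.all (fun hP hK h => h.mono hP hK) fun i P' K' hP hK => ?_
    have hm := Can.all (Q := fun (l : ↥(R \ R₀)) P' K' =>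
        Known P' K' fun s => W s i l * X s l c) (P := P') (K := K') (c := 1)
      (fun hP hK h => h.mono hP hK) fun l P'' K'' hP' hK' =>
        .op .mul ((hW i l).mono (hP'.trans hP) (hK.trans hK'))
          ((hX l c).mono (hP'.trans hP) (hK.trans hK')) fun s _ => rfl
    rw [Fintype.card_coe, mul_one] at hm
    refine Can.mono_cost (hm.bind (c' := (R \ R₀).card + 1) fun P₁ K₁ hP₁ hK₁ h₁ => ?_) (by omega)
    refine (Can.sum (R \ R₀) (fun l s => W s i l * X s l c) fun l hl => h₁ ⟨l, hl⟩).bind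
      fun P₂ K₂ hP₂ hK₂ h₂ => ?_
    refine Can.op .add ((hX i c).mono ((hP₂.trans hP₁).trans hP) ((hK.trans hK₁).trans hK₂)) h₂
      fun s hs' => ?_
    rw [hv i s (hP (hP₁ (hP₂ hs')))]
    rfl
  refine Can.mono_cost (h₁.bind (c' := Fintype.card ρ + Fintype.card ρ * (2 * b + 2))
    fun P₁ K₁ hP₁ hK₁ hv₁ => ?_) (by ring_nf; omega)
  refine (Can.test_family v hv₁).bind fun P₂ K₂ hP₂ hK₂ hZ => ?_
  obtain ⟨Z, hZ⟩ := hZ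
  -- After the zero tests the pattern of the column is the same for all remaining instances, so one
  -- pivot row serves them all.
  by_cases hpiv : ∃ r ∉ R, r ∉ Z
  swap
  · push Not at hpiv
    refine .done ⟨W, R, π, hW.mono (hP₂.trans hP₁) (hK₁.trans hK₂), hR, by omega, fun s hsP => ?_⟩
    obtain ⟨hu, hsupp, hred⟩ := hs s (hP₁ (hP₂ hsP))
    refine ⟨hu, hsupp, hred.succ_of_zero fun c' hc' i hi => ?_⟩
    obtain rfl : c' = c := Fin.ext (hc'.trans hc.symm)
    exact (hZ s hsP i).2 (hpiv i hi)
  obtain ⟨r, hrR, hrZ⟩ := hpiv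
  have hvr : ∀ s ∈ P₂, v r s ≠ 0 := fun s hsP h0 => hrZ ((hZ s hsP r).1 h0)
  let w : ρ → S → 𝕜 := fun i s => ((if i = r then 1 else 0) - v i s) / v r s
  have h₂ : Can (fun P' K' => ∀ i, Known P' K' (w i)) P₂ K₂ (Fintype.card ρ * 2) := by
    refine Can.all (fun hP hK h => h.mono hP hK) fun i P' K' hP hK => ?_
    refine (Can.op .sub (h := fun s => (if i = r then 1 else 0) - v i s)
      (Known.const (if i = r then (1 : 𝕜) else 0))
      (((hv₁ i).mono hP₂ hK₂).mono hP hK) fun s _ => rfl).bind (c := 1) (c' := 1)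
        fun P'' K'' hP' hK' h => ?_
    refine Can.op .div h (((hv₁ r).mono hP₂ hK₂).mono (hP'.trans hP) (hK.trans hK')) fun s hs' => ?_
    simp [ArithOp.apply, w, hvr s (hP (hP' hs'))]
  refine Can.mono_cost (h₂.bind (c' := Fintype.card ρ * (2 * b))
    fun P₃ K₃ hP₃ hK₃ hw => ?_) (by ring_nf; omega)
  have hP30 : P₃ ⊆ P := hP₃.trans (hP₂.trans hP₁)
  have hK03 : K ⊆ K₃ := hK₁.trans (hK₂.trans hK₃)
  -- Chosen so that 1 + W' = (1 + w e_rᵀ)(1 + W): the new elimination step composed with the earlier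
  -- ones.
  let W' : S → Matrix ρ ρ 𝕜 := fun s =>
    W s + Matrix.vecMulVec (fun i => w i s) fun l => (1 + W s) r l
  have hrN : r ∉ R \ R₀ := fun h => hrR (Finset.mem_sdiff.1 h).1
  have h₃ : Can (fun P' K' => KnownMat P' K' W') P₃ K₃ (Fintype.card ρ * (2 * b)) := by
    have := Can.all (Q := fun (q : ρ × ↥(R \ R₀)) P' K' =>
        Known P' K' fun s => W s q.1 q.2 + w q.1 s * W s r q.2) (P := P₃) (K := K₃) (c := 2)
      (fun hP hK h => h.mono hP hK) fun q P' K' hP hK => by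
        refine (Can.op .mul ((hw q.1).mono hP hK)
          ((hW r q.2).mono (hP.trans hP30) (hK03.trans hK)) fun s _ => rfl).bind (c := 1) (c' := 1)
            fun P'' K'' hP' hK' h => ?_
        exact Can.op .add ((hW q.1 q.2).mono (hP'.trans (hP.trans hP30))
          (hK03.trans (hK.trans hK'))) h fun s _ => rfl
    refine (this.imp fun P' K' hP hK hq i l => ?_).mono_cost ?_
    · by_cases hl : l ∈ R \ R₀
      · refine (hq (i, ⟨l, hl⟩)).congr fun s hs' => ?_
        have : r ≠ l := by rintro rfl; exact hrN hl
        simp [W', Matrix.vecMulVec_apply, this]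
      -- Column `r` of `W` is still zero, so the new column is `w` itself and needs no operation.
      · by_cases hlr : l = r
        · subst hlr
          refine ((hw i).mono hP hK).congr fun s hs' => ?_
          have h0 := (hs s (hP30 (hP hs'))).2.1
          simp [W', Matrix.vecMulVec_apply, h0 _ _ hl]
        · refine (Known.const 0).congr fun s hs' => ?_
          have h0 := (hs s (hP30 (hP hs'))).2.1
          simp [W', Matrix.vecMulVec_apply, h0 _ _ hl, Ne.symm hlr]
    · rw [Fintype.card_prod, Fintype.card_coe, Nat.mul_assoc, Nat.mul_comm _ 2]
      gcongr
  refine h₃.imp fun P₄ K₄ hP₄ hK₄ hW' => ?_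
  refine ⟨W', insert r R, Function.update π r c, hW', hR.trans (Finset.subset_insert _ _), ?_,
    fun s hsP => ?_⟩
  · rw [← Finset.singleton_union, Finset.union_sdiff_distrib]
    refine (Finset.card_union_le _ _).trans ?_
    have : ({r} \ R₀).card ≤ 1 := (Finset.card_le_card Finset.sdiff_subset).trans (by simp)
    omega
  obtain ⟨hu, hsupp, hred⟩ := hs s (hP30 (hP₄ hsP))
  have hvr' : v r s ≠ 0 := hvr s (hP₃ (hP₄ hsP))
  have hfac : 1 + W' s = (1 + Matrix.vecMulVec (fun i => w i s) (Pi.single r 1)) * (1 + W s) := by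
    rw [Matrix.add_mul, Matrix.one_mul, ← add_assoc]
    congr 1
    ext i l
    simp [Matrix.vecMulVec_apply, Matrix.mul_apply, Pi.single_apply]
  refine ⟨?_, fun i l hl => ?_, ?_⟩
  · rw [hfac]
    refine (isUnit_one_add_vecMulVec ?_).mul hu
    have : 1 + w r s = 1 / v r s := by
      simp only [w, if_true]
      field_simp
      ring
    rw [this]
    exact one_div_ne_zero hvr'
  · have hl' : l ∉ R \ R₀ := fun h => hl (Finset.sdiff_subset_sdiff (Finset.subset_insert _ _)
      subset_rfl h)
    have hlr : r ≠ l := by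
      rintro rfl
      exact hl (Finset.mem_sdiff.2 ⟨Finset.mem_insert_self _ _, fun h => hrR (hR h)⟩)
    simp [W', Matrix.vecMulVec_apply, hsupp _ _ hl', hlr]
  · rw [← hc]
    refine ReducedUpTo.succ_of_pivot (by rw [hc]; exact hred) hrR hvr' fun i l => ?_
    rw [hfac, Matrix.mul_assoc, Matrix.add_mul, Matrix.one_mul, Matrix.add_apply]
    congr 1
    rw [Matrix.mul_apply]
    simp [Matrix.vecMulVec_apply, Pi.single_apply, w, v]

theorem PanelState.iterate {k b : ℕ} {X : S → Matrix ρ (Fin k) 𝕜} {R₀ : Finset ρ} {t : ℕ}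
    {P : Set S} {K : Set (S → 𝕜)} (h : PanelState X R₀ t 0 P K) (hX : KnownMat P K X) {j : ℕ}
    (hj : j ≤ b) :
    Can (PanelState X R₀ (t + j) j) P K (j * (Fintype.card ρ * (4 * b + 4))) := by
  induction j with
  | zero => exact .done h
  | succ j ih =>
    rw [Nat.add_mul, Nat.one_mul]
    exact (ih (by omega)).bind fun P' K' hP hK h' => h'.step (hX.mono hP hK) hj

/-- The state of the elimination of `Y`: an invertible matrix `V` is known for which `V * Y` is
reduced up to column `t`. -/
def EliminationState {k : ℕ} (Y : S → Matrix ρ (Fin k) 𝕜) (t : ℕ) (P : Set S)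
    (K : Set (S → 𝕜)) : Prop :=
  ∃ (V : S → Matrix ρ ρ 𝕜) (R : Finset ρ) (π : ρ → Fin k),
    KnownMat P K V ∧ KnownMat P K (fun s => V s * Y s) ∧ ∀ s ∈ P,
      IsUnit (V s) ∧ ReducedUpTo (V s * Y s) R π t

/-- Multiplication by `1 + W`, where `W` has few nonzero columns. -/
theorem HasMulTree.can_one_add_mul {b μ : ℕ} (hmul : HasMulTree 𝕜 b μ) {n : Type*} [Fintype n]
    {p : ℕ} (hρ : Fintype.card ρ ≤ p * b) (hn : Fintype.card n ≤ p * b) {P : Set S}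
    {K : Set (S → 𝕜)} {W : S → Matrix ρ ρ 𝕜} {N : Finset ρ} (hN : N.card ≤ b)
    (hsupp : ∀ s ∈ P, ∀ i, ∀ l ∉ N, W s i l = 0) {X : S → Matrix ρ n 𝕜}
    (hW : KnownMat P K W) (hX : KnownMat P K X) :
    Can (fun P' K' => KnownMat P' K' fun s => (1 + W s) * X s) P K
      (p ^ 2 * (μ + b ^ 2) + (p * b) ^ 2) := by
  have h₁ := hmul.can_mul (n := N) (p := p) (q := 1) (t := p) hρ (by simpa using hN) hn
    (P := P) (K := K) (X := fun s => (W s).submatrix id Subtype.val)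
    (Y := fun s => (X s).submatrix Subtype.val id) (fun i j => hW _ _) fun i j => hX _ _
  refine Can.mono_cost (h₁.bind (c' := Fintype.card ρ * Fintype.card n) fun P' K' hP hK h => ?_) ?_
  · refine (Can.add_mat (hX.mono hP hK) h).imp fun P'' K'' hP' _ h => h.congr fun s hs => ?_
    rw [Matrix.add_mul, Matrix.one_mul]
    congr 1
    ext i j
    rw [Matrix.mul_apply, Matrix.mul_apply]
    refine (Fintype.sum_of_injective (Subtype.val : N → ρ) Subtype.val_injective _ _
      (fun l hl => ?_) fun l => rfl).symm
    rw [hsupp s (hP (hP' hs)) i l (by simpa using hl), zero_mul]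
  · have : Fintype.card ρ * Fintype.card n ≤ (p * b) * (p * b) := Nat.mul_le_mul hρ hn
    nlinarith

/-- A panel of b columns produces a `W` with at most b nonzero columns. Its effect on `V` and on `V
* Y` is applied afterwards, by two products of inner dimension b. -/
theorem EliminationState.panel {b μ : ℕ} (hmul : HasMulTree 𝕜 b μ) {k : ℕ}
    {Y : S → Matrix ρ (Fin k) 𝕜} {t p : ℕ} (hρ : Fintype.card ρ ≤ p * b) (hk : k ≤ p * b)
    {P : Set S} {K : Set (S → 𝕜)} (h : EliminationState Y t P K) :
    Can (EliminationState Y (t + b)) P K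
      (b * (p * b * (4 * b + 4)) + 2 * (p ^ 2 * (μ + b ^ 2) + (p * b) ^ 2)) := by
  obtain ⟨V, R₀, π₀, hV, hX, hs⟩ := h
  have h₁ : PanelState (fun s => V s * Y s) R₀ t 0 P K :=
    ⟨fun _ => 0, R₀, π₀, fun _ _ => .const 0, subset_rfl, by simp, fun s hsP => by
      simpa using (hs s hsP).2⟩
  refine Can.mono_cost ((h₁.iterate hX (le_refl b)).bind (c' := (p ^ 2 * (μ + b ^ 2) + (p * b) ^ 2) +
    (p ^ 2 * (μ + b ^ 2) + (p * b) ^ 2)) fun P₁ K₁ hP₁ hK₁ h₁ => ?_) ?_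
  · obtain ⟨W, R, π, hW, -, hcard, hs'⟩ := h₁
    refine (hmul.can_one_add_mul hρ hρ hcard (fun s hsP => (hs' s hsP).2.1) hW
      (hV.mono hP₁ hK₁)).bind fun P₂ K₂ hP₂ hK₂ h₂ => ?_
    refine (hmul.can_one_add_mul hρ (by simpa using hk) hcard
      (fun s hsP => (hs' s (hP₂ hsP)).2.1) (hW.mono hP₂ hK₂)
      ((hX.mono hP₁ hK₁).mono hP₂ hK₂)).imp fun P₃ K₃ hP₃ hK₃ h₃ => ?_
    refine ⟨fun s => (1 + W s) * V s, R, π, h₂.mono hP₃ hK₃, ?_, fun s hsP => ?_⟩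
    · exact h₃.congr fun s _ => Matrix.mul_assoc _ _ _
    · have := hs' s (hP₂ (hP₃ hsP))
      refine ⟨this.1.mul (hs s (hP₁ (hP₂ (hP₃ hsP)))).1, ?_⟩
      rw [Matrix.mul_assoc]
      exact this.2.2
  · rw [← two_mul]
    gcongr

/-- With p = b = e the cost is of order e^5 + e^3 μ. This is good enough here, so no recursive
elimination with the exponent ω is needed. -/
theorem HasMulTree.can_eliminate {b μ : ℕ} (hmul : HasMulTree 𝕜 b μ) {k : ℕ}
    {Y : S → Matrix ρ (Fin k) 𝕜} {p : ℕ} (hρ : Fintype.card ρ ≤ p * b) (hk : k ≤ p * b)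
    (hk0 : 0 < k) {P : Set S} {K : Set (S → 𝕜)} (hY : KnownMat P K Y) :
    Can (EliminationState Y (p * b)) P K
      (p * (b * (p * b * (4 * b + 4)) + 2 * (p ^ 2 * (μ + b ^ 2) + (p * b) ^ 2))) := by
  have key : ∀ q : ℕ, Can (EliminationState Y (q * b)) P K
      (q * (b * (p * b * (4 * b + 4)) + 2 * (p ^ 2 * (μ + b ^ 2) + (p * b) ^ 2))) := by
    intro q
    induction q with
    | zero =>
      refine .done ⟨fun _ => 1, ∅, fun _ => ⟨0, hk0⟩, fun i j => .const _, ?_, fun s _ => ?_⟩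
      · simpa using hY
      · refine ⟨isUnit_one, ?_⟩
        constructor <;> simp
    | succ q ih =>
      rw [Nat.add_mul, Nat.one_mul, Nat.add_mul, Nat.one_mul]
      exact ih.bind fun P' K' _ _ h => h.panel hmul hρ hk
  exact key p

end Elimination

/-! ### Reduced row echelon forms from pivots -/

section Echelon

variable {𝕜 C : Type*} [Field 𝕜]

/-- Rows with distinct pivot columns can be listed by increasing pivot column, followed by zero
rows. -/
theorem exists_row_order [LinearOrder C] {J : Type*} [Fintype J] (piv : J → C)
    (hpiv : piv.Injective) {r : ℕ} (hr : Fintype.card J ≤ r) :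
    ∃ σ : Fin r → Option J, (∀ j, ∃ i, σ i = some j) ∧
      ∀ i i' j', i < i' → σ i' = some j' → ∃ j, σ i = some j ∧ piv j < piv j' := by
  let _ : LinearOrder J := LinearOrder.lift' piv hpiv
  let iso : Fin (Fintype.card J) ≃o J := Fintype.orderIsoFinOfCardEq J rfl
  refine ⟨fun i => if h : (i : ℕ) < Fintype.card J then some (iso ⟨i, h⟩) else none,
    fun j => ⟨⟨iso.symm j, (iso.symm j).2.trans_le hr⟩, ?_⟩, fun i i' j' hi h => ?_⟩
  · simp
  · by_cases h' : (i' : ℕ) < Fintype.card J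
    · simp only [dif_pos h', Option.some.injEq] at h
      have hi' : (i : ℕ) < Fintype.card J := lt_trans (show (i : ℕ) < i' from hi) h'
      refine ⟨iso ⟨i, hi'⟩, dif_pos hi', ?_⟩
      rw [← h]
      exact iso.strictMono (show (⟨i, hi'⟩ : Fin _) < ⟨i', h'⟩ from hi)
    · simp [dif_neg h'] at h

/-- The rows are sorted by pivot, so `hzero` is required only above a pivot; below it the entries
vanish by `hleft`. -/
theorem isReducedRowEchelon_of_pivots [LinearOrder C] {J : Type*} {piv : J → C} {r : ℕ}
    {σ : Fin r → Option J}
    (hσ : ∀ i i' j', i < i' → σ i' = some j' → ∃ j, σ i = some j ∧ piv j < piv j')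
    {w : J → C → 𝕜} (hone : ∀ j, w j (piv j) = 1)
    (hzero : ∀ j j', piv j < piv j' → w j (piv j') = 0)
    (hleft : ∀ j, ∀ c < piv j, w j c = 0) :
    Matrix.IsReducedRowEchelon (Matrix.of fun i c => (σ i).elim 0 fun j => w j c) := by
  have hlead : ∀ {i c}, Matrix.IsLeadingEntry
      (Matrix.of fun (i : Fin r) c => (σ i).elim 0 fun j => w j c) i c →
      ∃ j, σ i = some j ∧ c = piv j := by
    rintro i c ⟨h1, h2⟩
    rcases hi : σ i with _ | j
    · simp [hi] at h2
    · simp only [Matrix.of_apply, hi, Option.elim_some] at h1 h2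
      refine ⟨j, rfl, le_antisymm (not_lt.1 fun h => ?_) (not_lt.1 fun h => h2 (hleft j c h))⟩
      have := h1 _ h
      rw [hone] at this
      exact one_ne_zero this
  constructor
  · intro i₁ i₂ hi c hc
    rcases hi₂ : σ i₂ with _ | j₂
    · simp [hi₂]
    · obtain ⟨j₁, hj₁, hlt⟩ := hσ i₁ i₂ j₂ hi hi₂
      simp only [Matrix.of_apply, hi₂, hj₁, Option.elim_some] at hc ⊢
      refine hleft j₂ c (lt_of_le_of_lt (not_lt.1 fun h => ?_) hlt)
      have := hc _ h
      rw [hone] at this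
      exact one_ne_zero this
  · intro i c h
    obtain ⟨j, hj, rfl⟩ := hlead h
    simp [hj, hone]
  · intro i₁ i₂ c hi h
    obtain ⟨j₂, hj₂, rfl⟩ := hlead h
    obtain ⟨j₁, hj₁, hlt⟩ := hσ i₁ i₂ j₂ hi hj₂
    simp [hj₁, hzero _ _ hlt]

theorem span_range_option_elim {J : Type*} {r : ℕ} {σ : Fin r → Option J}
    (hσ : ∀ j, ∃ i, σ i = some j) (w : J → C → 𝕜) :
    Submodule.span 𝕜 (Set.range fun i c => (σ i).elim 0 fun j => w j c) =
      Submodule.span 𝕜 (Set.range w) := by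
  refine le_antisymm (Submodule.span_le.2 ?_) (Submodule.span_mono ?_)
  · rintro _ ⟨i, rfl⟩
    rcases h : σ i with _ | j
    · simp only [h, Option.elim_none]
      exact Submodule.zero_mem _
    · simpa [h] using Submodule.subset_span (Set.mem_range_self j)
  · rintro _ ⟨j, rfl⟩
    obtain ⟨i, hi⟩ := hσ j
    exact ⟨i, by simp [hi]⟩

end Echelon

/-! ### Reduction by the pivot rows -/

section BlockReduction

variable {𝕜 C : Type*} [Field 𝕜]

/-- The columns of level at most `a`. -/
abbrev Low (lev : C → ℕ) (a : ℕ) : Type _ := {c // lev c ≤ a}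

/-- The columns of level `a`. -/
abbrev AtLevel (lev : C → ℕ) (a : ℕ) : Type _ := {c // lev c = a}

/-- The columns of level above `a`. -/
abbrev High (lev : C → ℕ) (a : ℕ) : Type _ := {c // a < lev c}

/-- The rows that have not been chosen as pivot rows. -/
abbrev RestRow {lev : C → ℕ} {a r : ℕ} (p : Low lev a → Fin r) : Type := {i // i ∉ Set.range p}

/-- The column `ℓ` is a pivot of the row `x`: apart from `ℓ`, the row is supported in columns of
level at least `a`, and of level above `a` if `ℓ` has level `a`. -/
def IsPivot (lev : C → ℕ) (a : ℕ) (x : C → 𝕜) (ℓ : C) : Prop :=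
  x ℓ = 1 ∧ ∀ c, c ≠ ℓ → x c ≠ 0 → a ≤ lev c ∧ (lev ℓ = a → a < lev c)

/-- Two different pivots would both have level exactly `a`, which the last clause of `IsPivot`
forbids. About `ℓ'` only the support of `x` is used, so the pivot can be read off from the zero
pattern of a row. -/
theorem IsPivot.unique {lev : C → ℕ} {a : ℕ} {x : C → 𝕜} {ℓ ℓ' : C} (h : IsPivot lev a x ℓ) (hℓ : lev ℓ ≤ a)
    (hℓ' : lev ℓ' ≤ a) (h0 : x ℓ' ≠ 0)
    (h' : ∀ c, c ≠ ℓ' → x c ≠ 0 → a ≤ lev c ∧ (lev ℓ' = a → a < lev c)) : ℓ' = ℓ := by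
  by_contra hne
  have h1 := h.2 ℓ' hne h0
  have h2 := h' ℓ (Ne.symm hne) (by rw [h.1]; exact one_ne_zero)
  have := h1.2 (by omega)
  omega

/-- Extend a vector by zero to the columns of level at most `a`. -/
def extendHigh {lev : C → ℕ} {a : ℕ} : (High lev a → 𝕜) →ₗ[𝕜] (C → 𝕜) where
  toFun x c := if h : a < lev c then x ⟨c, h⟩ else 0
  map_add' x y := by ext c; by_cases h : a < lev c <;> simp [h]
  map_smul' t x := by ext c; by_cases h : a < lev c <;> simp [h]

theorem extendHigh_high {lev : C → ℕ} {a : ℕ} (x : High lev a → 𝕜) (g : High lev a) :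
    extendHigh x g = x g := dif_pos g.2

theorem extendHigh_low {lev : C → ℕ} {a : ℕ} (x : High lev a → 𝕜) {c : C} (hc : lev c ≤ a) :
    extendHigh x c = 0 := dif_neg hc.not_gt

theorem extendHigh_mul_row {lev : C → ℕ} {a : ℕ} {m n : Type*} [Fintype n] (X : Matrix m n 𝕜)
    (Y : Matrix n (High lev a) 𝕜) (i : m) :
    extendHigh ((X * Y) i) = ∑ j, X i j • extendHigh (Y j) := by
  have : (X * Y) i = ∑ j, X i j • Y j := by
    funext g
    simp [Matrix.mul_apply]
  rw [this, map_sum]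
  simp only [map_smul]

variable [Fintype C] {lev : C → ℕ} {a r : ℕ} (p : Low lev a → Fin r) (A : Matrix (Fin r) C 𝕜)

/-- The entries of the pivot rows in the columns of level `a`, apart from the pivots. -/
def midBlock : Matrix (Low lev a) (AtLevel lev a) 𝕜 :=
  Matrix.of fun c m => if lev c < a then A (p c) m else 0

/-- The pivot rows, reduced by each other, in the columns of level above `a`. -/
def pivotBlock : Matrix (Low lev a) (High lev a) 𝕜 :=
  (Matrix.of fun c (g : High lev a) => A (p c) g) -
    midBlock p A * Matrix.of fun (m : AtLevel lev a) (g : High lev a) => A (p ⟨m, m.2.le⟩) g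

/-- The other rows, reduced by the pivot rows, in the columns of level above `a`. -/
def restBlock : Matrix (RestRow p) (High lev a) 𝕜 :=
  (Matrix.of fun (i : RestRow p) (g : High lev a) => A i g) -
    (Matrix.of fun (i : RestRow p) (c : Low lev a) => A i c) * pivotBlock p A

variable [DecidableEq C]

/-- The reduced pivot row with pivot `c`. -/
def pivotRow (c : Low lev a) : C → 𝕜 := Pi.single (c : C) 1 + extendHigh (pivotBlock p A c)

variable {p A}

/-- One substitution reduces the pivot rows completely. A row with pivot below level `a` can meet
other pivots only at level `a`, and the rows with these pivots have no further entries of level at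
most `a`. -/
theorem pivotRow_eq (hp : ∀ c, IsPivot lev a (A (p c)) c) (c : Low lev a) :
    pivotRow p A c = A (p c) - ∑ m : AtLevel lev a, midBlock p A c m • A (p ⟨m, m.2.le⟩) := by
  funext x
  simp only [pivotRow, Pi.add_apply, Pi.sub_apply, Finset.sum_apply, Pi.smul_apply, smul_eq_mul]
  rcases lt_or_ge a (lev x) with hx | hx
  · have hne : x ≠ c := by rintro rfl; exact absurd hx c.2.not_gt
    rw [show extendHigh (pivotBlock p A c) x = pivotBlock p A c ⟨x, hx⟩ from dif_pos hx,
      Pi.single_eq_of_ne hne, zero_add]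
    simp [pivotBlock, Matrix.mul_apply]
  · rw [extendHigh_low _ hx, add_zero]
    have hm : ∀ m : AtLevel lev a, A (p ⟨m, m.2.le⟩) x = if x = m then 1 else 0 := by
      intro m
      split_ifs with h
      · subst h; exact (hp ⟨m, m.2.le⟩).1
      · by_contra h0
        exact absurd ((hp ⟨m, m.2.le⟩).2 x h h0).2 (by simp [m.2, hx])
    simp only [hm]
    by_cases hxa : lev x = a
    · rw [Finset.sum_eq_single ⟨x, hxa⟩ (fun m _ hm => by
        rw [if_neg (fun h => hm (Subtype.ext h.symm)), mul_zero]) (by simp), if_pos rfl, mul_one]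
      by_cases hc : lev (c : C) < a
      · have hne : x ≠ c := by rintro rfl; omega
        simp [midBlock, hc, hne]
      · simp only [midBlock, Matrix.of_apply, if_neg hc, sub_zero]
        by_cases hxc : x = c
        · subst hxc; simpa using (hp c).1.symm
        · rw [Pi.single_eq_of_ne hxc]
          by_contra h0
          have := ((hp c).2 x hxc (Ne.symm h0)).2 (le_antisymm c.2 (not_lt.1 hc))
          omega
    · rw [Finset.sum_eq_zero fun m _ => by
        rw [if_neg (by rintro rfl; exact hxa m.2), mul_zero], sub_zero]
      by_cases hxc : x = c
      · subst hxc; simpa using (hp c).1.symm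
      · rw [Pi.single_eq_of_ne hxc]
        by_contra h0
        have := ((hp c).2 x hxc (Ne.symm h0)).1
        omega

theorem pivotRow_low (c : Low lev a) {x : C} (hx : lev x ≤ a) :
    pivotRow p A c x = if x = c then 1 else 0 := by
  simp [pivotRow, extendHigh_low _ hx, Pi.single_apply]

theorem extendHigh_restBlock (i : RestRow p) :
    extendHigh (restBlock p A i) = A i - ∑ c : Low lev a, A i c • pivotRow p A c := by
  funext x
  simp only [Pi.sub_apply, Finset.sum_apply, Pi.smul_apply, smul_eq_mul]
  rcases lt_or_ge a (lev x) with hx | hx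
  · rw [show extendHigh (restBlock p A i) x = restBlock p A i ⟨x, hx⟩ from dif_pos hx]
    simp only [restBlock, Matrix.sub_apply, Matrix.of_apply, Matrix.mul_apply]
    congr 1
    refine Finset.sum_congr rfl fun c _ => ?_
    have hne : x ≠ c := by rintro rfl; exact absurd hx c.2.not_gt
    rw [pivotRow, Pi.add_apply, Pi.single_eq_of_ne hne, zero_add, extendHigh_high _ ⟨x, hx⟩]
  · rw [extendHigh_low _ hx, Finset.sum_eq_single ⟨x, hx⟩]
    · simp [pivotRow_low _ hx]
    · intro c _ hc
      rw [pivotRow_low _ hx, if_neg (fun h => hc (Subtype.ext h.symm)), mul_zero]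
    · simp

theorem span_reduced (hp : ∀ c, IsPivot lev a (A (p c)) c) :
    Submodule.span 𝕜 (Set.range fun i => A i) =
      Submodule.span 𝕜 (Set.range (Sum.elim (pivotRow p A)
        fun i : RestRow p => extendHigh (restBlock p A i))) := by
  apply le_antisymm <;> rw [Submodule.span_le]
  · have hrow : ∀ c, pivotRow p A c ∈ Submodule.span 𝕜 (Set.range (Sum.elim (pivotRow p A)
        fun i : RestRow p => extendHigh (restBlock p A i))) := fun c =>
      Submodule.subset_span ⟨.inl c, rfl⟩
    -- The rows with pivots of level `a` are unchanged, so the reduction of the other pivot rows can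
    -- be undone with them.
    have hmid : ∀ m : AtLevel lev a, A (p ⟨m, m.2.le⟩) = pivotRow p A ⟨m, m.2.le⟩ := by
      intro m
      rw [pivotRow_eq hp]
      simp [midBlock, m.2]
    rintro _ ⟨i, rfl⟩
    by_cases hi : i ∈ Set.range p
    · obtain ⟨c, rfl⟩ := hi
      have := pivotRow_eq hp c
      rw [eq_sub_iff_add_eq] at this
      change A (p c) ∈ _
      rw [← this]
      refine Submodule.add_mem _ (hrow c) (Submodule.sum_mem _ fun m _ => ?_)
      rw [hmid m]
      exact Submodule.smul_mem _ _ (hrow _)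
    · have := extendHigh_restBlock (A := A) ⟨i, hi⟩
      rw [eq_sub_iff_add_eq] at this
      change A i ∈ _
      rw [← this]
      exact Submodule.add_mem _ (Submodule.subset_span ⟨.inr ⟨i, hi⟩, rfl⟩)
        (Submodule.sum_mem _ fun c _ => Submodule.smul_mem _ _ (hrow c))
  · have hA : ∀ i, A i ∈ Submodule.span 𝕜 (Set.range fun i => A i) := fun i =>
      Submodule.subset_span ⟨i, rfl⟩
    have hrow : ∀ c, pivotRow p A c ∈ Submodule.span 𝕜 (Set.range fun i => A i) := fun c => by
      rw [pivotRow_eq hp]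
      exact Submodule.sub_mem _ (hA _) (Submodule.sum_mem _ fun m _ => Submodule.smul_mem _ _ (hA _))
    rintro _ ⟨c | i, rfl⟩
    · exact hrow c
    · rw [Sum.elim_inr, extendHigh_restBlock]
      exact Submodule.sub_mem _ (hA _) (Submodule.sum_mem _ fun c _ =>
        Submodule.smul_mem _ _ (hrow c))

end BlockReduction

/-! ### Correctness and cost of the reduction of a near-echelon matrix -/

section Assembly

variable {𝕜 C : Type*} [Field 𝕜] [Fintype C] [LinearOrder C] {lev : C → ℕ} {a r k : ℕ}

/-- The properties of the matrix built by the algorithm that its reduction relies on. -/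
structure IsNearEchelon (lev : C → ℕ) (a : ℕ) (A : Matrix (Fin r) C 𝕜) : Prop where
  shape : ∀ i, ∃ ℓ, lev ℓ ≤ a ∧ IsPivot lev a (A i) ℓ
  cover : ∀ ℓ, lev ℓ ≤ a → ∃ i, IsPivot lev a (A i) ℓ
  null : ∀ v ∈ Submodule.span 𝕜 (Set.range fun i => A i),
    (∀ c, lev c ≤ a + 1 → v c = 0) → v = 0

/-- The columns of level `a + 1`, as columns of level above `a`. -/
def nextHigh (o : Fin k ≃o AtLevel lev (a + 1)) (j : Fin k) : High lev a :=
  ⟨o j, by rw [(o j).2]; exact Nat.lt_succ_self a⟩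

variable (p : Low lev a → Fin r) (o : Fin k ≃o AtLevel lev (a + 1)) (R : Finset (RestRow p))
  (π : RestRow p → Fin k)

/-- The pivot columns of the reduced row echelon form. -/
def finalPivot : Low lev a ⊕ R → C :=
  Sum.elim (fun c => c) fun i => nextHigh o (π i)

variable (A : Matrix (Fin r) C 𝕜) (V : Matrix (RestRow p) (RestRow p) 𝕜)

/-- The coefficients of the reduced pivot rows at the remaining pivots. -/
def backBlock : Matrix (Low lev a) (RestRow p) 𝕜 :=
  (pivotBlock p A).submatrix id fun i => nextHigh o (π i)

/-- The nonzero rows of the reduced row echelon form. -/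
def finalRow : Low lev a ⊕ R → C → 𝕜 :=
  Sum.elim (fun c => Pi.single (c : C) 1 +
      extendHigh ((pivotBlock p A - backBlock p o π A * (V * restBlock p A)) c))
    fun i => extendHigh ((V * restBlock p A) i)

variable {p o R π A V}


theorem finalRow_inl (c : Low lev a) : finalRow p o R π A V (.inl c) =
    pivotRow p A c - ∑ i, backBlock p o π A c i • extendHigh ((V * restBlock p A) i) := by
  rw [← extendHigh_mul_row, pivotRow, add_sub_assoc, ← map_sub]
  rfl

theorem sum_restBlock_mem (hp : ∀ c, IsPivot lev a (A (p c)) c) (i : RestRow p) :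
    extendHigh ((V * restBlock p A) i) ∈ Submodule.span 𝕜 (Set.range fun i => A i) := by
  rw [extendHigh_mul_row, span_reduced hp]
  exact Submodule.sum_mem _ fun j _ => Submodule.smul_mem _ _ (Submodule.subset_span ⟨.inr j, rfl⟩)

/-- Such a row lies in the row space and vanishes at all levels up to `a + 1`, so `null` applies.
This is why the elimination may stop at level `a + 1`, although columns of higher level remain. -/
theorem row_eq_zero (hA : IsNearEchelon lev a A) (hp : ∀ c, IsPivot lev a (A (p c)) c) {t : ℕ}
    (ht : k ≤ t)
    (hred : ReducedUpTo (V * (restBlock p A).submatrix id (nextHigh o)) R π t) {i : RestRow p}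
    (hi : i ∉ R) : extendHigh ((V * restBlock p A) i) = 0 := by
  refine hA.null _ (sum_restBlock_mem hp i) fun c hc => ?_
  rcases Nat.lt_or_ge a (lev c) with h | h
  · have h' : lev c = a + 1 := by omega
    obtain ⟨j, hj⟩ := o.surjective ⟨c, h'⟩
    have h0 := hred.zero i hi j (lt_of_lt_of_le j.2 ht)
    have : nextHigh o j = ⟨c, h⟩ := Subtype.ext (show (o j : C) = c by rw [hj])
    rw [show (c : C) = ((⟨c, h⟩ : High lev a) : C) from rfl, extendHigh_high, ← this]
    exact h0
  · exact extendHigh_low _ h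

/-- The rows outside `R` are dropped without loss because they are zero; the other changes are
inverted by `V⁻¹` and by undoing the back substitution. -/
theorem span_finalRow (hA : IsNearEchelon lev a A) (hp : ∀ c, IsPivot lev a (A (p c)) c) {t : ℕ}
    (ht : k ≤ t) (hV : IsUnit V)
    (hred : ReducedUpTo (V * (restBlock p A).submatrix id (nextHigh o)) R π t) :
    Submodule.span 𝕜 (Set.range (finalRow p o R π A V)) =
      Submodule.span 𝕜 (Set.range fun i => A i) := by
  apply le_antisymm
  · rw [Submodule.span_le]
    rintro _ ⟨c | i, rfl⟩
    · rw [finalRow_inl]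
      refine Submodule.sub_mem _ ?_ (Submodule.sum_mem _ fun i _ =>
        Submodule.smul_mem _ _ (sum_restBlock_mem hp i))
      rw [span_reduced hp]
      exact Submodule.subset_span ⟨.inl c, rfl⟩
    · exact sum_restBlock_mem hp i.1
  · rw [span_reduced hp, Submodule.span_le]
    have hrow : ∀ i, extendHigh ((V * restBlock p A) i) ∈
        Submodule.span 𝕜 (Set.range (finalRow p o R π A V)) := by
      intro i
      by_cases hi : i ∈ R
      · exact Submodule.subset_span ⟨.inr ⟨i, hi⟩, rfl⟩
      · rw [row_eq_zero hA hp ht hred hi]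
        exact Submodule.zero_mem _
    rintro _ ⟨c | i, rfl⟩
    · have := finalRow_inl (R := R) (o := o) (π := π) (A := A) (V := V) c
      rw [eq_sub_iff_add_eq] at this
      rw [Sum.elim_inl, ← this]
      exact Submodule.add_mem _ (Submodule.subset_span ⟨.inl c, rfl⟩)
        (Submodule.sum_mem _ fun i _ => Submodule.smul_mem _ _ (hrow i))
    · obtain ⟨U, rfl⟩ := hV
      have : restBlock p A =
          ((U⁻¹ : (Matrix (RestRow p) (RestRow p) 𝕜)ˣ) : Matrix (RestRow p) (RestRow p) 𝕜) *
            ((U : Matrix (RestRow p) (RestRow p) 𝕜) * restBlock p A) := by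
        rw [← Matrix.mul_assoc, Units.inv_mul, Matrix.one_mul]
      rw [Sum.elim_inr, this, extendHigh_mul_row]
      exact Submodule.sum_mem _ fun j _ => Submodule.smul_mem _ _ (hrow j)

theorem mul_restBlock_pivot {t : ℕ}
    (hred : ReducedUpTo (V * (restBlock p A).submatrix id (nextHigh o)) R π t) {i : RestRow p}
    (hi : i ∈ R) (j : RestRow p) :
    (V * restBlock p A) j (nextHigh o (π i)) = if j = i then 1 else 0 :=
  hred.pivot i hi j

theorem finalPivot_injective {t : ℕ}
    (hred : ReducedUpTo (V * (restBlock p A).submatrix id (nextHigh o)) R π t) :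
    (finalPivot p o R π).Injective := by
  rintro (c | i) (c' | i') h
  · exact congrArg _ (Subtype.ext h)
  · have := c.2
    rw [show (c : C) = _ from h] at this
    exact absurd (nextHigh o (π i')).2 this.not_gt
  · have := c'.2
    rw [show (c' : C) = _ from h.symm] at this
    exact absurd (nextHigh o (π i)).2 this.not_gt
  · have h' : nextHigh o (π i) = nextHigh o (π i') := Subtype.ext h
    have h1 := mul_restBlock_pivot hred i.2 i.1
    rw [h', mul_restBlock_pivot hred i'.2, if_pos rfl] at h1
    congr 1
    by_contra hne
    rw [if_neg fun h => hne (Subtype.ext h)] at h1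
    exact zero_ne_one h1

theorem finalRow_pivot {t : ℕ}
    (hred : ReducedUpTo (V * (restBlock p A).submatrix id (nextHigh o)) R π t)
    (j j' : Low lev a ⊕ R) :
    finalRow p o R π A V j (finalPivot p o R π j') = if j = j' then 1 else 0 := by
  rcases j' with c' | i'
  · rcases j with c | i
    · simp [finalRow, finalPivot, extendHigh_low _ c'.2, Pi.single_apply, Subtype.ext_iff, eq_comm]
    · simp [finalRow, finalPivot, extendHigh_low _ c'.2]
  · rcases j with c | i
    · have hne : ((nextHigh o (π i') : High lev a) : C) ≠ c := by
        intro h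
        have := c.2
        rw [← h] at this
        exact absurd (nextHigh o (π i')).2 this.not_gt
      simp only [finalRow, finalPivot, Sum.elim_inl, Sum.elim_inr, Pi.add_apply,
        Pi.single_eq_of_ne hne, zero_add, extendHigh_high, Matrix.sub_apply, reduceCtorEq,
        if_false]
      -- In the pivot column of `i'` the transformed rest block is a unit vector, so exactly the
      -- entry of `pivotBlock` is subtracted. The rows outside `R`, for which `π` has no meaning,
      -- contribute nothing.
      rw [Matrix.mul_apply, Finset.sum_eq_single i'.1]
      · rw [mul_restBlock_pivot hred i'.2, if_pos rfl, mul_one]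
        exact sub_self _
      · intro l _ hl
        rw [mul_restBlock_pivot hred i'.2, if_neg hl, mul_zero]
      · simp
    · simp only [finalRow, finalPivot, Sum.elim_inr, extendHigh_high]
      rw [mul_restBlock_pivot hred i'.2]
      by_cases h : i = i'
      · rw [h, if_pos rfl, if_pos rfl]
      · rw [if_neg (fun h' => h (Subtype.ext h')), if_neg (fun h' => h (Sum.inr_injective h'))]

theorem finalRow_left (hlev : Monotone lev) {t : ℕ}
    (hred : ReducedUpTo (V * (restBlock p A).submatrix id (nextHigh o)) R π t)
    (j : Low lev a ⊕ R) {c : C} (hc : c < finalPivot p o R π j) :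
    finalRow p o R π A V j c = 0 := by
  rcases j with c' | i
  · have hc' : c < c' := hc
    simp [finalRow, extendHigh_low _ ((hlev hc'.le).trans c'.2), Pi.single_eq_of_ne hc'.ne]
  · have hc' : c < nextHigh o (π i) := hc
    have hle : lev c ≤ a + 1 := (hlev hc'.le).trans (o (π i)).2.le
    rcases Nat.lt_or_ge a (lev c) with h | h
    · have h' : lev c = a + 1 := by omega
      obtain ⟨j, hj⟩ := o.surjective ⟨c, h'⟩
      have hjc : nextHigh o j = ⟨c, h⟩ := Subtype.ext (show (o j : C) = c by rw [hj])
      have hlt : j < π i := by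
        rw [← o.lt_iff_lt, hj]
        exact hc'
      have h0 := hred.left i i.2 j hlt
      change extendHigh ((V * restBlock p A) i) ((⟨c, h⟩ : High lev a) : C) = 0
      rw [extendHigh_high, ← hjc]
      exact h0
    · exact extendHigh_low _ h

/-- The number of steps of the reduction of a near-echelon matrix with `r` rows and `N` columns:
`k` is the number of columns of level `a + 1`, the columns of level at most `a` and above `a` are
cut into `u` and `v` blocks of size `k`, and the final elimination works with `q` blocks of
size `b`; the numbers `μ` and `ν` are the costs of multiplying blocks of size `k` and `b`. -/
def reductionCost (r N k u v q b μ ν : ℕ) : ℕ :=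
  r * N + ((u * 3 * v * (μ + k ^ 2) + (u * k) * (v * k)) +
    ((1 * u * v * (μ + k ^ 2) + k * (v * k)) +
      (q * (b * (q * b * (4 * b + 4)) + 2 * (q ^ 2 * (ν + b ^ 2) + (q * b) ^ 2)) +
        (1 * 1 * v * (μ + k ^ 2) + (u * 1 * v * (μ + k ^ 2) + (u * k) * (v * k))))))

/-- The zero tests on all entries reveal the pivot rows. Then come the mutual reduction of the pivot
rows, the Schur complement, its elimination on the columns of level `a + 1`, and the back
substitution. With k columns of level `a + 1` there are at most k rows besides the pivot rows, so
blocks of size k fit all products. -/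
theorem can_reduce (hlev : Monotone lev) {u v q b μ ν : ℕ}
    (hμ : HasMulTree 𝕜 (Fintype.card (AtLevel lev (a + 1))) μ) (hν : HasMulTree 𝕜 b ν)
    (hk0 : 0 < Fintype.card (AtLevel lev (a + 1)))
    (hr : r ≤ Fintype.card (Low lev a) + Fintype.card (AtLevel lev (a + 1)))
    (hlow : Fintype.card (Low lev a) ≤ u * Fintype.card (AtLevel lev (a + 1)))
    (hhigh : Fintype.card (High lev a) ≤ v * Fintype.card (AtLevel lev (a + 1)))
    (hmid : Fintype.card (AtLevel lev a) ≤ 3 * Fintype.card (AtLevel lev (a + 1)))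
    (hq : Fintype.card (AtLevel lev (a + 1)) ≤ q * b)
    {P : Set (Matrix (Fin r) C 𝕜)} (hP : ∀ A ∈ P, IsNearEchelon lev a A) :
    Can (fun P' K' => ∃ h : Fin r × C → Matrix (Fin r) C 𝕜 → 𝕜, (∀ j, Known P' K' (h j)) ∧
        ∀ A ∈ P', Matrix.IsReducedRowEchelon (Matrix.of fun i c => h (i, c) A) ∧
          Submodule.span 𝕜 (Set.range fun i c => h (i, c) A) =
            Submodule.span 𝕜 (Set.range fun i => A i))
      P (Set.range fun (j : Fin r × C) A => A j.1 j.2)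
      (reductionCost r (Fintype.card C) (Fintype.card (AtLevel lev (a + 1))) u v q b μ ν) := by
  classical
  set k := Fintype.card (AtLevel lev (a + 1)) with hk
  let o : Fin k ≃o AtLevel lev (a + 1) := Fintype.orderIsoFinOfCardEq _ rfl
  have hent : ∀ P' K', (Set.range fun (j : Fin r × C) (A : Matrix (Fin r) C 𝕜) => A j.1 j.2) ⊆ K' →
      ∀ i c, Known P' K' fun A : Matrix (Fin r) C 𝕜 => A i c := fun P' K' hK i c =>
    .of_mem (hK ⟨(i, c), rfl⟩)
  have htest := Can.test_family (P := P)
    (K := Set.range fun (j : Fin r × C) (A : Matrix (Fin r) C 𝕜) => A j.1 j.2)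
    (fun (j : Fin r × C) A => A j.1 j.2) fun j => hent _ _ subset_rfl _ _
  rw [Fintype.card_prod, Fintype.card_fin] at htest
  refine htest.bind fun P₁ K₁ hP₁ hK₁ hZ => ?_
  obtain ⟨Z, hZ⟩ := hZ
  rcases P₁.eq_empty_or_nonempty with rfl | ⟨A₀, hA₀⟩
  · exact .empty rfl
  -- The tree must not depend on the instance, so the pivot rows are chosen from one representative
  -- of the zero pattern.
  choose p hp₀ using fun c : Low lev a => (hP A₀ (hP₁ hA₀)).cover c c.2
  have hp : ∀ A ∈ P₁, ∀ c, IsPivot lev a (A (p c)) c := by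
    intro A hA c
    have hiff : ∀ x, A (p c) x = 0 ↔ A₀ (p c) x = 0 := fun x =>
      (hZ A hA (p c, x)).trans (hZ A₀ hA₀ (p c, x)).symm
    -- The pattern does not show that the pivot entry is 1. But the row has some pivot by `shape`,
    -- and the pattern forces it to be `c`.
    obtain ⟨ℓ, hℓ, hpiv⟩ := (hP A (hP₁ hA)).shape (p c)
    have hne : A (p c) c ≠ 0 := by
      rw [Ne, hiff, (hp₀ c).1]
      exact one_ne_zero
    rw [hpiv.unique hℓ c.2 hne fun x hx h0 => (hp₀ c).2 x hx (by rwa [Ne, ← hiff])]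
    exact hpiv
  have hpinj : p.Injective := by
    intro c c' h
    have h1 := hp₀ c
    have h2 := hp₀ c'
    rw [← h] at h2
    exact Subtype.ext (h2.unique c'.2 c.2 (by rw [h1.1]; exact one_ne_zero) h1.2)
  have hcard : Fintype.card (RestRow p) + Fintype.card (Low lev a) = r := by
    have h1 := Fintype.card_subtype_compl (fun i : Fin r => i ∈ Set.range p)
    have h2 : Fintype.card {i // i ∈ Set.range p} = Fintype.card (Low lev a) :=
      Set.card_range_of_injective hpinj
    have h3 := Fintype.card_subtype_le (fun i : Fin r => i ∈ Set.range p)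
    rw [Fintype.card_fin] at h1 h3
    have h4 : Fintype.card (RestRow p) = Fintype.card {i : Fin r // i ∉ Set.range p} := rfl
    omega
  have hrest : Fintype.card (RestRow p) ≤ k := by omega
  -- the pivot rows
  have hpb : Can (fun P' K' => KnownMat P' K' (pivotBlock p)) P₁ K₁
      (u * 3 * v * (μ + k ^ 2) + (u * k) * (v * k)) := by
    refine Can.mono_cost ((hμ.can_mul (P := P₁) (K := K₁) (X := midBlock p)
      (Y := fun A => Matrix.of fun (m : AtLevel lev a) (g : High lev a) => A (p ⟨m, m.2.le⟩) g)
      hlow hmid hhigh (fun c m => ?_) fun m g => hent _ _ hK₁ _ _).bind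
        fun P' K' hP' hK' h => (Can.sub_mat (X := fun A : Matrix (Fin r) C 𝕜 =>
          Matrix.of fun (c : Low lev a) (g : High lev a) => A (p c) g) (fun c g => hent _ _ (hK₁.trans hK') _ _) h)) ?_
    · by_cases hc : lev c < a
      · simpa [midBlock, hc] using hent _ _ hK₁ _ _
      · simpa [midBlock, hc] using Known.const 0
    · gcongr
  refine hpb.bind fun P₂ K₂ hP₂ hK₂ hpb => ?_
  -- the other rows
  have hrb : Can (fun P' K' => KnownMat P' K' (restBlock p)) P₂ K₂
      (1 * u * v * (μ + k ^ 2) + k * (v * k)) := by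
    refine Can.mono_cost ((hμ.can_mul (p := 1) (P := P₂) (K := K₂)
      (X := fun A => Matrix.of fun (i : RestRow p) (c : Low lev a) => A i c)
      (by simpa using hrest) hlow hhigh (fun i c => hent _ _ (hK₁.trans hK₂) _ _) hpb).bind
        fun P' K' hP' hK' h => (Can.sub_mat (X := fun A : Matrix (Fin r) C 𝕜 =>
          Matrix.of fun (i : RestRow p) (g : High lev a) => A i g)
          (fun c g => hent _ _ ((hK₁.trans hK₂).trans hK') _ _) h)) ?_
    gcongr
  refine hrb.bind fun P₃ K₃ hP₃ hK₃ hrb => ?_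
  refine (hν.can_eliminate (Y := fun A => (restBlock p A).submatrix id (nextHigh o))
    (hrest.trans hq) hq hk0 fun i j => hrb i _).bind fun P₄ K₄ hP₄ hK₄ hel => ?_
  obtain ⟨V, R, π, hV, -, hred⟩ := hel
  -- The elimination saw only the columns of level `a + 1`; its transformation is now applied to all
  -- columns above level `a`.
  refine (hμ.can_mul (p := 1) (q := 1) (by simpa using hrest) (by simpa using hrest) hhigh hV
    (hrb.mono hP₄ hK₄)).bind fun P₅ K₅ hP₅ hK₅ hVY => ?_
  have hpb₅ := hpb.mono (hP₅.trans (hP₄.trans hP₃)) (hK₃.trans (hK₄.trans hK₅))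
  have hfin : Can (fun P' K' => KnownMat P' K' fun A =>
      pivotBlock p A - backBlock p o π A * (V A * restBlock p A)) P₅ K₅
      (u * 1 * v * (μ + k ^ 2) + (u * k) * (v * k)) := by
    refine Can.mono_cost ((hμ.can_mul (q := 1) (P := P₅) (K := K₅) (X := backBlock p o π)
      hlow (by simpa using hrest) hhigh (fun c i => hpb₅ _ _) hVY).bind
        fun P' K' hP' hK' h => Can.sub_mat (hpb₅.mono hP' hK') h) ?_
    gcongr
  refine hfin.bind (c' := 0) fun P₆ K₆ hP₆ hK₆ hD => ?_
  rcases P₆.eq_empty_or_nonempty with rfl | ⟨A₁, hA₁⟩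
  · exact .empty rfl
  -- `R` and `π` no longer depend on the instance, so any remaining instance shows that the pivots
  -- are distinct. Sorting the rows costs nothing.
  have hinj := finalPivot_injective (hred A₁ (hP₅ (hP₆ hA₁))).2
  obtain ⟨σ, hσ, hσ'⟩ := exists_row_order (finalPivot p o R π) hinj (r := r) (by
    rw [Fintype.card_sum, Fintype.card_coe]
    have := Finset.card_le_univ R
    omega)
  refine .done ⟨fun j A => (σ j.1).elim 0 fun l => finalRow p o R π A (V A) l j.2,
    fun j => ?_, fun A hA => ?_⟩
  · change Known _ _ fun A => (σ j.1).elim 0 fun l => finalRow p o R π A (V A) l j.2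
    generalize σ j.1 = x
    rcases x with _ | (c | i)
    · exact .const 0
    · rcases lt_or_ge a (lev j.2) with h | h
      · refine (hD c ⟨j.2, h⟩).congr fun A _ => ?_
        have hne : j.2 ≠ c := by intro hc; rw [hc] at h; exact absurd h c.2.not_gt
        change (Pi.single (c : C) 1 + extendHigh _ : C → 𝕜) j.2 = _
        rw [Pi.add_apply, Pi.single_eq_of_ne hne, zero_add]
        exact extendHigh_high _ ⟨j.2, h⟩
      · refine (Known.const ((Pi.single (c : C) 1 : C → 𝕜) j.2)).congr fun A _ => ?_
        change (Pi.single (c : C) 1 + extendHigh _ : C → 𝕜) j.2 = _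
        rw [Pi.add_apply, extendHigh_low _ h, add_zero]
    · rcases lt_or_ge a (lev j.2) with h | h
      · exact ((hVY i.1 ⟨j.2, h⟩).mono hP₆ hK₆).congr fun A _ => extendHigh_high _ ⟨j.2, h⟩
      · exact (Known.const 0).congr fun A _ => extendHigh_low _ h
  · have hA₅ := hP₆.trans hP₅ hA
    have hA₁' := hP₂ (hP₃ (hP₄ hA₅))
    have hnear := hP A (hP₁ hA₁')
    have hpA := hp A hA₁'
    obtain ⟨hu, hredA⟩ := hred A hA₅
    refine ⟨isReducedRowEchelon_of_pivots hσ' (fun j => ?_) (fun j j' hj => ?_)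
      fun j c hc => finalRow_left hlev hredA j hc, ?_⟩
    · rw [finalRow_pivot hredA, if_pos rfl]
    · rw [finalRow_pivot hredA, if_neg (by rintro rfl; exact lt_irrefl _ hj)]
    · rw [← span_finalRow hnear hpA hq hu hredA]
      exact span_range_option_elim hσ _

end Assembly

/-! ### The grevlex and term-over-position orders -/

section Grevlex

theorem degree_fin_four (m : Fin 4 →₀ ℕ) : m.degree = m 0 + m 1 + m 2 + m 3 := by
  rw [Finsupp.degree_eq_sum, Fin.sum_univ_four]

theorem finsupp_fin_four_ext {a b : Fin 4 →₀ ℕ} (h0 : a 0 = b 0) (h1 : a 1 = b 1)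
    (h2 : a 2 = b 2) (h3 : a 3 = b 3) : a = b := by
  ext i
  fin_cases i <;> assumption

/-- With the exponents written out, comparisons of monomials become linear arithmetic. -/
theorem grevlexLT_iff {a b : Fin 4 →₀ ℕ} : GrevlexLT a b ↔
    a 0 + a 1 + a 2 + a 3 < b 0 + b 1 + b 2 + b 3 ∨
    (a 0 + a 1 + a 2 + a 3 = b 0 + b 1 + b 2 + b 3 ∧
      (b 3 < a 3 ∨ a 3 = b 3 ∧ (b 2 < a 2 ∨ a 2 = b 2 ∧ (b 1 < a 1 ∨ a 1 = b 1 ∧ b 0 < a 0)))) := by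
  rw [GrevlexLT, degree_fin_four, degree_fin_four]
  refine or_congr Iff.rfl (and_congr Iff.rfl ?_)
  constructor
  · rintro ⟨i, hi, h⟩
    fin_cases i
    · have h1 := h 1 (by decide); have h2 := h 2 (by decide); have h3 := h 3 (by decide)
      simp only [Fin.zero_eta] at hi
      omega
    · have h2 := h 2 (by decide); have h3 := h 3 (by decide)
      simp only [Fin.mk_one] at hi
      omega
    · have h3 := h 3 (by decide)
      simp only [Fin.reduceFinMk] at hi
      omega
    · simp only [Fin.reduceFinMk] at hi
      omega
  · rintro (h | ⟨h3, h | ⟨h2, h | ⟨h1, h⟩⟩⟩)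
    · exact ⟨3, h, fun j hj => by omega⟩
    · refine ⟨2, h, fun j hj => ?_⟩
      obtain rfl : j = 3 := by omega
      exact h3
    · refine ⟨1, h, fun j hj => ?_⟩
      obtain rfl | rfl : j = 2 ∨ j = 3 := by omega
      exacts [h2, h3]
    · refine ⟨0, h, fun j hj => ?_⟩
      obtain rfl | rfl | rfl : j = 1 ∨ j = 2 ∨ j = 3 := by omega
      exacts [h1, h2, h3]

instance grevlexLT_isStrictTotalOrder : IsStrictTotalOrder (Fin 4 →₀ ℕ) GrevlexLT where
  irrefl a h := by rw [grevlexLT_iff] at h; omega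
  trans a b c h h' := by rw [grevlexLT_iff] at *; omega
  trichotomous a b h h' := by
    rw [grevlexLT_iff] at h h'
    apply finsupp_fin_four_ext <;> omega

theorem grevlexLT_add_right_iff {a b c : Fin 4 →₀ ℕ} :
    GrevlexLT (a + c) (b + c) ↔ GrevlexLT a b := by
  simp only [grevlexLT_iff, Finsupp.add_apply]
  omega

theorem GrevlexLT.apply_three_le {a b : Fin 4 →₀ ℕ} (h : GrevlexLT a b)
    (hd : a.degree = b.degree) : b 3 ≤ a 3 := by
  rw [grevlexLT_iff] at h
  rw [degree_fin_four, degree_fin_four] at hd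
  omega

/-- A monomial in the variables up to `X k` is larger than every other monomial of its degree. -/
theorem grevlexLT_of_low {k : Fin 4} {σ τ : Fin 4 →₀ ℕ} (hd : τ.degree = σ.degree)
    (hσ : ∀ l, k < l → σ l = 0) (hτ : ¬ ∀ l, k < l → τ l = 0) : GrevlexLT τ σ := by
  rw [grevlexLT_iff]
  rw [degree_fin_four, degree_fin_four] at hd
  push Not at hτ
  obtain ⟨l, hl, h⟩ := hτ
  have h1 : k < 1 → σ 1 = 0 := hσ 1
  have h2 : k < 2 → σ 2 = 0 := hσ 2
  have h3 : k < 3 → σ 3 = 0 := hσ 3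
  fin_cases l <;> simp only [Fin.zero_eta, Fin.mk_one, Fin.reduceFinMk] at hl h <;> omega

theorem apply_le_of_grevlexLT_of_low {k : Fin 4} {σ τ : Fin 4 →₀ ℕ} (hd : σ.degree = τ.degree)
    (hσ : ∀ l, k < l → σ l = 0) (hτ : ∀ l, k < l → τ l = 0) (h : GrevlexLT σ τ) : τ k ≤ σ k := by
  rw [grevlexLT_iff] at h
  rw [degree_fin_four, degree_fin_four] at hd
  have h1 : k < 1 → σ 1 = 0 := hσ 1
  have h2 : k < 2 → σ 2 = 0 := hσ 2
  have h3 : k < 3 → σ 3 = 0 := hσ 3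
  have h1' : k < 1 → τ 1 = 0 := hτ 1
  have h2' : k < 2 → τ 2 = 0 := hτ 2
  have h3' : k < 3 → τ 3 = 0 := hτ 3
  fin_cases k <;> simp only [Fin.zero_eta, Fin.mk_one, Fin.reduceFinMk] at * <;> omega

instance topLT_isStrictTotalOrder (s : ℕ) :
    IsStrictTotalOrder ((Fin 4 →₀ ℕ) × Fin s) TopLT where
  irrefl a h := by
    rcases h with h | h
    · exact irrefl_of GrevlexLT _ h
    · exact lt_irrefl _ h.2
  trans a b c h h' := by
    rcases h with h | ⟨h, h1⟩ <;> rcases h' with h' | ⟨h', h1'⟩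
    · exact .inl (trans_of GrevlexLT h h')
    · exact .inl (h' ▸ h)
    · exact .inl (h ▸ h')
    · exact .inr ⟨h.trans h', h1.trans h1'⟩
  trichotomous a b h h' := by
    simp only [TopLT, not_or, not_and] at h h'
    have h1 : a.1 = b.1 := by
      rcases trichotomous_of GrevlexLT a.1 b.1 with h2 | h2 | h2
      exacts [absurd h2 h.1, h2, absurd h2 h'.1]
    exact Prod.ext h1 (le_antisymm (not_lt.1 (h'.2 h1.symm)) (not_lt.1 (h.2 h1)))

theorem exists_max_of_isStrictTotalOrder {α : Type*} (lt : α → α → Prop) [IsStrictTotalOrder α lt]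
    (s : Finset α) (hs : s.Nonempty) : ∃ m ∈ s, ∀ m' ∈ s, m' ≠ m → lt m' m := by
  classical
  let _ := linearOrderOfSTO lt
  exact ⟨s.max' hs, s.max'_mem hs, fun m' hm hne => lt_of_le_of_ne (s.le_max' m' hm) hne⟩

/-- The columns of a Macaulay matrix are linearly ordered. -/
abbrev monDegLinearOrder (d : ℕ) : LinearOrder (MonDeg d) :=
  haveI : IsStrictTotalOrder (MonDeg d) (fun a b => a < b) :=
    { irrefl := fun a h => irrefl_of GrevlexLT a.1 h
      trans := fun _ _ _ h h' => trans_of GrevlexLT h' h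
      trichotomous := fun a b h h' => Subtype.ext
        (Std.Trichotomous.trichotomous (r := GrevlexLT) a.1 b.1 h' h) }
  letI : DecidableRel (fun a b : MonDeg d => a < b) := Classical.decRel _
  linearOrderOfSTO fun a b => a < b

end Grevlex

/-! ### Counting monomials by the exponent of the last variable -/

section Counting

theorem mem_monDeg {m : Fin 4 →₀ ℕ} {d : ℕ} :
    m ∈ Finset.finsuppAntidiag (Finset.univ : Finset (Fin 4)) d ↔ m.degree = d := by
  simp [Finset.mem_finsuppAntidiag, Finsupp.degree_eq_sum]

theorem MonDeg.degree_eq {d : ℕ} (m : MonDeg d) : m.1.degree = d := mem_monDeg.1 m.2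

/-- The monomial `m` as a monomial of degree `d`. -/
def MonDeg.mk {d : ℕ} (m : Fin 4 →₀ ℕ) (h : m.degree = d) : MonDeg d := ⟨m, mem_monDeg.2 h⟩

theorem card_monDeg (d : ℕ) : Fintype.card (MonDeg d) = (d + 3).choose 3 := by
  have h := Finset.card_finsuppAntidiag_nat_eq_choose (s := (Finset.univ : Finset (Fin 4))) d
  have h' : Fintype.card (MonDeg d) =
      (Finset.finsuppAntidiag (Finset.univ : Finset (Fin 4)) d).card := Fintype.card_coe _
  rw [h', h, Finset.card_univ, Fintype.card_fin, show 4 + d - 1 = d + 3 by omega,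
    ← Nat.choose_symm (by omega : 3 ≤ d + 3)]
  simp

/-- The exponent of the last variable. -/
def lastExp {d : ℕ} (m : MonDeg d) : ℕ := m.1 3

theorem lastExp_monotone (d : ℕ) :
    letI := monDegLinearOrder d
    Monotone (lastExp : MonDeg d → ℕ) := by
  let _ := monDegLinearOrder d
  intro a b h
  rcases h.eq_or_lt with rfl | h
  · exact le_rfl
  · exact GrevlexLT.apply_three_le h (b.degree_eq.trans a.degree_eq.symm)

/-- Division by the `l`-th power of `X 3` is a bijection onto the monomials of degree `d - l`. -/
theorem card_le_lastExp (d l : ℕ) :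
    Fintype.card {m : MonDeg d // l ≤ lastExp m} = (d + 3 - l).choose 3 := by
  rcases Nat.lt_or_ge d l with h | h
  · rw [Nat.choose_eq_zero_of_lt (by omega), Fintype.card_eq_zero_iff]
    refine ⟨fun m => ?_⟩
    have h1 := m.1.degree_eq
    rw [degree_fin_four] at h1
    have h2 : l ≤ m.1.1 3 := m.2
    omega
  · rw [show d + 3 - l = d - l + 3 by omega, ← card_monDeg]
    refine Fintype.card_congr
      { toFun := fun m => MonDeg.mk (m.1.1 - Finsupp.single 3 l) ?_
        invFun := fun m => ⟨MonDeg.mk (m.1 + Finsupp.single 3 l) ?_, ?_⟩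
        left_inv := fun m => ?_
        right_inv := fun m => ?_ }
    · have h1 := m.1.degree_eq
      have h2 : l ≤ m.1.1 3 := m.2
      rw [degree_fin_four] at h1 ⊢
      simp
      omega
    · have h1 := m.degree_eq
      rw [degree_fin_four] at h1 ⊢
      simp
      omega
    · simp [lastExp, MonDeg.mk]
    · have h2 : l ≤ m.1.1 3 := m.2
      refine Subtype.ext (Subtype.ext (finsupp_fin_four_ext ?_ ?_ ?_ ?_)) <;>
        simp [MonDeg.mk, h2]
    · refine Subtype.ext (finsupp_fin_four_ext ?_ ?_ ?_ ?_) <;>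
        simp [MonDeg.mk]

theorem card_high (d a : ℕ) :
    Fintype.card (High (lastExp : MonDeg d → ℕ) a) = (d + 2 - a).choose 3 := by
  rw [show d + 2 - a = d + 3 - (a + 1) by omega, ← card_le_lastExp]
  exact Fintype.card_congr (Equiv.refl _)

theorem card_low_add_high {C : Type*} [Fintype C] (lev : C → ℕ) (a : ℕ) :
    Fintype.card (Low lev a) + Fintype.card (High lev a) = Fintype.card C := by
  rw [← Fintype.card_sum]
  refine (Fintype.card_congr ((Equiv.sumCompl fun c => lev c ≤ a).symm.trans
    (Equiv.sumCongr (Equiv.refl _) (Equiv.subtypeEquivRight fun c => ?_)))).symm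
  exact not_le

theorem card_atLevel (d a : ℕ) (h : a ≤ d) :
    Fintype.card (AtLevel (lastExp : MonDeg d → ℕ) a) = (d + 2 - a).choose 2 := by
  have h1 := card_le_lastExp d a
  have h2 := card_high d a
  have h3 : Fintype.card {m : MonDeg d // a ≤ lastExp m} =
      Fintype.card (AtLevel (lastExp : MonDeg d → ℕ) a) +
        Fintype.card (High (lastExp : MonDeg d → ℕ) a) := by
    classical
    rw [← Fintype.card_subtype_or_disjoint]
    · refine Fintype.card_congr (Equiv.subtypeEquivRight fun c => ?_)
      omega
    · rw [Pi.disjoint_iff]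
      intro c
      simp only [Prop.disjoint_iff, not_and]
      omega
  obtain ⟨t, ht⟩ : ∃ t, d + 2 - a = t := ⟨_, rfl⟩
  rw [show d + 3 - a = t + 1 by omega, Nat.choose_succ_succ] at h1
  rw [ht] at h2 ⊢
  simp only [Nat.reduceAdd, Nat.succ_eq_add_one] at h1
  omega

end Counting

/-! ### Homogeneous components and leading monomials -/

section Homogeneous

variable {𝕜 : Type*} [Field 𝕜] {s : ℕ} {F : Fin s → MvPolynomial (Fin 4) 𝕜} {δ : ℕ}

theorem homogeneousComponent_mul_of_isHomogeneous {f g : MvPolynomial (Fin 4) 𝕜}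
    (hg : g.IsHomogeneous δ) (e : ℕ) :
    homogeneousComponent (e + δ) (f * g) = homogeneousComponent e f * g := by
  conv_lhs => rw [← sum_homogeneousComponent f, Finset.sum_mul, map_sum]
  have h : ∀ i, homogeneousComponent (e + δ) (homogeneousComponent i f * g) =
      if i = e then homogeneousComponent e f * g else 0 := by
    intro i
    rw [homogeneousComponent_of_mem ((homogeneousComponent_isHomogeneous i f).mul hg)]
    by_cases hi : i = e
    · simp [hi]
    · rw [if_neg hi, if_neg (by omega)]
  simp only [h]
  rw [Finset.sum_ite_eq']
  split_ifs with hmem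
  · rfl
  · rw [homogeneousComponent_eq_zero, zero_mul]
    simpa using hmem

theorem sum_homogeneousComponent_mul (hF : ∀ i, (F i).IsHomogeneous δ)
    (u : Fin s → MvPolynomial (Fin 4) 𝕜) (e : ℕ) :
    ∑ i, homogeneousComponent e (u i) * F i = homogeneousComponent (e + δ) (∑ i, u i * F i) := by
  rw [map_sum]
  exact Finset.sum_congr rfl fun i _ => (homogeneousComponent_mul_of_isHomogeneous (hF i) e).symm

theorem exists_homogeneous_combination (hF : ∀ i, (F i).IsHomogeneous δ)
    {f : MvPolynomial (Fin 4) 𝕜} (hf : f ∈ Ideal.span (Set.range F)) (e : ℕ) :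
    ∃ u : Fin s → MvPolynomial (Fin 4) 𝕜, (∀ i, (u i).IsHomogeneous e) ∧
      ∑ i, u i * F i = homogeneousComponent (e + δ) f := by
  obtain ⟨u, hu⟩ := Ideal.mem_span_range_iff_exists_fun.1 hf
  exact ⟨fun i => homogeneousComponent e (u i), fun i => homogeneousComponent_isHomogeneous _ _,
    by rw [sum_homogeneousComponent_mul hF, hu]⟩

theorem sum_mul_mem_span (F : Fin s → MvPolynomial (Fin 4) 𝕜)
    (u : Fin s → MvPolynomial (Fin 4) 𝕜) :
    ∑ i, u i * F i ∈ Ideal.span (Set.range F) :=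
  Ideal.sum_mem _ fun i _ => Ideal.mul_mem_left _ _ (Ideal.subset_span ⟨i, rfl⟩)

theorem isHomogeneous_sum_mul (hF : ∀ i, (F i).IsHomogeneous δ) {e : ℕ}
    {u : Fin s → MvPolynomial (Fin 4) 𝕜} (hu : ∀ i, (u i).IsHomogeneous e) :
    (∑ i, u i * F i).IsHomogeneous (e + δ) :=
  IsHomogeneous.sum _ _ _ fun i _ => (hu i).mul (hF i)

theorem homogeneousComponent_mem_span (hF : ∀ i, (F i).IsHomogeneous δ)
    {f : MvPolynomial (Fin 4) 𝕜} (hf : f ∈ Ideal.span (Set.range F)) {d : ℕ} (hd : δ ≤ d) :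
    homogeneousComponent d f ∈ Ideal.span (Set.range F) := by
  obtain ⟨u, -, h⟩ := exists_homogeneous_combination hF hf (d - δ)
  rw [Nat.sub_add_cancel hd] at h
  exact h ▸ sum_mul_mem_span F u

theorem degree_of_isHomogeneous {f : MvPolynomial (Fin 4) 𝕜} {d : ℕ} (hf : f.IsHomogeneous d)
    {m : Fin 4 →₀ ℕ} (hm : coeff m f ≠ 0) : m.degree = d := by
  rw [Finsupp.degree_eq_weight_one]
  exact hf hm

theorem isHomogeneous_of_degree {f : MvPolynomial (Fin 4) 𝕜} {d : ℕ}
    (hf : ∀ m, coeff m f ≠ 0 → m.degree = d) : f.IsHomogeneous d := by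
  intro m hm
  have := hf m hm
  rwa [Finsupp.degree_eq_weight_one] at this

theorem IsLM.homogeneousComponent {f : MvPolynomial (Fin 4) 𝕜} {m : Fin 4 →₀ ℕ}
    (h : IsLM f m) : IsLM (homogeneousComponent m.degree f) m := by
  have hc : ∀ m', m'.degree = m.degree →
      coeff m' (MvPolynomial.homogeneousComponent m.degree f) = coeff m' f := fun m' hm' => by
    rw [coeff_homogeneousComponent, if_pos hm']
  refine ⟨?_, fun m' hm' hne => h.2 m' ?_ hne⟩
  · rw [mem_support_iff, hc m rfl]
    exact mem_support_iff.1 h.1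
  · rw [mem_support_iff] at hm' ⊢
    rwa [hc m' (degree_of_isHomogeneous (homogeneousComponent_isHomogeneous _ _) hm')] at hm'

theorem IsLM.unique {f : MvPolynomial (Fin 4) 𝕜} {m m' : Fin 4 →₀ ℕ}
    (h : IsLM f m) (h' : IsLM f m') : m = m' := by
  by_contra hne
  exact asymm_of GrevlexLT (h.2 m' h'.1 (Ne.symm hne)) (h'.2 m h.1 hne)

theorem exists_isModLM {u : Fin s → MvPolynomial (Fin 4) 𝕜} (hu : u ≠ 0) :
    ∃ t, IsModLM u t := by
  classical
  let T : Finset ((Fin 4 →₀ ℕ) × Fin s) :=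
    Finset.univ.biUnion fun i => (u i).support.image fun m => (m, i)
  have hT : ∀ t, t ∈ T ↔ coeff t.1 (u t.2) ≠ 0 := by
    rintro ⟨m, i⟩
    simp only [T, Finset.mem_biUnion, Finset.mem_univ, true_and, Finset.mem_image,
      mem_support_iff, Prod.mk.injEq]
    constructor
    · rintro ⟨j, m', h, rfl, rfl⟩; exact h
    · intro h; exact ⟨i, m, h, rfl, rfl⟩
  obtain ⟨i, hi⟩ := Function.ne_iff.1 hu
  obtain ⟨m, hm⟩ := ne_zero_iff.1 hi
  obtain ⟨t, ht, h⟩ := exists_max_of_isStrictTotalOrder TopLT T ⟨(m, i), (hT (m, i)).2 hm⟩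
  exact ⟨t, (hT t).1 ht, fun t' ht' => h t' ((hT t').2 ht')⟩

end Homogeneous

/-! ### Signatures and the syzygy criterion -/

section Signatures

variable {𝕜 : Type*} [Field 𝕜] {s : ℕ} {F : Fin s → MvPolynomial (Fin 4) 𝕜} {δ : ℕ}

theorem Attains.degree_eq (hF : ∀ i, (F i).IsHomogeneous δ) {p : Fin 4 →₀ ℕ}
    {t : (Fin 4 →₀ ℕ) × Fin s} (h : Attains F p t) : t.1.degree + δ = p.degree := by
  obtain ⟨e, u, hu, hlm, hp⟩ := h
  rw [degree_of_isHomogeneous (hu t.2) hlm.1,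
    degree_of_isHomogeneous (isHomogeneous_sum_mul hF hu) (mem_support_iff.1 hp.1)]

/-- If `u` and `v` are homogeneous module elements of the same degree with leading monomial `t`,
then a combination of them has a smaller leading monomial. Here the image of `v` is too small to
interfere with the leading monomial `p` of the image of `u`. -/
theorem Attains.exists_smaller {p : Fin 4 →₀ ℕ}
    {t : (Fin 4 →₀ ℕ) × Fin s} (h : Attains F p t) {v : Fin s → MvPolynomial (Fin 4) 𝕜}
    (hv : ∀ i, (v i).IsHomogeneous t.1.degree) (ht : IsModLM v t)
    (hlt : ∀ m, coeff m (∑ i, v i * F i) ≠ 0 → GrevlexLT m p) :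
    ∃ t', Attains F p t' ∧ TopLT t' t := by
  obtain ⟨e, u, hu, hlm, hp⟩ := h
  obtain rfl : t.1.degree = e := degree_of_isHomogeneous (hu t.2) hlm.1
  let a : 𝕜 := coeff t.1 (u t.2) / coeff t.1 (v t.2)
  let w : Fin s → MvPolynomial (Fin 4) 𝕜 := fun i => u i - C a * v i
  have hsum : ∑ i, w i * F i = ∑ i, u i * F i - C a * ∑ i, v i * F i := by
    simp only [w, sub_mul, Finset.sum_sub_distrib, Finset.mul_sum, mul_assoc]
  have hpv : coeff p (∑ i, v i * F i) = 0 := by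
    by_contra h
    exact irrefl_of GrevlexLT p (hlt p h)
  have hLM : IsLM (∑ i, w i * F i) p := by
    constructor
    · rw [mem_support_iff, hsum, coeff_sub, coeff_C_mul, hpv, mul_zero, sub_zero]
      exact mem_support_iff.1 hp.1
    · intro m hm hne
      rw [mem_support_iff, hsum, coeff_sub, coeff_C_mul] at hm
      by_cases h : coeff m (∑ i, u i * F i) = 0
      · exact hlt m fun h' => hm (by rw [h, h', mul_zero, sub_zero])
      · exact hp.2 m (mem_support_iff.2 h) hne
  have hw : w ≠ 0 := by
    intro h
    have h1 := hLM.1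
    simp [h] at h1
  obtain ⟨t', ht'⟩ := exists_isModLM hw
  refine ⟨t', ⟨t.1.degree, w, fun i => ?_, ht', hLM⟩, ?_⟩
  · have := (isHomogeneous_C (Fin 4) a).mul (hv i)
    rw [zero_add] at this
    exact (hu i).sub this
  · have h1 := ht'.1
    simp only [w, coeff_sub, coeff_C_mul] at h1
    have hne : t' ≠ t := by
      rintro rfl
      exact h1 (by rw [div_mul_cancel₀ _ ht.1, sub_self])
    by_cases h : coeff t'.1 (u t'.2) = 0
    · exact ht.2 t' (fun h' => h1 (by rw [h, h', mul_zero, sub_zero])) hne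
    · exact hlm.2 t' h hne

theorem exists_attains (hF : ∀ i, (F i).IsHomogeneous δ) {f : MvPolynomial (Fin 4) 𝕜}
    (hf : f ∈ Ideal.span (Set.range F)) {d : ℕ} (hd : δ ≤ d) (hfd : f.IsHomogeneous d)
    {p : Fin 4 →₀ ℕ} (hp : IsLM f p) : ∃ t, Attains F p t := by
  obtain ⟨u, hu, h⟩ := exists_homogeneous_combination hF hf (d - δ)
  rw [Nat.sub_add_cancel hd, homogeneousComponent_eq_self hfd] at h
  have hu0 : u ≠ 0 := by
    rintro rfl
    rw [← h] at hp
    simpa using hp.1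
  obtain ⟨t, ht⟩ := exists_isModLM hu0
  exact ⟨t, d - δ, u, hu, ht, h ▸ hp⟩

theorem exists_isSignature (hF : ∀ i, (F i).IsHomogeneous δ) {f : MvPolynomial (Fin 4) 𝕜}
    (hf : f ∈ Ideal.span (Set.range F)) {d : ℕ} (hd : δ ≤ d) (hfd : f.IsHomogeneous d)
    {p : Fin 4 →₀ ℕ} (hp : IsLM f p) : ∃ t, IsSignature F f t := by
  classical
  obtain ⟨t₀, ht₀⟩ := exists_attains hF hf hd hfd hp
  let T : Finset ((Fin 4 →₀ ℕ) × Fin s) :=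
    ((Finset.finsuppAntidiag Finset.univ (d - δ)) ×ˢ Finset.univ).filter (Attains F p)
  have hpd : p.degree = d := degree_of_isHomogeneous hfd (mem_support_iff.1 hp.1)
  have hT : ∀ t, t ∈ T ↔ Attains F p t := by
    intro t
    simp only [T, Finset.mem_filter, Finset.mem_product, Finset.mem_univ, and_true, mem_monDeg,
      and_iff_right_iff_imp]
    intro h
    have := h.degree_eq hF
    omega
  obtain ⟨t, ht, h⟩ := exists_max_of_isStrictTotalOrder (Function.swap TopLT) T
    ⟨t₀, (hT t₀).2 ht₀⟩
  exact ⟨t, p, hp, (hT t).1 ht, fun t' ht' hne => h t' ((hT t').2 ht') hne⟩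

/-- If `t` were attained at two leading monomials, subtracting a multiple of the element with the
smaller one would cancel `t` and keep the larger one. Then `t` would not be minimal for the larger
one. -/
theorem IsSignature.lm_unique {f g : MvPolynomial (Fin 4) 𝕜}
    {t : (Fin 4 →₀ ℕ) × Fin s} (hf : IsSignature F f t) (hg : IsSignature F g t) :
    ∃ p, IsLM f p ∧ IsLM g p := by
  have key : ∀ {p q}, Attains F p t → (∀ t', Attains F p t' → t' ≠ t → TopLT t t') →
      Attains F q t → ¬ GrevlexLT q p := by
    rintro p q hp hmin ⟨e, v, hv, ht, hq⟩ hlt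
    obtain ⟨t', h1, h2⟩ := hp.exists_smaller
      (by rwa [degree_of_isHomogeneous (hv t.2) ht.1]) ht fun m hm => by
        by_cases hmq : m = q
        · rwa [hmq]
        · exact trans_of GrevlexLT (hq.2 m (mem_support_iff.2 hm) hmq) hlt
    exact asymm_of TopLT h2 (hmin t' h1 fun h => irrefl_of TopLT t (h ▸ h2))
  obtain ⟨p, hp, hp', hpm⟩ := hf
  obtain ⟨q, hq, hq', hqm⟩ := hg
  rcases trichotomous_of GrevlexLT p q with h | rfl | h
  · exact absurd h (key hq' hqm hp')
  · exact ⟨p, hp, hq⟩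
  · exact absurd h (key hp' hpm hq')

/-- No monomial of `f` involves only the variables up to `X k`. -/
def NoLowTerm (k : Fin 4) (f : MvPolynomial (Fin 4) 𝕜) : Prop :=
  ∀ m : Fin 4 →₀ ℕ, (∀ l, k < l → m l = 0) → coeff m f = 0

/-- `NoLowTerm k` expresses membership in the ideal generated by the variables after `X k`, hence
the closure properties. Moreover `X k` is a nonzerodivisor modulo this ideal. -/
theorem NoLowTerm.mul_right {k : Fin 4} {f : MvPolynomial (Fin 4) 𝕜} (h : NoLowTerm k f)
    (g : MvPolynomial (Fin 4) 𝕜) : NoLowTerm k (f * g) := by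
  classical
  intro m hm
  rw [coeff_mul]
  refine Finset.sum_eq_zero fun x hx => ?_
  rw [Finset.HasAntidiagonal.mem_antidiagonal] at hx
  rw [h x.1 fun l hl => ?_, zero_mul]
  have := hm l hl
  rw [← hx, Finsupp.add_apply] at this
  omega

theorem NoLowTerm.sum_mul {k : Fin 4} {u : Fin s → MvPolynomial (Fin 4) 𝕜}
    (h : ∀ i, NoLowTerm k (u i)) (F : Fin s → MvPolynomial (Fin 4) 𝕜) :
    NoLowTerm k (∑ i, u i * F i) := by
  intro m hm
  rw [coeff_sum]
  exact Finset.sum_eq_zero fun i _ => (h i).mul_right (F i) m hm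

theorem NoLowTerm.of_X_mul {k : Fin 4} {f : MvPolynomial (Fin 4) 𝕜}
    (h : NoLowTerm k (X k * f)) : NoLowTerm k f := by
  intro m hm
  rw [← coeff_X_mul m k f]
  refine h _ fun l hl => ?_
  simp [hm l hl, hl.ne]

/-- The signature of a row whose leading monomial involves only variables up to `X k` does so,
too. -/
theorem Attains.low {k : Fin 4} {p : Fin 4 →₀ ℕ} (hp : ∀ l, k < l → p l = 0)
    {t : (Fin 4 →₀ ℕ) × Fin s} (h : Attains F p t) : ∀ l, k < l → t.1 l = 0 := by
  obtain ⟨e, u, hu, hlm, hpu⟩ := h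
  by_contra ht
  refine mem_support_iff.1 hpu.1 (NoLowTerm.sum_mul (fun i m hm => ?_) F p hp)
  by_contra hc
  have hd : t.1.degree = m.degree := by
    rw [degree_of_isHomogeneous (hu i) hc, degree_of_isHomogeneous (hu t.2) hlm.1]
  have hlt := grevlexLT_of_low hd hm ht
  by_cases hmt : (m, i) = t
  · rw [← hmt] at hlt
    exact irrefl_of GrevlexLT _ hlt
  · rcases hlm.2 (m, i) hc hmt with h | h
    · exact asymm_of GrevlexLT h hlt
    · rw [← h.1] at hlt
      exact irrefl_of GrevlexLT _ hlt

/-- In grevlex, a syzygy with leading monomial `X k * t` is divisible by `X k` modulo the variables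
after `X k`. The quotient `v` has leading monomial `t`, and its image is zero modulo these
variables, so all its terms are smaller than `p`. Subtracting a multiple of `v` then lowers the
signature at `p`, against minimality. -/
theorem notMem_syzLM_of_low (hF : ∀ i, (F i).IsHomogeneous δ) {k : Fin 4} {p : Fin 4 →₀ ℕ}
    (hp : ∀ l, k < l → p l = 0) {t : (Fin 4 →₀ ℕ) × Fin s} (h : Attains F p t)
    (hmin : ∀ t', Attains F p t' → t' ≠ t → TopLT t t') :
    (t.1 + Finsupp.single k 1, t.2) ∉ syzLM F := by
  rintro ⟨w₀, hw₀, hlm₀⟩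
  have htlow := h.low hp
  -- pass to a homogeneous syzygy
  obtain ⟨w, hw, hlm, hwh⟩ : ∃ w : Fin s → MvPolynomial (Fin 4) 𝕜, ∑ i, w i * F i = 0 ∧
      IsModLM w (t.1 + Finsupp.single k 1, t.2) ∧ ∀ i, (w i).IsHomogeneous (t.1.degree + 1) := by
    have hc : ∀ i m, m.degree = t.1.degree + 1 →
        coeff m (homogeneousComponent (t.1.degree + 1) (w₀ i)) = coeff m (w₀ i) := fun i m hm => by
      rw [coeff_homogeneousComponent, if_pos hm]
    refine ⟨fun i => homogeneousComponent (t.1.degree + 1) (w₀ i), ?_, ⟨?_, fun t' ht' => ?_⟩,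
      fun i => homogeneousComponent_isHomogeneous _ _⟩
    · rw [sum_homogeneousComponent_mul hF, hw₀, map_zero]
    · rw [hc _ _ (by simp)]
      exact hlm₀.1
    · refine hlm₀.2 t' ?_
      rwa [hc _ _ (degree_of_isHomogeneous (homogeneousComponent_isHomogeneous _ _) ht')] at ht'
  let v : Fin s → MvPolynomial (Fin 4) 𝕜 := fun i => (w i).divMonomial (Finsupp.single k 1)
  have hcv : ∀ i m, coeff m (v i) = coeff (m + Finsupp.single k 1) (w i) := fun i m => by
    rw [coeff_divMonomial, add_comm]
  -- A term of `w` in the variables before `X k` alone would be larger than the leading monomial of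
  -- `w`, which is divisible by `X k`.
  have hlow : ∀ i, NoLowTerm k (w i - X k * v i) := by
    intro i m hm
    by_cases hmk : m k = 0
    · rw [coeff_sub, coeff_X_mul', if_neg (by simpa using hmk), sub_zero]
      by_contra hc
      have hne : (m, i) ≠ (t.1 + Finsupp.single k 1, t.2) := by
        intro h
        have := congrArg (fun x => x.1 k) h
        simp [hmk] at this
      have hdeg : m.degree = (t.1 + Finsupp.single k 1).degree := by
        rw [degree_of_isHomogeneous (hwh i) hc]
        simp
      have hlt : GrevlexLT m (t.1 + Finsupp.single k 1) := by
        rcases hlm.2 (m, i) hc hne with h | h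
        · exact h
        · exfalso
          have := congrArg (fun x : Fin 4 →₀ ℕ => x k) h.1
          simp [hmk] at this
      have := apply_le_of_grevlexLT_of_low hdeg hm (fun l hl => by
        simp [htlow l hl, hl.ne]) hlt
      simp [hmk] at this
    · have : m = (m - Finsupp.single k 1) + Finsupp.single k 1 := by
        rw [tsub_add_cancel_of_le]
        rw [Finsupp.single_le_iff]
        omega
      rw [coeff_sub, coeff_X_mul', if_pos (by simpa using hmk), hcv, ← this, sub_self]
  have hvF : NoLowTerm k (∑ i, v i * F i) := by
    refine NoLowTerm.of_X_mul fun m hm => ?_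
    have h1 := NoLowTerm.sum_mul hlow F m hm
    simp only [sub_mul, Finset.sum_sub_distrib, hw, zero_sub, coeff_neg, neg_eq_zero] at h1
    rw [← h1, Finset.mul_sum]
    simp only [mul_assoc]
  have hvh : ∀ i, (v i).IsHomogeneous t.1.degree := by
    refine fun i => isHomogeneous_of_degree fun m hm => ?_
    rw [hcv] at hm
    simpa using degree_of_isHomogeneous (hwh i) hm
  have hvt : IsModLM v t := by
    refine ⟨by rw [hcv]; exact hlm.1, fun t' ht' hne => ?_⟩
    rw [hcv] at ht'
    have hne' : (t'.1 + Finsupp.single k 1, t'.2) ≠ (t.1 + Finsupp.single k 1, t.2) := by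
      intro h
      rw [Prod.mk.injEq] at h
      exact hne (Prod.ext (add_right_cancel h.1) h.2)
    rcases hlm.2 _ ht' hne' with h | h
    · exact .inl (grevlexLT_add_right_iff.1 h)
    · exact .inr ⟨add_right_cancel h.1, h.2⟩
  have hdeg := h.degree_eq hF
  obtain ⟨t', h1, h2⟩ := h.exists_smaller hvh hvt fun m hm => by
    refine grevlexLT_of_low ?_ hp fun hlow => hm (hvF m hlow)
    rw [degree_of_isHomogeneous (isHomogeneous_sum_mul hF hvh) hm, hdeg]
  exact asymm_of TopLT h2 (hmin t' h1 fun h => irrefl_of TopLT t (h ▸ h2))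

end Signatures

/-! ### Leading positions and dimension -/

section LeadingPositions

variable {𝕜 C : Type*} [Field 𝕜] [LinearOrder C]

/-- `c` is the first position at which the vector `v` does not vanish. -/
def IsLead (v : C → 𝕜) (c : C) : Prop := (∀ c' < c, v c' = 0) ∧ v c ≠ 0

theorem IsLead.unique {v : C → 𝕜} {c c' : C} (h : IsLead v c) (h' : IsLead v c') : c = c' :=
  le_antisymm (not_lt.1 fun hlt => h'.2 (h.1 _ hlt)) (not_lt.1 fun hlt => h.2 (h'.1 _ hlt))

theorem exists_isLead [Fintype C] {v : C → 𝕜} (hv : v ≠ 0) : ∃ c, IsLead v c := by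
  classical
  obtain ⟨x, hx⟩ := Function.ne_iff.1 hv
  let T : Finset C := Finset.univ.filter fun c => v c ≠ 0
  have hT : T.Nonempty := ⟨x, by simpa [T] using hx⟩
  refine ⟨T.min' hT, fun c' hc' => ?_, by simpa [T] using T.min'_mem hT⟩
  by_contra h
  exact absurd (T.min'_le c' (by simpa [T] using h)) (not_le.2 hc')

/-- The dimension of a space of vectors is the number of leading positions. -/
theorem finrank_eq_card_lead [Fintype C] (W : Submodule 𝕜 (C → 𝕜)) :
    Module.finrank 𝕜 W = Nat.card {c // ∃ v ∈ W, IsLead v c} := by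
  classical
  rw [Nat.card_eq_fintype_card]
  apply le_antisymm
  · let Φ : W →ₗ[𝕜] ({c // ∃ v ∈ W, IsLead v c} → 𝕜) :=
      { toFun := fun v c => v.1 c.1
        map_add' := fun _ _ => rfl
        map_smul' := fun _ _ => rfl }
    have hΦ : Function.Injective Φ := by
      rw [← LinearMap.ker_eq_bot, LinearMap.ker_eq_bot']
      intro v hv
      by_contra hne
      obtain ⟨c, hc⟩ := exists_isLead (v := v.1) fun h => hne (Subtype.ext h)
      exact hc.2 (congrFun hv ⟨c, v.1, v.2, hc⟩)
    simpa using LinearMap.finrank_le_finrank_of_injective hΦ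
  · choose v hv hlead using fun c : {c // ∃ v ∈ W, IsLead v c} => c.2
    refine LinearIndependent.fintype_card_le_finrank (R := 𝕜)
      (b := fun c => (⟨v c, hv c⟩ : W)) ?_
    rw [Fintype.linearIndependent_iff]
    intro g hg
    by_contra! hne
    obtain ⟨i, hi⟩ := hne
    -- In a linear relation the smallest leading position with nonzero coefficient cannot be
    -- cancelled.
    let T : Finset {c // ∃ v ∈ W, IsLead v c} := Finset.univ.filter fun c => g c ≠ 0
    have hT : T.Nonempty := ⟨i, by simpa [T] using hi⟩
    have hmem : g (T.min' hT) ≠ 0 := by simpa [T] using T.min'_mem hT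
    have h0 := congrFun (congrArg Subtype.val hg) (T.min' hT).1
    simp only [Submodule.coe_sum, Submodule.coe_smul, Finset.sum_apply, Pi.smul_apply,
      smul_eq_mul, ZeroMemClass.coe_zero, Pi.zero_apply] at h0
    rw [Finset.sum_eq_single (T.min' hT)] at h0
    · exact (mul_ne_zero hmem (hlead _).2) h0
    · intro c _ hc
      by_cases hg0 : g c = 0
      · rw [hg0, zero_mul]
      · rw [(hlead c).1, mul_zero]
        exact lt_of_le_of_ne (T.min'_le c (by simpa [T] using hg0)) (fun h => hc (Subtype.ext h.symm))
    · simp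

theorem exists_isLeadingEntry_of_mem_span {q : ℕ} {E : Matrix (Fin q) C 𝕜}
    (hE : E.IsReducedRowEchelon) [Fintype C] {v : C → 𝕜}
    (hv : v ∈ Submodule.span 𝕜 (Set.range fun i => E i)) {c : C} (hc : IsLead v c) :
    ∃ i, E.IsLeadingEntry i c := by
  classical
  obtain ⟨g, rfl⟩ := (Submodule.mem_span_range_iff_exists_fun 𝕜).1 hv
  -- The first nonzero row that occurs in the combination determines its leading position, since
  -- later rows lead further right.
  let T : Finset (Fin q) := Finset.univ.filter fun i => g i ≠ 0 ∧ E i ≠ 0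
  have hT : T.Nonempty := by
    by_contra h
    rw [Finset.not_nonempty_iff_eq_empty] at h
    refine hc.2 ?_
    rw [Finset.sum_apply]
    refine Finset.sum_eq_zero fun i _ => ?_
    have hi : i ∉ T := h ▸ Finset.notMem_empty i
    simp only [T, Finset.mem_filter, Finset.mem_univ, true_and, not_and_or, not_not] at hi
    rcases hi with hi | hi <;> simp [hi]
  have hmin := T.min'_mem hT
  set i₀ := T.min' hT with hi₀
  simp only [T, Finset.mem_filter, Finset.mem_univ, true_and] at hmin
  obtain ⟨ℓ, hℓ⟩ := exists_isLead hmin.2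
  have heq : ∀ x ≤ ℓ, (∑ i, g i • E i) x = g i₀ * E i₀ x := by
    intro x hx
    rw [Finset.sum_apply, Finset.sum_eq_single i₀]
    · rfl
    · intro i _ hi
      by_cases hiT : i ∈ T
      · have hlt : i₀ < i := lt_of_le_of_ne (T.min'_le i hiT) (Ne.symm hi)
        have := hE.isRowEchelon hlt fun j hj => hℓ.1 j (lt_of_lt_of_le hj hx)
        rw [Pi.smul_apply, this, smul_zero]
      · simp only [T, Finset.mem_filter, Finset.mem_univ, true_and, not_and_or, not_not] at hiT
        rcases hiT with hi | hi <;> simp [hi]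
    · simp
  have hlead : IsLead (∑ i, g i • E i) ℓ :=
    ⟨fun x hx => by rw [heq x hx.le, hℓ.1 x hx, mul_zero],
      by rw [heq ℓ le_rfl]; exact mul_ne_zero hmin.1 hℓ.2⟩
  rw [hc.unique hlead]
  exact ⟨i₀, hℓ⟩

end LeadingPositions

/-! ### Macaulay matrices and the graded pieces of the ideal -/

section RowSpace

variable {𝕜 : Type*} [Field 𝕜]

theorem coeff_rowPoly {d : ℕ} (v : MonDeg d → 𝕜) (σ : MonDeg d) :
    coeff σ.1 (rowPoly v) = v σ := by
  classical
  rw [rowPoly, coeff_sum, Finset.sum_eq_single σ]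
  · rw [coeff_monomial, if_pos rfl]
  · intro m _ hm
    rw [coeff_monomial, if_neg fun h => hm (Subtype.ext h)]
  · simp

theorem isHomogeneous_rowPoly {d : ℕ} (v : MonDeg d → 𝕜) : (rowPoly v).IsHomogeneous d :=
  IsHomogeneous.sum _ _ _ fun m _ => isHomogeneous_monomial _ m.degree_eq

theorem rowPoly_coeff {d : ℕ} {f : MvPolynomial (Fin 4) 𝕜} (hf : f.IsHomogeneous d) :
    rowPoly (fun σ : MonDeg d => coeff σ.1 f) = f := by
  ext m
  by_cases hm : m.degree = d
  · exact coeff_rowPoly _ (MonDeg.mk m hm)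
  · have h1 : coeff m f = 0 := by
      by_contra h
      exact hm (degree_of_isHomogeneous hf h)
    have h2 : coeff m (rowPoly fun σ : MonDeg d => coeff σ.1 f) = 0 := by
      by_contra h
      exact hm (degree_of_isHomogeneous (isHomogeneous_rowPoly _) h)
    rw [h1, h2]

/-- The polynomial represented by a row, as a linear map. -/
def rowPolyLinear (d : ℕ) : (MonDeg d → 𝕜) →ₗ[𝕜] MvPolynomial (Fin 4) 𝕜 where
  toFun := rowPoly
  map_add' v w := by simp [rowPoly, Finset.sum_add_distrib]
  map_smul' a v := by simp [rowPoly, Finset.smul_sum, smul_monomial]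

/-- The coefficient vectors of the forms of degree `d` in an ideal. -/
def rowSpace (I : Ideal (MvPolynomial (Fin 4) 𝕜)) (d : ℕ) : Submodule 𝕜 (MonDeg d → 𝕜) :=
  (I.restrictScalars 𝕜).comap (rowPolyLinear d)

theorem mem_rowSpace {I : Ideal (MvPolynomial (Fin 4) 𝕜)} {d : ℕ} {v : MonDeg d → 𝕜} :
    v ∈ rowSpace I d ↔ rowPoly v ∈ I := Iff.rfl

theorem rowPolyLinear_injective (d : ℕ) :
    Function.Injective (rowPolyLinear d : (MonDeg d → 𝕜) →ₗ[𝕜] _) := by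
  intro v w h
  funext σ
  rw [← coeff_rowPoly v, ← coeff_rowPoly w]
  exact congrArg (coeff σ.1) h

theorem map_rowSpace (I : Ideal (MvPolynomial (Fin 4) 𝕜)) (d : ℕ) :
    (rowSpace I d).map (rowPolyLinear d) =
      Submodule.restrictScalars 𝕜 I ⊓ homogeneousSubmodule (Fin 4) 𝕜 d := by
  ext f
  constructor
  · rintro ⟨v, hv, rfl⟩
    exact ⟨hv, isHomogeneous_rowPoly v⟩
  · rintro ⟨h1, h2⟩
    refine ⟨fun σ => coeff σ.1 f, ?_, rowPoly_coeff h2⟩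
    rw [SetLike.mem_coe, mem_rowSpace, rowPoly_coeff h2]
    exact h1

theorem hilbertFun_eq_finrank (I : Ideal (MvPolynomial (Fin 4) 𝕜)) (d : ℕ) :
    hilbertFun I d = Module.finrank 𝕜 (rowSpace I d) := by
  rw [hilbertFun, ← map_rowSpace]
  exact (LinearEquiv.finrank_eq (Submodule.equivMapOfInjective _ (rowPolyLinear_injective d)
    (rowSpace I d))).symm

theorem hilbertFun_le (I : Ideal (MvPolynomial (Fin 4) 𝕜)) (d : ℕ) :
    hilbertFun I d ≤ (d + 3).choose 3 := by
  rw [hilbertFun_eq_finrank, ← card_monDeg, ← Module.finrank_fintype_fun_eq_card (R := 𝕜)]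
  exact Submodule.finrank_le _

theorem isLM_rowPoly_iff {d : ℕ} {v : MonDeg d → 𝕜} {c : MonDeg d} :
    letI := monDegLinearOrder d
    IsLM (rowPoly v) c.1 ↔ IsLead v c := by
  let _ := monDegLinearOrder d
  constructor
  · rintro ⟨h1, h2⟩
    rw [mem_support_iff, coeff_rowPoly] at h1
    refine ⟨fun c' hc' => ?_, h1⟩
    by_contra h
    have hne : c'.1 ≠ c.1 := fun h => hc'.ne (Subtype.ext h)
    exact asymm_of GrevlexLT (show GrevlexLT c.1 c'.1 from hc')
      (h2 c'.1 (by rwa [mem_support_iff, coeff_rowPoly]) hne)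
  · rintro ⟨h1, h2⟩
    refine ⟨by rwa [mem_support_iff, coeff_rowPoly], fun m hm hne => ?_⟩
    rw [mem_support_iff] at hm
    have hd := degree_of_isHomogeneous (isHomogeneous_rowPoly v) hm
    rw [show m = (MonDeg.mk m hd).1 from rfl, coeff_rowPoly] at hm
    rcases trichotomous_of GrevlexLT m c.1 with h | h | h
    · exact h
    · exact absurd h hne
    · exact absurd (h1 (MonDeg.mk m hd) h) hm

variable {s : ℕ} {F : Fin s → MvPolynomial (Fin 4) 𝕜} {δ : ℕ}

theorem mem_leadingMonomials_iff (hF : ∀ i, (F i).IsHomogeneous δ) {d : ℕ} (hd : δ ≤ d)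
    (c : MonDeg d) :
    letI := monDegLinearOrder d
    c.1 ∈ leadingMonomials (Ideal.span (Set.range F)) ↔
      ∃ v ∈ rowSpace (Ideal.span (Set.range F)) d, IsLead v c := by
  let _ := monDegLinearOrder d
  constructor
  · rintro ⟨f, hf, hlm⟩
    have h1 := homogeneousComponent_mem_span hF hf hd
    have h2 := hlm.homogeneousComponent
    rw [c.degree_eq] at h2
    have h3 := rowPoly_coeff (homogeneousComponent_isHomogeneous d f)
    refine ⟨fun σ => coeff σ.1 (homogeneousComponent d f), ?_, ?_⟩
    · rwa [mem_rowSpace, h3]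
    · rwa [← isLM_rowPoly_iff, h3]
  · rintro ⟨v, hv, hlead⟩
    exact ⟨rowPoly v, hv, isLM_rowPoly_iff.2 hlead⟩

theorem hilbertFun_eq_card_leadingMonomials (hF : ∀ i, (F i).IsHomogeneous δ) {d : ℕ}
    (hd : δ ≤ d) : hilbertFun (Ideal.span (Set.range F)) d =
      Nat.card {c : MonDeg d // c.1 ∈ leadingMonomials (Ideal.span (Set.range F))} := by
  let _ := monDegLinearOrder d
  rw [hilbertFun_eq_finrank, finrank_eq_card_lead]
  exact Nat.card_congr (Equiv.subtypeEquivRight fun c => (mem_leadingMonomials_iff hF hd c).symm)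

theorem span_macaulay (hF : ∀ i, (F i).IsHomogeneous δ) {d : ℕ} (hd : δ ≤ d) :
    Submodule.span 𝕜 (Set.range fun p => macaulay F δ d p) =
      rowSpace (Ideal.span (Set.range F)) d := by
  apply le_antisymm
  · rw [Submodule.span_le]
    rintro _ ⟨p, rfl⟩
    have hh : (monomial p.1.1 (1 : 𝕜) * F p.2).IsHomogeneous d := by
      have := (isHomogeneous_monomial (1 : 𝕜) p.1.degree_eq).mul (hF p.2)
      rwa [Nat.sub_add_cancel hd] at this
    change rowPoly (fun σ : MonDeg d => coeff σ.1 (monomial p.1.1 (1 : 𝕜) * F p.2)) ∈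
      Ideal.span (Set.range F)
    rw [rowPoly_coeff hh]
    exact Ideal.mul_mem_left _ _ (Ideal.subset_span ⟨p.2, rfl⟩)
  · intro v hv
    obtain ⟨u, hu, h⟩ := exists_homogeneous_combination hF (mem_rowSpace.1 hv) (d - δ)
    rw [Nat.sub_add_cancel hd, homogeneousComponent_eq_self (isHomogeneous_rowPoly v)] at h
    have hv' : v = ∑ i, ∑ τ : MonDeg (d - δ), coeff τ.1 (u i) • macaulay F δ d (τ, i) := by
      funext σ
      rw [← coeff_rowPoly v σ, ← h, coeff_sum, Finset.sum_apply]
      refine Finset.sum_congr rfl fun i _ => ?_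
      conv_lhs => rw [← rowPoly_coeff (hu i), rowPoly, Finset.sum_mul, coeff_sum]
      rw [Finset.sum_apply]
      refine Finset.sum_congr rfl fun τ _ => ?_
      rw [Pi.smul_apply, smul_eq_mul, macaulay, ← coeff_C_mul, ← mul_assoc, C_mul_monomial, mul_one]
    rw [hv']
    exact Submodule.sum_mem _ fun i _ => Submodule.sum_mem _ fun τ _ =>
      Submodule.smul_mem _ _ (Submodule.subset_span ⟨(τ, i), rfl⟩)

end RowSpace

/-! ### The shape and the number of rows of the built matrix -/

section BuiltMatrix

variable {𝕜 : Type*} [Field 𝕜] {s : ℕ} {F : Fin s → MvPolynomial (Fin 4) 𝕜} {δ d a : ℕ}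

/-- The monomial `X k * m`. -/
def MonDeg.mulX (m : MonDeg d) (k : Fin 4) : MonDeg (d + 1) :=
  MonDeg.mk (m.1 + Finsupp.single k 1) (by simp [m.degree_eq])

theorem lastExp_mulX (m : MonDeg d) (k : Fin 4) :
    lastExp (m.mulX k) = lastExp m + if k = 3 then 1 else 0 := by
  simp [lastExp, MonDeg.mulX, MonDeg.mk, Finsupp.single_apply]

theorem coeff_X_mul_rowPoly (v : MonDeg d → 𝕜) (k : Fin 4) (m : MonDeg d) :
    coeff (m.mulX k).1 (X k * rowPoly v) = v m := by
  have := coeff_X_mul m.1 k (rowPoly v)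
  rw [coeff_rowPoly, add_comm] at this
  exact this

theorem exists_of_coeff_X_mul_rowPoly_ne_zero {v : MonDeg d → 𝕜} {k : Fin 4} {σ : MonDeg (d + 1)}
    (h : coeff σ.1 (X k * rowPoly v) ≠ 0) : ∃ m : MonDeg d, σ = m.mulX k ∧ v m ≠ 0 := by
  rw [coeff_X_mul'] at h
  split_ifs at h with hk
  swap
  · exact absurd rfl h
  have hle : Finsupp.single k 1 ≤ σ.1 := by
    rw [Finsupp.single_le_iff]
    exact Nat.one_le_iff_ne_zero.2 (Finsupp.mem_support_iff.1 hk)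
  have heq : σ.1 - Finsupp.single k 1 + Finsupp.single k 1 = σ.1 := tsub_add_cancel_of_le hle
  have hdeg : (σ.1 - Finsupp.single k 1).degree = d := by
    have h1 := σ.degree_eq
    rw [← heq] at h1
    simpa using h1
  refine ⟨MonDeg.mk _ hdeg, Subtype.ext heq.symm, ?_⟩
  rwa [← coeff_rowPoly v]

theorem isHomogeneous_X_mul_rowPoly (v : MonDeg d → 𝕜) (k : Fin 4) :
    (X k * rowPoly v).IsHomogeneous (d + 1) := by
  rw [add_comm]
  exact (isHomogeneous_X 𝕜 k).mul (isHomogeneous_rowPoly v)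

/-- The row of coefficients of `X k * g`, where `g` is a row of a reduced row echelon form with
leading monomial `c`. -/
theorem isPivot_of_isLead {q : ℕ} {E : Matrix (Fin q) (MonDeg d) 𝕜} (hE : E.IsReducedRowEchelon)
    {I : Ideal (MvPolynomial (Fin 4) 𝕜)}
    (hspan : Submodule.span 𝕜 (Set.range fun i => E i) = rowSpace I d)
    (hlow : letI := monDegLinearOrder d
      ∀ m : MonDeg d, lastExp m < a ↔ ∃ v ∈ rowSpace I d, IsLead v m)
    {i : Fin q} {c : MonDeg d} (hc : E.IsLeadingEntry i c) (k : Fin 4) :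
    lastExp (c.mulX k) ≤ a ∧ IsPivot lastExp a
      (fun σ : MonDeg (d + 1) => coeff σ.1 (X k * rowPoly (E i))) (c.mulX k) := by
  let _ := monDegLinearOrder d
  have hca : lastExp c < a :=
    (hlow c).2 ⟨E i, hspan ▸ Submodule.subset_span ⟨i, rfl⟩, hc⟩
  have hexp := lastExp_mulX c k
  refine ⟨by split_ifs at hexp <;> omega, ?_, fun σ hσ h0 => ?_⟩
  · exact (coeff_X_mul_rowPoly _ _ _).trans (hE.eq_one hc)
  · obtain ⟨m, rfl, hm⟩ := exists_of_coeff_X_mul_rowPoly_ne_zero h0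
    have hmc : m ≠ c := fun h => hσ (h ▸ rfl)
    -- Every column of level below `a` is a pivot column of `E`, so it is zero in all rows but its
    -- own.
    have hma : a ≤ lastExp m := by
      by_contra hlt
      obtain ⟨v, hv, hlead⟩ := (hlow m).1 (not_le.1 hlt)
      rw [← hspan] at hv
      obtain ⟨j, hj⟩ := exists_isLeadingEntry_of_mem_span hE hv hlead
      have hij : i ≠ j := by
        rintro rfl
        exact hmc (IsLead.unique (v := E i) hj hc)
      exact hm (hE.eq_zero_of_ne_of_isLeadingEntry hij hj)
    have hexp' := lastExp_mulX m k
    constructor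
    · omega
    -- A product of level `a` comes from a leading monomial of level below `a`, so `k = 3`, and
    -- multiplication raises the level of the other terms as well.
    · intro h
      split_ifs at hexp hexp' <;> omega

/-- The matrix built from the reduced matrix in degree `d` is close to an echelon form, if the
leading monomials in degree `d` are those in which the exponent of the last variable is small. -/
theorem IsBuiltMatrix.isNearEchelon (hF : ∀ i, (F i).IsHomogeneous δ) (hd : δ ≤ d) (ha : 0 < a)
    (hlow : ∀ m : MonDeg d,
      m.1 ∈ leadingMonomials (Ideal.span (Set.range F)) ↔ lastExp m < a)
    (hnext : ∀ m : MonDeg (d + 1),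
      m.1 ∈ leadingMonomials (Ideal.span (Set.range F)) → lastExp m ≤ a + 1)
    {r : ℕ} {A : Matrix (Fin r) (MonDeg (d + 1)) 𝕜} (hA : IsBuiltMatrix F δ d A) :
    IsNearEchelon lastExp a A := by
  obtain ⟨q, E, ⟨hE, hspan⟩, e, he⟩ := hA
  rw [span_macaulay hF hd] at hspan
  let _ := monDegLinearOrder d
  have hlow' : ∀ m : MonDeg d, lastExp m < a ↔
      ∃ v ∈ rowSpace (Ideal.span (Set.range F)) d, IsLead v m := fun m =>
    (hlow m).symm.trans (mem_leadingMonomials_iff hF hd m)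
  have hrow : ∀ i, A i = fun σ => coeff σ.1 (X (e i).1.2 * rowPoly (E (e i).1.1)) := fun i =>
    funext fun σ => he i σ
  have hmem : ∀ i, rowPoly (E i) ∈ Ideal.span (Set.range F) := fun i => by
    rw [← mem_rowSpace, ← hspan]
    exact Submodule.subset_span ⟨i, rfl⟩
  constructor
  · intro i
    obtain ⟨c, hc⟩ := exists_isLead (e i).2.1
    rw [hrow i]
    exact ⟨_, isPivot_of_isLead hE hspan hlow' hc _⟩
  · intro ℓ hℓ
    -- Take the last variable `X k` that divides `ℓ`. Then `ℓ / X k` is a leading monomial in degree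
    -- `d` without variables after `X k`, as required by the syzygy criterion.
    obtain ⟨k, hk, hkmax⟩ : ∃ k, ℓ.1 k ≠ 0 ∧ ∀ l, k < l → ℓ.1 l = 0 := by
      have hne : ℓ.1.support.Nonempty := by
        rw [Finsupp.support_nonempty_iff]
        intro h
        have := ℓ.degree_eq
        rw [h] at this
        simp at this
      refine ⟨ℓ.1.support.max' hne, Finsupp.mem_support_iff.1 (Finset.max'_mem _ _), fun l hl => ?_⟩
      by_contra h
      exact absurd (Finset.le_max' _ l (Finsupp.mem_support_iff.2 h)) (not_le.2 hl)
    have heq : ℓ.1 - Finsupp.single k 1 + Finsupp.single k 1 = ℓ.1 := by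
      apply tsub_add_cancel_of_le
      rw [Finsupp.single_le_iff]
      omega
    have hdeg : (ℓ.1 - Finsupp.single k 1).degree = d := by
      have h1 := ℓ.degree_eq
      rw [← heq] at h1
      simpa using h1
    obtain ⟨c, rfl⟩ : ∃ c : MonDeg d, ℓ = c.mulX k := ⟨MonDeg.mk _ hdeg, Subtype.ext heq.symm⟩
    have hclow : ∀ l, k < l → c.1 l = 0 := fun l hl => by
      have : c.1 l + (Finsupp.single k 1 : Fin 4 →₀ ℕ) l = 0 := hkmax l hl
      omega
    have hca : lastExp c < a := by
      have hexp := lastExp_mulX c k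
      by_cases hk3 : k = 3
      · rw [if_pos hk3] at hexp
        omega
      · have : c.1 3 = 0 := hclow 3 (by omega)
        change c.1 3 < a
        omega
    obtain ⟨v, hv, hlead⟩ := (hlow' c).1 hca
    rw [← hspan] at hv
    obtain ⟨i, hi⟩ := exists_isLeadingEntry_of_mem_span hE hv hlead
    have hlm : IsLM (rowPoly (E i)) c.1 := isLM_rowPoly_iff.2 hi
    obtain ⟨t, ht⟩ := exists_isSignature hF (hmem i) hd (isHomogeneous_rowPoly _) hlm
    have hnew : (i, k) ∈ newRows F E := by
      refine ⟨hi.row_ne_zero, t, ht, fun l hl => ?_, ?_⟩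
      · obtain ⟨p, hp, hatt, -⟩ := ht
        by_contra hkl
        rw [hlm.unique hp] at hclow
        exact Finsupp.mem_support_iff.1 hl (hatt.low hclow l (not_le.1 hkl))
      · obtain ⟨p, hp, hatt, hmin⟩ := ht
        rw [hlm.unique hp] at hclow
        exact notMem_syzLM_of_low hF hclow hatt hmin
    refine ⟨e.symm ⟨(i, k), hnew⟩, ?_⟩
    rw [hrow, Equiv.apply_symm_apply]
    exact (isPivot_of_isLead hE hspan hlow' hi k).2
  · intro v hv hzero
    have hle : Submodule.span 𝕜 (Set.range fun i => A i) ≤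
        rowSpace (Ideal.span (Set.range F)) (d + 1) := by
      rw [Submodule.span_le]
      rintro _ ⟨i, rfl⟩
      rw [SetLike.mem_coe, mem_rowSpace]
      change rowPoly (A i) ∈ _
      rw [hrow i, rowPoly_coeff (isHomogeneous_X_mul_rowPoly _ _)]
      exact Ideal.mul_mem_left _ _ (hmem _)
    by_contra hne
    let _ := monDegLinearOrder (d + 1)
    obtain ⟨c, hc⟩ := exists_isLead hne
    -- A nonzero vector of the row space would have its leading monomial at level at most `a + 1`.
    exact hc.2 (hzero c (hnext c ((mem_leadingMonomials_iff hF (by omega) c).2 ⟨v, hle hv, hc⟩)))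

/-- The built matrix has at most as many rows as the dimension of the ideal in its degree. -/
theorem IsBuiltMatrix.card_rows_le (hF : ∀ i, (F i).IsHomogeneous δ)
    {r : ℕ} {A : Matrix (Fin r) (MonDeg (d + 1)) 𝕜} (hA : IsBuiltMatrix F δ d A) :
    r ≤ hilbertFun (Ideal.span (Set.range F)) (d + 1) := by
  classical
  obtain ⟨q, E, ⟨hE, -⟩, e, -⟩ := hA
  let _ := monDegLinearOrder d
  choose hne t hsig hvar hsyz using fun i => (e i).2
  let T : Fin r → (Fin 4 →₀ ℕ) × Fin s := fun i =>
    ((t i).1 + Finsupp.single (e i).1.2 1, (t i).2)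
  have hdeg : ∀ i, (t i).1.degree + δ = d := by
    intro i
    obtain ⟨p, hp, hatt, -⟩ := hsig i
    rw [hatt.degree_eq hF]
    exact degree_of_isHomogeneous (isHomogeneous_rowPoly _) (mem_support_iff.1 hp.1)
  have hT : T.Injective := by
    intro i j hij
    simp only [T, Prod.mk.injEq] at hij
    -- The variable is recovered from the product: it is the last one dividing it, since no later
    -- variable divides the signature.
    have hk : (e i).1.2 = (e j).1.2 := by
      have key : ∀ i j, (t i).1 + Finsupp.single (e i).1.2 1 =
          (t j).1 + Finsupp.single (e j).1.2 1 → (e i).1.2 ≤ (e j).1.2 := by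
        intro i j h
        by_contra hlt
        have h1 := congrArg (fun x : Fin 4 →₀ ℕ => x (e i).1.2) h
        have hne : (e j).1.2 ≠ (e i).1.2 := fun h => hlt h.ge
        simp only [Finsupp.add_apply, Finsupp.single_eq_same, Finsupp.single_eq_of_ne hne.symm,
          add_zero] at h1
        exact hlt (hvar j _ (Finsupp.mem_support_iff.2 (by omega)))
      exact le_antisymm (key i j hij.1) (key j i hij.1.symm)
    have ht : t i = t j := by
      rw [hk] at hij
      exact Prod.ext (add_right_cancel hij.1) hij.2
    obtain ⟨p, hp, hp'⟩ := (hsig i).lm_unique (ht ▸ hsig j)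
    have hpd : p.degree = d :=
      degree_of_isHomogeneous (isHomogeneous_rowPoly _) (mem_support_iff.1 hp.1)
    have h1 : E.IsLeadingEntry (e i).1.1 (MonDeg.mk p hpd) := isLM_rowPoly_iff.1 hp
    have h2 : E.IsLeadingEntry (e j).1.1 (MonDeg.mk p hpd) := isLM_rowPoly_iff.1 hp'
    have hr : (e i).1.1 = (e j).1.1 := by
      by_contra hne
      exact h1.2 (hE.eq_zero_of_ne_of_isLeadingEntry hne h2)
    exact e.injective (Subtype.ext (Prod.ext hr hk))
  -- Independence is shown not for the rows but for the products of their module monomials with `F`.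
  -- A linear relation among these is a syzygy whose leading monomial is one of the `T i`, which the
  -- algorithm has excluded.
  let f : Fin r → MvPolynomial (Fin 4) 𝕜 := fun i => monomial (T i).1 1 * F (T i).2
  have hf : ∀ i, f i ∈ Submodule.restrictScalars 𝕜 (Ideal.span (Set.range F)) ⊓
      homogeneousSubmodule (Fin 4) 𝕜 (d + 1) := by
    intro i
    refine ⟨Ideal.mul_mem_left _ _ (Ideal.subset_span ⟨_, rfl⟩), ?_⟩
    have h1 := (isHomogeneous_monomial (1 : 𝕜) (d := (T i).1) rfl).mul (hF (T i).2)
    have h2 : (T i).1.degree + δ = d + 1 := by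
      simp only [T, map_add, Finsupp.degree_single]
      have := hdeg i
      omega
    rw [h2] at h1
    exact h1
  have hfin : FiniteDimensional 𝕜 ↥(Submodule.restrictScalars 𝕜 (Ideal.span (Set.range F)) ⊓
      homogeneousSubmodule (Fin 4) 𝕜 (d + 1)) := by
    rw [← map_rowSpace]
    infer_instance
  have hind : LinearIndependent 𝕜 fun i => (⟨f i, hf i⟩ :
      ↥(Submodule.restrictScalars 𝕜 (Ideal.span (Set.range F)) ⊓
        homogeneousSubmodule (Fin 4) 𝕜 (d + 1))) := by
    rw [Fintype.linearIndependent_iff]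
    intro g hg
    have hg' : ∑ i, g i • f i = 0 := by
      have := congrArg Subtype.val hg
      simpa using this
    by_contra! hne
    obtain ⟨i₀, hi₀⟩ := hne
    let w : Fin s → MvPolynomial (Fin 4) 𝕜 := fun j =>
      ∑ i, if (T i).2 = j then monomial (T i).1 (g i) else 0
    have hw : ∀ x : (Fin 4 →₀ ℕ) × Fin s, coeff x.1 (w x.2) = ∑ i, if T i = x then g i else 0 := by
      intro x
      simp only [w, coeff_sum]
      refine Finset.sum_congr rfl fun i _ => ?_
      by_cases h2 : (T i).2 = x.2
      · rw [if_pos h2, coeff_monomial]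
        exact if_congr ⟨fun h1 => Prod.ext h1 h2, fun h => congrArg Prod.fst h⟩ rfl rfl
      · rw [if_neg h2, coeff_zero, if_neg fun h => h2 (congrArg Prod.snd h)]
    have hwT : ∀ i, coeff (T i).1 (w (T i).2) = g i := by
      intro i
      rw [hw, Finset.sum_eq_single i]
      · rw [if_pos rfl]
      · intro j _ hj
        rw [if_neg fun h => hj (hT h)]
      · simp
    have hsum : ∑ j, w j * F j = 0 := by
      rw [← hg']
      simp only [w, Finset.sum_mul, ite_mul, zero_mul]
      rw [Finset.sum_comm]
      refine Finset.sum_congr rfl fun i _ => ?_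
      rw [Finset.sum_ite_eq, if_pos (Finset.mem_univ _), ← smul_mul_assoc, smul_monomial,
        smul_eq_mul, mul_one]
    have hw0 : w ≠ 0 := by
      intro h
      refine hi₀ ?_
      rw [← hwT i₀, h]
      simp
    obtain ⟨x, hx⟩ := exists_isModLM hw0
    obtain ⟨i, rfl⟩ : ∃ i, T i = x := by
      by_contra! h
      refine hx.1 ?_
      rw [hw]
      exact Finset.sum_eq_zero fun i _ => if_neg (h i)
    exact hsyz i ⟨w, hsum, hx⟩
  have := hind.fintype_card_le_finrank
  rwa [Fintype.card_fin] at this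

end BuiltMatrix

/-! ### The generic Hilbert function and the leading monomials -/

section GenericHilbertFunction

theorem six_mul_choose_three (x : ℕ) : (6 : ℤ) * (x.choose 3 : ℤ) = x * (x - 1) * (x - 2) := by
  induction x with
  | zero => simp
  | succ x ih =>
    have h2 : (2 : ℤ) * (x.choose 2 : ℤ) = x * (x - 1) := by
      have := Nat.cast_choose_two ℚ x
      have h : (2 : ℚ) * (x.choose 2 : ℚ) = x * (x - 1) := by rw [this]; ring
      exact_mod_cast h
    rw [Nat.choose_succ_succ]
    push_cast
    linear_combination ih + 3 * h2

variable {𝕜 : Type*} [Field 𝕜] {n D : ℕ}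

/-- After multiplication by 6 this is a polynomial identity in n and D. The bounds on `D` ensure
that the natural subtractions are genuine. -/
theorem HasGenericHilbertFun.add_choose {I : Ideal (MvPolynomial (Fin 4) 𝕜)}
    (h : HasGenericHilbertFun n I) (hn : 3 ≤ n) (h1 : n - 1 ≤ D) (h2 : D ≤ 2 * n - 3) :
    hilbertFun I D + (2 * n - 1 - D).choose 3 = (D + 3).choose 3 := by
  have h0 := h D h1 h2
  obtain ⟨y, rfl⟩ : ∃ y, D = n - 1 + y := ⟨D - (n - 1), by omega⟩
  obtain ⟨m, rfl⟩ : ∃ m, n = m + 1 := ⟨n - 1, by omega⟩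
  rw [show m + 1 - 1 + y + 4 - (m + 1) = y + 3 by omega,
    show m + 1 - 1 + y + 3 - (m + 1) = y + 2 by omega,
    show m + 1 - 1 + y + 2 - (m + 1) = y + 1 by omega] at h0
  obtain ⟨z, hz⟩ : ∃ z, 2 * (m + 1) - 1 - (m + 1 - 1 + y) = z := ⟨_, rfl⟩
  have hz' : (z : ℤ) = m + 1 - y := by omega
  rw [hz]
  have e1 := six_mul_choose_three (y + 3)
  have e2 := six_mul_choose_three (y + 2)
  have e3 := six_mul_choose_three (y + 1)
  have e4 := six_mul_choose_three z
  have e5 := six_mul_choose_three (m + 1 - 1 + y + 3)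
  rw [hz'] at e4
  simp only [Nat.add_sub_cancel] at h0 e5 ⊢
  push_cast at e1 e2 e3 e5 h0
  have key : (6 : ℤ) * ((hilbertFun I (m + y) : ℤ) + (z.choose 3 : ℤ)) =
      6 * ((m + y + 3).choose 3 : ℤ) := by
    rw [mul_add, e4, e5, h0]
    linear_combination ((m : ℤ) + 1) ^ 2 * e1 - (2 * ((m : ℤ) + 1) ^ 2 - 2) * e2 +
      ((m : ℤ) + 1) ^ 2 * e3
  have := mul_left_cancel₀ (by norm_num : (6 : ℤ) ≠ 0) key
  exact_mod_cast this

/-- The leading monomials of a reverse lexicographic ideal with the generic Hilbert function are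
those in which the last variable has a small exponent. -/
theorem mem_leadingMonomials_iff_lastExp_lt {s : ℕ} {F : Fin s → MvPolynomial (Fin 4) 𝕜}
    (hF : ∀ i, (F i).IsHomogeneous (n - 1))
    (hrev : IsReverseLex (Ideal.span (Set.range F)))
    (hgen : HasGenericHilbertFun n (Ideal.span (Set.range F)))
    (hn : 3 ≤ n) (h1 : n - 1 ≤ D) (h2 : D ≤ 2 * n - 3) (c : MonDeg D) :
    c.1 ∈ leadingMonomials (Ideal.span (Set.range F)) ↔ lastExp c < 2 * (D + 2 - n) := by
  classical
  set L := leadingMonomials (Ideal.span (Set.range F)) with hL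
  let U : Finset (MonDeg D) := Finset.univ.filter fun c => c.1 ∉ L
  let T : Finset (MonDeg D) := Finset.univ.filter fun c => 2 * (D + 2 - n) ≤ lastExp c
  have hU : ∀ c, c ∈ U ↔ c.1 ∉ L := fun c => by simp [U]
  have hT : ∀ c, c ∈ T ↔ 2 * (D + 2 - n) ≤ lastExp c := fun c => by simp [T]
  have hTcard : T.card = (2 * n - 1 - D).choose 3 := by
    rw [show 2 * n - 1 - D = D + 3 - 2 * (D + 2 - n) by omega, ← card_le_lastExp,
      Fintype.card_subtype]
  have hUcard : U.card = (2 * n - 1 - D).choose 3 := by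
    have e1 := hgen.add_choose hn h1 h2
    rw [hilbertFun_eq_card_leadingMonomials hF h1, Nat.card_eq_fintype_card,
      Fintype.card_subtype, ← hL] at e1
    have e2 := Finset.card_filter_add_card_filter_not (s := (Finset.univ : Finset (MonDeg D)))
      (fun c => c.1 ∈ L)
    rw [Finset.card_univ, card_monDeg] at e2
    change (Finset.univ.filter fun c : MonDeg D => c.1 ∉ L).card = _
    omega
  have hUT : U = T := by
    -- Both complements are closed under passing to smaller monomials of the same degree, and such
    -- sets form a chain. Equal cardinality then forces equality.
    have hor : U ⊆ T ∨ T ⊆ U := by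
      by_contra! hcon
      obtain ⟨x, hxU, hxT⟩ := Finset.not_subset.1 hcon.1
      obtain ⟨y, hyT, hyU⟩ := Finset.not_subset.1 hcon.2
      rw [hU] at hxU hyU
      rw [hT] at hxT hyT
      rw [not_not] at hyU
      have hd : x.1.degree = y.1.degree := x.degree_eq.trans y.degree_eq.symm
      rcases trichotomous_of GrevlexLT x.1 y.1 with h | h | h
      · exact hxT (hyT.trans (h.apply_three_le hd))
      · exact hxU (h ▸ hyU)
      · exact hxU (hrev.2 _ hyU _ hd h)
    rcases hor with h | h
    · exact Finset.eq_of_subset_of_card_le h (by omega)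
    · exact (Finset.eq_of_subset_of_card_le h (by omega)).symm
  rw [← not_iff_not, ← hU, hUT, hT, not_lt]

end GenericHilbertFunction

/-! ### The minors as homogeneous generators -/

section Minors

variable {𝕜 : Type*} [Field 𝕜] {n : ℕ}

theorem isHomogeneous_minor {M : Matrix (Fin n) (Fin n) (MvPolynomial (Fin 4) 𝕜)}
    (hM : ∀ i j, (M i j).IsHomogeneous 1) (p : (Fin (n - 1) ↪o Fin n) × (Fin (n - 1) ↪o Fin n)) :
    (minor M p).IsHomogeneous (n - 1) := by
  rw [minor, Matrix.det_apply]
  refine IsHomogeneous.sum _ _ _ fun σ _ => ?_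
  have h : (∏ i, (M.submatrix p.1 p.2) (σ i) i).IsHomogeneous (n - 1) := by
    have := IsHomogeneous.prod Finset.univ (fun i => (M.submatrix p.1 p.2) (σ i) i)
      (fun _ => 1) fun i _ => hM _ _
    simpa using this
  rcases Int.units_eq_one_or (Equiv.Perm.sign σ) with hs | hs
  · simpa [hs] using h
  · simpa [hs] using h.neg

theorem detIdeal_eq_span {s : ℕ} (M : Matrix (Fin n) (Fin n) (MvPolynomial (Fin 4) 𝕜))
    (ord : Fin s ≃ (Fin (n - 1) ↪o Fin n) × (Fin (n - 1) ↪o Fin n)) :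
    detIdeal M = Ideal.span (Set.range fun i => minor M (ord i)) := by
  rw [detIdeal]
  congr 1
  exact (ord.surjective.range_comp (minor M)).symm

end Minors

/-! ### The cost estimate -/

section Cost

/-- Writing k^ω = k² x with x = k^(ω-2) ≥ 1, each block product of size k costs at most (|c|+1) k²
x, block additions included. The k² is absorbed by the block counts through uk ≤ 2β and vk ≤ 2γ. -/
theorem reductionCost_le {ω c : ℝ} (hω : 2 ≤ ω) {e k β γ r u v μ ν : ℕ} (he : 1 ≤ e)
    (hek : e ≤ k) (hkβ : k ≤ β) (hr : r ≤ β + k) (hu : u * k ≤ 2 * β) (hv : v * k ≤ 2 * γ)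
    (hμ : (μ : ℝ) ≤ |c| * (k : ℝ) ^ ω) (hν : (ν : ℝ) ≤ |c| * (e : ℝ) ^ ω)
    (h5 : e ^ 5 ≤ 12 * (β * γ)) :
    (reductionCost r (β + γ) k u v e e μ ν : ℝ) ≤ (200 + 50 * |c|) *
      ((β : ℝ) ^ 2 * (k : ℝ) ^ (ω - 2) + (k : ℝ) ^ (ω - 2) * β * γ) := by
  have hk1 : (1 : ℝ) ≤ k := by exact_mod_cast he.trans hek
  have he1 : (1 : ℝ) ≤ e := by exact_mod_cast he
  obtain ⟨x, hx⟩ : ∃ x, (k : ℝ) ^ (ω - 2) = x := ⟨_, rfl⟩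
  obtain ⟨y, hy⟩ : ∃ y, (e : ℝ) ^ (ω - 2) = y := ⟨_, rfl⟩
  have hx1 : 1 ≤ x := hx ▸ Real.one_le_rpow hk1 (by linarith)
  have hy1 : 1 ≤ y := hy ▸ Real.one_le_rpow he1 (by linarith)
  have hyx : y ≤ x := by
    rw [← hx, ← hy]
    exact Real.rpow_le_rpow (by positivity) (by exact_mod_cast hek) (by linarith)
  have hkω : (k : ℝ) ^ ω = k ^ 2 * x := by
    rw [← hx, ← Real.rpow_natCast, ← Real.rpow_add (by linarith)]
    congr 1
    push_cast
    ring
  have heω : (e : ℝ) ^ ω = e ^ 2 * y := by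
    rw [← hy, ← Real.rpow_natCast, ← Real.rpow_add (by linarith)]
    congr 1
    push_cast
    ring
  rw [hkω] at hμ
  rw [heω] at hν
  rw [hx]
  obtain ⟨c', hc'⟩ : ∃ c', |c| = c' := ⟨_, rfl⟩
  have hc0 : 0 ≤ c' := hc' ▸ abs_nonneg c
  rw [hc'] at hμ hν ⊢
  have hkβ' : (k : ℝ) ≤ β := by exact_mod_cast hkβ
  have hr' : (r : ℝ) ≤ β + k := by exact_mod_cast hr
  have hu' : (u : ℝ) * k ≤ 2 * β := by exact_mod_cast hu
  have hv' : (v : ℝ) * k ≤ 2 * γ := by exact_mod_cast hv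
  have h5' : (e : ℝ) ^ 5 ≤ 12 * (β * γ) := by exact_mod_cast h5
  have hβ0 : (0 : ℝ) ≤ β := Nat.cast_nonneg _
  have hγ0 : (0 : ℝ) ≤ γ := Nat.cast_nonneg _
  have hu0 : (0 : ℝ) ≤ u := Nat.cast_nonneg _
  have hv0 : (0 : ℝ) ≤ v := Nat.cast_nonneg _
  have hμk : (μ : ℝ) + k ^ 2 ≤ k ^ 2 * ((c' + 1) * x) := by
    have : (k : ℝ) ^ 2 * 1 ≤ k ^ 2 * x := by gcongr
    nlinarith
  have huv : (u : ℝ) * v * (μ + k ^ 2) ≤ 4 * (β * γ) * ((c' + 1) * x) := by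
    calc (u : ℝ) * v * (μ + k ^ 2) ≤ u * v * (k ^ 2 * ((c' + 1) * x)) := by gcongr
      _ = (u * k) * (v * k) * ((c' + 1) * x) := by ring
      _ ≤ (2 * β) * (2 * γ) * ((c' + 1) * x) := by gcongr
      _ = _ := by ring
  have hvv : (v : ℝ) * (μ + k ^ 2) ≤ 2 * (β * γ) * ((c' + 1) * x) := by
    calc (v : ℝ) * (μ + k ^ 2) ≤ v * (k ^ 2 * ((c' + 1) * x)) := by gcongr
      _ = k * (v * k) * ((c' + 1) * x) := by ring
      _ ≤ β * (2 * γ) * ((c' + 1) * x) := by gcongr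
      _ = _ := by ring
  have hββ : (β : ℝ) ^ 2 ≤ β ^ 2 * x := le_mul_of_one_le_right (by positivity) hx1
  have hβγ : (β : ℝ) * γ ≤ β * γ * x := le_mul_of_one_le_right (by positivity) hx1
  have hrN : (r : ℝ) * (β + γ) ≤ 2 * (β ^ 2 * x + β * γ * x) := by
    calc (r : ℝ) * (β + γ) ≤ (2 * β) * (β + γ) := by gcongr; linarith
      _ = 2 * (β ^ 2 + β * γ) := by ring
      _ ≤ _ := by linarith
  have hadd : (u : ℝ) * k * (v * k) ≤ 4 * (β * γ * x) := by
    calc (u : ℝ) * k * (v * k) ≤ (2 * β) * (2 * γ) := by gcongr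
      _ = 4 * (β * γ) := by ring
      _ ≤ _ := by linarith
  have hadd' : (k : ℝ) * (v * k) ≤ 2 * (β * γ * x) := by
    calc (k : ℝ) * (v * k) ≤ β * (2 * γ) := by gcongr
      _ = 2 * (β * γ) := by ring
      _ ≤ _ := by linarith
  -- The elimination costs at most (12 + 2|c|) e^5 x, because e^(ω-2) ≤ x; then `h5` compares e^5
  -- with βγ.
  have hel : (e : ℝ) * (e * (e * e * (4 * e + 4)) + 2 * (e ^ 2 * (ν + e ^ 2) + (e * e) ^ 2)) ≤
      (144 + 24 * c') * (β * γ * x) := by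
    have h45 : (e : ℝ) ^ 4 ≤ e ^ 5 := pow_le_pow_right₀ he1 (by norm_num)
    have h5x : (e : ℝ) ^ 5 ≤ e ^ 5 * x := le_mul_of_one_le_right (by positivity) hx1
    have hνx : (e : ℝ) ^ 3 * ν ≤ c' * (e ^ 5 * x) := by
      calc (e : ℝ) ^ 3 * ν ≤ e ^ 3 * (c' * (e ^ 2 * y)) := by gcongr
        _ ≤ e ^ 3 * (c' * (e ^ 2 * x)) := by gcongr
        _ = _ := by ring
    have h5γ : (e : ℝ) ^ 5 * x ≤ 12 * (β * γ) * x := by gcongr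
    calc (e : ℝ) * (e * (e * e * (4 * e + 4)) + 2 * (e ^ 2 * (ν + e ^ 2) + (e * e) ^ 2))
        = 4 * e ^ 4 + 8 * e ^ 5 + 2 * (e ^ 3 * ν) := by ring
      _ ≤ 12 * (e ^ 5 * x) + 2 * (c' * (e ^ 5 * x)) := by linarith
      _ = (12 + 2 * c') * (e ^ 5 * x) := by ring
      _ ≤ (12 + 2 * c') * (12 * (β * γ) * x) := by gcongr
      _ = _ := by ring
  have hβγx : 0 ≤ (β : ℝ) * γ * x := by positivity
  have hββx : 0 ≤ (β : ℝ) ^ 2 * x := by positivity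
  have hc1 : 0 ≤ c' * ((β : ℝ) * γ * x) := by positivity
  have hc2 : 0 ≤ c' * ((β : ℝ) ^ 2 * x) := by positivity
  simp only [reductionCost]
  push_cast
  nlinarith

end Cost

/-! ### Computation trees for near-echelon matrices -/

section Main

/-- If there are no columns of level above `a`, then the row space is the whole space. -/
theorem IsNearEchelon.span_eq_top {𝕜 C : Type*} [Field 𝕜] [Fintype C] {lev : C → ℕ}
    {a r : ℕ} {A : Matrix (Fin r) C 𝕜} (hA : IsNearEchelon lev a A) (hlev : ∀ c, lev c ≤ a) :
    Fintype.card C ≤ r ∧ Submodule.span 𝕜 (Set.range fun i => A i) = ⊤ := by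
  classical
  choose p hp using fun c : Low lev a => hA.cover c c.2
  constructor
  · have hinj : Function.Injective fun c => p ⟨c, hlev c⟩ := by
      intro c c' h
      have h1 := hp ⟨c, hlev c⟩
      have h2 := hp ⟨c', hlev c'⟩
      rw [← show p ⟨c, _⟩ = p ⟨c', _⟩ from h] at h2
      exact h2.unique (hlev c') (hlev c) (by rw [h1.1]; exact one_ne_zero) h1.2
    simpa using Fintype.card_le_of_injective _ hinj
  · rw [span_reduced hp, eq_top_iff]
    intro v _
    rw [pi_eq_sum_univ' v]
    refine Submodule.sum_mem _ fun c _ => Submodule.smul_mem _ _ (Submodule.subset_span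
      ⟨.inl ⟨c, hlev c⟩, ?_⟩)
    funext x
    rw [Sum.elim_inl, pivotRow_low _ (hlev x), Pi.single_apply]

variable {𝕜 : Type*} [Field 𝕜]

/-- If every column is a pivot column, the reduced row echelon form is returned at no cost. -/
theorem exists_tree_of_full {d a r : ℕ} (hda : d ≤ a) :
    ∃ t : CompTree 𝕜 (Fin r × MonDeg d) (Fin r × MonDeg d),
      ∀ A : Matrix (Fin r) (MonDeg d) 𝕜, IsNearEchelon lastExp a A →
        ∃ E : Matrix (Fin r) (MonDeg d) 𝕜,
          t.Computes (fun p => A p.1 p.2) (fun p => E p.1 p.2) 0 ∧ IsRREFOf A E := by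
  classical
  let _ := monDegLinearOrder d
  have hlev : ∀ c : MonDeg d, lastExp c ≤ a := by
    intro c
    have h := c.degree_eq
    rw [degree_fin_four] at h
    change c.1 3 ≤ a
    omega
  by_cases hr : Fintype.card (MonDeg d) ≤ r
  · obtain ⟨σ, hσ, hσ'⟩ := exists_row_order (id : MonDeg d → MonDeg d) Function.injective_id hr
    let E : Matrix (Fin r) (MonDeg d) 𝕜 :=
      Matrix.of fun i c => (σ i).elim 0 fun j => (Pi.single j 1 : MonDeg d → 𝕜) c
    refine ⟨.output fun p => .const (E p.1 p.2), fun A hA => ⟨E, rfl, ?_, ?_⟩⟩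
    · refine isReducedRowEchelon_of_pivots hσ' (fun j => ?_) (fun j j' h => ?_) fun j c h => ?_
      · exact Pi.single_eq_same _ _
      · exact Pi.single_eq_of_ne h.ne' _
      · exact Pi.single_eq_of_ne h.ne _
    · rw [(hA.span_eq_top hlev).2]
      refine (span_range_option_elim hσ fun j => (Pi.single j 1 : MonDeg d → 𝕜)).trans ?_
      rw [eq_top_iff]
      intro v _
      rw [pi_eq_sum_univ' v]
      refine Submodule.sum_mem _ fun c _ => Submodule.smul_mem _ _ (Submodule.subset_span ⟨c, ?_⟩)
      rfl
  -- With fewer rows than columns there is no instance, so any tree will do.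
  · exact ⟨.output fun _ => .const 0, fun A hA => absurd (hA.span_eq_top hlev).1 hr⟩

theorem two_mul_choose_two_succ (e : ℕ) : 2 * (e + 1).choose 2 = (e + 1) * e := by
  rw [Nat.choose_two_right, Nat.mul_div_cancel' (Nat.even_mul_pred_self _).two_dvd]
  rfl

theorem six_mul_choose_three_add_two (e : ℕ) :
    6 * (e + 2).choose 3 = (e + 2) * (e + 1) * e := by
  have h := six_mul_choose_three (e + 2)
  push_cast at h
  have h' : (6 : ℤ) * (e + 2).choose 3 = (e + 2) * (e + 1) * e := by rw [h]; ring
  exact_mod_cast h'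

theorem le_choose_two_succ {e : ℕ} (he : 1 ≤ e) : e ≤ (e + 1).choose 2 := by
  have := two_mul_choose_two_succ e
  nlinarith

theorem choose_two_succ_le_sq {e : ℕ} (he : 1 ≤ e) : (e + 1).choose 2 ≤ e * e := by
  have := two_mul_choose_two_succ e
  nlinarith

theorem choose_two_add_two_le {e : ℕ} (he : 1 ≤ e) :
    (e + 2).choose 2 ≤ 3 * (e + 1).choose 2 := by
  have h := le_choose_two_succ he
  have h' := Nat.choose_succ_succ (e + 1) 1
  change (e + 2).choose 2 = (e + 1).choose 1 + (e + 1).choose 2 at h'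
  rw [Nat.choose_one_right] at h'
  omega

theorem pow_five_le {e β : ℕ} (h : (e + 1).choose 2 ≤ β) :
    e ^ 5 ≤ 12 * (β * (e + 2).choose 3) := by
  have h1 : e ^ 2 ≤ 2 * (e + 1).choose 2 := by
    rw [two_mul_choose_two_succ]; nlinarith
  have h3 : e ^ 3 ≤ 6 * (e + 2).choose 3 := by
    rw [six_mul_choose_three_add_two, pow_succ, pow_two]
    gcongr <;> omega
  calc e ^ 5 = e ^ 2 * e ^ 3 := by ring
    _ ≤ (2 * β) * (6 * (e + 2).choose 3) := Nat.mul_le_mul (h1.trans (by omega)) h3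
    _ = _ := by ring

theorem le_div_add_one_mul {k : ℕ} (hk : 0 < k) (x : ℕ) : x ≤ (x / k + 1) * k := by
  rw [Nat.add_mul, Nat.one_mul]
  exact (Nat.lt_div_mul_add hk).le

theorem div_add_one_mul_le {k x : ℕ} (hk : k ≤ x) : (x / k + 1) * k ≤ 2 * x := by
  rw [Nat.add_mul, Nat.one_mul]
  have := Nat.div_mul_le_self x k
  omega

theorem floor_mul_rpow_le (c ω : ℝ) (b : ℕ) :
    (⌊c * (b : ℝ) ^ ω⌋₊ : ℝ) ≤ |c| * (b : ℝ) ^ ω := by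
  have h0 : 0 ≤ |c| * (b : ℝ) ^ ω := by positivity
  refine (Nat.cast_le.2 (Nat.floor_le_floor ?_)).trans (Nat.floor_le h0)
  exact mul_le_mul_of_nonneg_right (le_abs_self c) (by positivity)

/-- The reduction of near-echelon matrices by a computation tree, for given block sizes. -/
theorem exists_tree_of_card {C : Type*} [Fintype C] [LinearOrder C] {lev : C → ℕ}
    (hlev : Monotone lev) {ω c : ℝ} (hω : 2 ≤ ω) (hmul : IsMatMulExponent 𝕜 ω c)
    {a e r k β γ : ℕ} (hlow : Fintype.card (Low lev a) = β)
    (hhigh : Fintype.card (High lev a) = γ)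
    (hnext : Fintype.card (AtLevel lev (a + 1)) = k)
    (hmid : Fintype.card (AtLevel lev a) ≤ 3 * k) (he : 1 ≤ e) (hek : e ≤ k) (hke : k ≤ e * e)
    (hkβ : k ≤ β) (hkγ : k ≤ γ) (h5 : e ^ 5 ≤ 12 * (β * γ)) (hr : r ≤ β + k) :
    ∃ t : CompTree 𝕜 (Fin r × C) (Fin r × C),
      ∀ A : Matrix (Fin r) C 𝕜, IsNearEchelon lev a A →
        ∃ (y : Fin r × C → 𝕜) (cost : ℕ), t.Computes (fun p => A p.1 p.2) y cost ∧
          (Matrix.IsReducedRowEchelon (Matrix.of fun i c => y (i, c)) ∧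
            Submodule.span 𝕜 (Set.range fun i c => y (i, c)) =
              Submodule.span 𝕜 (Set.range fun i => A i)) ∧
          (cost : ℝ) ≤ (200 + 50 * |c|) *
            ((β : ℝ) ^ 2 * (k : ℝ) ^ (ω - 2) + (k : ℝ) ^ (ω - 2) * β * γ) := by
  have hk0 : 0 < k := he.trans hek
  have hcan := can_reduce (𝕜 := 𝕜) (lev := lev) (a := a) (r := r)
    (u := β / k + 1) (v := γ / k + 1) (q := e) (b := e) (μ := ⌊c * (k : ℝ) ^ ω⌋₊)
    (ν := ⌊c * (e : ℝ) ^ ω⌋₊) hlev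
    (by rw [hnext]; exact hmul.hasMulTree k) (hmul.hasMulTree e)
    (by rw [hnext]; exact hk0) (by rw [hlow, hnext]; exact hr)
    (by rw [hlow, hnext]; exact le_div_add_one_mul hk0 β)
    (by rw [hhigh, hnext]; exact le_div_add_one_mul hk0 γ)
    (by rw [hnext]; exact hmid) (by rw [hnext]; exact hke)
    (P := {A | IsNearEchelon lev a A}) (fun A hA => hA)
  obtain ⟨t, ht⟩ := Can.exists_tree
    (fun (A : Matrix (Fin r) C 𝕜) (p : Fin r × C) => A p.1 p.2)
    (fun A y => Matrix.IsReducedRowEchelon (Matrix.of fun i c => y (i, c)) ∧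
      Submodule.span 𝕜 (Set.range fun i c => y (i, c)) =
        Submodule.span 𝕜 (Set.range fun i => A i)) hcan
  refine ⟨t, fun A hA => ?_⟩
  obtain ⟨y, cost, hrun, hy, hcost⟩ := ht A hA
  refine ⟨y, cost, hrun, hy, (Nat.cast_le.2 hcost).trans ?_⟩
  rw [hnext, ← card_low_add_high lev a, hlow, hhigh]
  exact reductionCost_le hω he hek hkβ hr (div_add_one_mul_le hkβ) (div_add_one_mul_le hkγ)
    (floor_mul_rpow_le c ω k) (floor_mul_rpow_le c ω e) h5

/-- The reduction of near-echelon matrices in the columns given by monomials. -/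
theorem exists_tree_of_isNearEchelon {ω c : ℝ} (hω : 2 ≤ ω) (hmul : IsMatMulExponent 𝕜 ω c)
    {d a e r : ℕ} (he : 1 ≤ e) (hd : d + 1 = a + e)
    (hr : r ≤ Fintype.card (Low (lastExp : MonDeg (d + 1) → ℕ) a) + (e + 1).choose 2) :
    ∃ t : CompTree 𝕜 (Fin r × MonDeg (d + 1)) (Fin r × MonDeg (d + 1)),
      ∀ A : Matrix (Fin r) (MonDeg (d + 1)) 𝕜, IsNearEchelon lastExp a A →
        ∃ (E : Matrix (Fin r) (MonDeg (d + 1)) 𝕜) (cost : ℕ),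
          t.Computes (fun p => A p.1 p.2) (fun p => E p.1 p.2) cost ∧ IsRREFOf A E ∧
          (cost : ℝ) ≤ (200 + 50 * |c|) *
            ((Fintype.card (Low (lastExp : MonDeg (d + 1) → ℕ) a) : ℝ) ^ 2 *
                ((e + 1).choose 2 : ℝ) ^ (ω - 2) +
              ((e + 1).choose 2 : ℝ) ^ (ω - 2) *
                Fintype.card (Low (lastExp : MonDeg (d + 1) → ℕ) a) * ((e + 2).choose 3 : ℝ)) := by
  let _ := monDegLinearOrder (d + 1)
  have hnext : Fintype.card (AtLevel (lastExp : MonDeg (d + 1) → ℕ) (a + 1)) =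
      (e + 1).choose 2 := by
    rw [card_atLevel _ _ (by omega), show d + 1 + 2 - (a + 1) = e + 1 by omega]
  have hmid : Fintype.card (AtLevel (lastExp : MonDeg (d + 1) → ℕ) a) = (e + 2).choose 2 := by
    rw [card_atLevel _ _ (by omega), show d + 1 + 2 - a = e + 2 by omega]
  have hhigh : Fintype.card (High (lastExp : MonDeg (d + 1) → ℕ) a) = (e + 2).choose 3 := by
    rw [card_high, show d + 1 + 2 - a = e + 2 by omega]
  have hmidlow : Fintype.card (AtLevel (lastExp : MonDeg (d + 1) → ℕ) a) ≤
      Fintype.card (Low (lastExp : MonDeg (d + 1) → ℕ) a) :=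
    Fintype.card_subtype_mono _ _ fun c hc => le_of_eq hc
  have hkβ : (e + 1).choose 2 ≤ Fintype.card (Low (lastExp : MonDeg (d + 1) → ℕ) a) :=
    (Nat.choose_le_choose 2 (by omega)).trans (hmid.symm.le.trans hmidlow)
  have hkγ : (e + 1).choose 2 ≤ (e + 2).choose 3 :=
    (Nat.le_add_right _ _).trans (Nat.choose_succ_succ (e + 1) 2).ge
  obtain ⟨t, ht⟩ := exists_tree_of_card (𝕜 := 𝕜) (lastExp_monotone (d + 1)) hω hmul rfl hhigh
    hnext (hmid.trans_le (choose_two_add_two_le he)) he (le_choose_two_succ he)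
    (choose_two_succ_le_sq he) hkβ hkγ (pow_five_le hkβ) hr
  refine ⟨t, fun A hA => ?_⟩
  obtain ⟨y, cost, hrun, hy, hcost⟩ := ht A hA
  exact ⟨Matrix.of fun i c => y (i, c), cost, hrun, hy, hcost⟩

end Main

end DetGB

end

theorem mainTheorem7 (ω c : ℝ) (hω₂ : 2 ≤ ω) (hω₃ : ω ≤ 3) :
    ∃ C : ℝ, 0 < C ∧
      ∀ (𝕜 : Type*) [Field 𝕜], DetGB.IsMatMulExponent 𝕜 ω c →
      ∀ n d : ℕ, 3 ≤ n → n - 1 ≤ d → d ≤ 2 * n - 3 →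
      ∀ r : ℕ, ∃ t : DetGB.CompTree 𝕜 (Fin r × DetGB.MonDeg (d + 1))
          (Fin r × DetGB.MonDeg (d + 1)),
        ∀ M : Matrix (Fin n) (Fin n) (MvPolynomial (Fin 4) 𝕜),
          (∀ i j, (M i j).IsHomogeneous 1) →
          DetGB.IsReverseLex (DetGB.detIdeal M) →
          DetGB.HasGenericHilbertFun n (DetGB.detIdeal M) →
        ∀ (ord : Fin (n ^ 2) ≃ (Fin (n - 1) ↪o Fin n) × (Fin (n - 1) ↪o Fin n))
          (A : Matrix (Fin r) (DetGB.MonDeg (d + 1)) 𝕜),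
          DetGB.IsBuiltMatrix (fun i => DetGB.minor M (ord i)) (n - 1) d A →
          ∃ (E : Matrix (Fin r) (DetGB.MonDeg (d + 1)) 𝕜) (cost : ℕ),
            t.Computes (fun p => A p.1 p.2) (fun p => E p.1 p.2) cost ∧
            DetGB.IsRREFOf A E ∧
            (cost : ℝ) ≤ C *
              (DetGB.betaSucc n d (DetGB.detIdeal M) ^ 2 * DetGB.alphaSucc n d ^ (ω - 2) +
                DetGB.alphaSucc n d ^ (ω - 2) * DetGB.betaSucc n d (DetGB.detIdeal M) *
                  DetGB.gammaSucc n d (DetGB.detIdeal M)) := by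
  refine ⟨200 + 50 * |c|, by positivity, fun 𝕜 _ hmul n d hn hd1 hd2 r => ?_⟩
  -- In terms of `e`, α is `(e + 1).choose 2`; `e` also serves as the number and the width of the
  -- panels.
  obtain ⟨e, he⟩ : ∃ e, d + e = 2 * n - 3 := ⟨2 * n - 3 - d, by omega⟩
  obtain ⟨a, ha⟩ : ∃ a, a = 2 * (d + 2 - n) := ⟨_, rfl⟩
  have hda : d + 1 = a + e := by omega
  have hαe : DetGB.alphaSucc n d = ((e + 1).choose 2 : ℕ) := by
    have h : (d : ℝ) + e = 2 * n - 3 := by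
      have h' : d + e + 3 = 2 * n := by omega
      have : (d : ℝ) + e + 3 = 2 * n := by exact_mod_cast h'
      linarith
    rw [DetGB.alphaSucc, Nat.cast_choose_two]
    push_cast
    rw [show (d : ℝ) = 2 * n - 3 - e by linarith]
    ring
  -- For e = 0 we have α = 0, and the bound is zero when ω > 2, so the tree must be free. Here d + 1
  -- = a: every monomial is a pivot, and the reduced form is known in advance.
  rcases Nat.eq_zero_or_pos e with rfl | hepos
  · obtain ⟨t, ht⟩ := DetGB.exists_tree_of_full (𝕜 := 𝕜) (d := d + 1) (a := a) (r := r) (by omega)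
    refine ⟨t, fun M hM hrev hgen ord A hA => ?_⟩
    have hF := fun i => DetGB.isHomogeneous_minor hM (ord i)
    have hle := DetGB.hilbertFun_le (DetGB.detIdeal M) (d + 1)
    rw [DetGB.detIdeal_eq_span M ord] at hrev hgen
    have hnear := hA.isNearEchelon (a := a) hF hd1 (by omega)
      (fun m => by
        rw [ha]
        exact DetGB.mem_leadingMonomials_iff_lastExp_lt hF hrev hgen hn hd1 hd2 m)
      (fun m _ => by
        have h := m.degree_eq
        rw [DetGB.degree_fin_four] at h
        change m.1 3 ≤ a + 1
        omega)
    obtain ⟨E, hrun, hE⟩ := ht A hnear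
    refine ⟨E, 0, hrun, hE, ?_⟩
    have hα0 : DetGB.alphaSucc n d = 0 := by rw [hαe]; simp
    have hβ : 0 ≤ DetGB.betaSucc n d (DetGB.detIdeal M) := by
      rw [DetGB.betaSucc, hα0, sub_zero]
      positivity
    have hγ : 0 ≤ DetGB.gammaSucc n d (DetGB.detIdeal M) := by
      rw [DetGB.gammaSucc, DetGB.betaSucc, hα0, sub_zero, sub_nonneg]
      exact_mod_cast hle
    have hα : 0 ≤ DetGB.alphaSucc n d := hα0.ge
    rw [Nat.cast_zero]
    positivity
  have hcard := DetGB.card_low_add_high (DetGB.lastExp : DetGB.MonDeg (d + 1) → ℕ) a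
  rw [DetGB.card_high, DetGB.card_monDeg, show d + 1 + 2 - a = e + 2 by omega] at hcard
  have hhilb : ∀ M : Matrix (Fin n) (Fin n) (MvPolynomial (Fin 4) 𝕜),
      DetGB.HasGenericHilbertFun n (DetGB.detIdeal M) →
      DetGB.hilbertFun (DetGB.detIdeal M) (d + 1) =
        Fintype.card (DetGB.Low (DetGB.lastExp : DetGB.MonDeg (d + 1) → ℕ) a) +
          (e + 1).choose 2 := by
    intro M hgen
    -- For e ≥ 1 the degree d + 1 is still in the range of the Hilbert function formula.
    have h := hgen.add_choose hn (D := d + 1) (by omega) (by omega)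
    rw [show 2 * n - 1 - (d + 1) = e + 1 by omega] at h
    have hp := Nat.choose_succ_succ (e + 1) 2
    change (e + 2).choose 3 = (e + 1).choose 2 + (e + 1).choose 3 at hp
    omega
  by_cases hr : r ≤ Fintype.card (DetGB.Low (DetGB.lastExp : DetGB.MonDeg (d + 1) → ℕ) a) +
      (e + 1).choose 2
  swap
  -- A built matrix has at most h_{d+1} rows, so for larger `r` the claim is vacuous.
  · refine ⟨.output fun _ => .const 0, fun M hM hrev hgen ord A hA => absurd ?_ hr⟩
    have hF := fun i => DetGB.isHomogeneous_minor hM (ord i)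
    rw [← hhilb M hgen, DetGB.detIdeal_eq_span M ord]
    exact hA.card_rows_le hF
  obtain ⟨t, ht⟩ := DetGB.exists_tree_of_isNearEchelon hω₂ hmul hepos hda hr
  refine ⟨t, fun M hM hrev hgen ord A hA => ?_⟩
  have hF := fun i => DetGB.isHomogeneous_minor hM (ord i)
  have hβ : DetGB.betaSucc n d (DetGB.detIdeal M) =
      Fintype.card (DetGB.Low (DetGB.lastExp : DetGB.MonDeg (d + 1) → ℕ) a) := by
    rw [DetGB.betaSucc, hαe, hhilb M hgen]
    push_cast
    ring
  have hγ : DetGB.gammaSucc n d (DetGB.detIdeal M) = ((e + 2).choose 3 : ℕ) := by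
    rw [DetGB.gammaSucc, hβ, sub_eq_iff_eq_add', ← Nat.cast_add, hcard]
  rw [hβ, hγ, hαe]
  rw [DetGB.detIdeal_eq_span M ord] at hrev hgen
  exact ht A (hA.isNearEchelon (a := a) hF hd1 (by omega)
    (fun m => by
      rw [ha]
      exact DetGB.mem_leadingMonomials_iff_lastExp_lt hF hrev hgen hn hd1 hd2 m)
    (fun m hm => by
      have h := (DetGB.mem_leadingMonomials_iff_lastExp_lt hF hrev hgen hn (by omega)
        (by omega) m).1 hm
      omega))
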